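/- Let $m\ge 2$ and let $\mu$ be Lebesgue measure on $\mathbb R^m$. Let $\Omega\subset\mathbb R^m$ be a body with piecewise $C^1$ boundary: $\Omega$ is compact, it is the closure of its interior, $\partial\Omega$ has finite $(m-1)$-dimensional area, and $\partial\Omega$ is a $C^1$ hypersurface around each of its points outside a subset of area $0$. Let $\sigma$ be the area ($(m-1)$-dimensional Hausdorff measure, normalised to agree with Lebesgue measure on $(m-1)$-dimensional spaces) on $\partial\Omega$, and let $n=n(y)$ be the outer unit normal vector of $\partial\Omega$ at $y$, which exists for $\sigma$-almost every $y\in\partial\Omega$. Put $A(S^{m-1})=2\pi^{m/2}/\Gamma(m/2)$. For $\alpha\in\mathbb R$ and $x\notin\partial\Omega$ define the renormalized $r^{\alpha-m}$-potential as follows. If $\alpha>0$ or $x\notin\Omega$, then $$V_\Omega^{(\alpha)}(x)=\int_\Omega|x-y|^{\alpha-m}\,d\mu(y);$$ if $\alpha\le0$ and $x$ is an interior point of $\Omega$, then $$V^{(\alpha)}_\Omega(x)=\lim_{\varepsilon\to+0}\left(\int_{\Omega\setminus B_\varepsilon(x)}|x-y|^{\alpha-m}\,d\mu(y)-\frac{A(S^{m-1})}{-\alpha}\cdot\frac1{\varepsilon^{-\alpha}}\right)\quad(\alpha<0),$$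 $$V^{(0)}_\Omega(x)=\lim_{\varepsilon\to+0}\left(\int_{\Omega\setminus B_\varepsilon(x)}|x-y|^{-m}\,d\mu(y)-A(S^{m-1})\log\frac1\varepsilon\right)\quad(\alpha=0).$$ Then for every $\alpha\in\mathbb R$ and every $x\notin\partial\Omega$ the integrals and limits that define $V^{(\alpha)}_\Omega(x)$ exist and are finite, all the integrals below converge absolutely, and $$V_\Omega^{(\alpha)}(x)=\frac1\alpha\int_{\partial\Omega}|x-y|^{\alpha-m}(y-x)\cdot n\,d\sigma(y)\quad(\alpha\ne0),$$ $$V_\Omega^{(0)}(x)=\int_{\partial\Omega}\frac{\log|x-y|}{|x-y|^m}\,(y-x)\cdot n\,d\sigma(y)\quad(\alpha=0).$$ If $m=2$, then moreover, with $s$ the arc-length of $\partial\Omega$, $$V_\Omega^{(\alpha)}(x)=\frac1{\alpha^2}\oint_{\partial\Omega}\left(\nabla_y|x-y|^\alpha\right)\cdot n\,ds=\frac1\alpha\oint_{\partial\Omega}|x-y|^{\alpha-2}\left((y_1-x_1)\,dy_2-(y_2-x_2)\,dy_1\right)\quad(\alpha\ne0),$$ $$V_\Omega^{(0)}(x)=\oint_{\partial\Omega}\log|x-y|\,\left(\nabla_y\log|x-y|\right)\cdot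 n\,ds=\oint_{\partial\Omega}\frac{\log|x-y|}{|x-y|^2}\left((y_1-x_1)\,dy_2-(y_2-x_2)\,dy_1\right)\quad(\alpha=0).$$ Here the contour integral $\oint_{\partial\Omega}\omega$ of a $1$-form $\omega$ is $\int_{\partial\Omega}\omega_y(\tau(y))\,ds(y)$, where $\tau$ is the outer unit normal $n$ rotated by $+\pi/2$; and it is also equal to the sum of the line integrals $\int_{\gamma_i}\omega$ for every parametrization of $\partial\Omega$ by finitely many $C^1$ arcs $\gamma_i$ that cover $\partial\Omega$, do not overlap except at end points, have non-zero velocity except possibly at end points, and have $\Omega$ on their left. -/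

import Mathlib

open MeasureTheory Set Filter Topology InnerProductSpace
open scoped unitInterval Gradient

noncomputable section

/-- `n` is the outer unit normal vector of `Ω` at the boundary point `y`: in some open
neighbourhood `U` of `y` the set `Ω` is the sublevel set `{φ ≤ 0}` of a `C¹` function `φ` with
`φ y = 0` and `∇ φ y ≠ 0` (so that `∂Ω` is a `C¹` hypersurface around `y` and `Ω` lies on one side
of it), and `n = ∇ φ y / ‖∇ φ y‖`. -/
def IsOuterUnitNormal {m : ℕ} (Ω : Set (EuclideanSpace ℝ (Fin m)))
    (y n : EuclideanSpace ℝ (Fin m)) : Prop :=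
  ∃ (U : Set (EuclideanSpace ℝ (Fin m))) (φ : EuclideanSpace ℝ (Fin m) → ℝ),
    IsOpen U ∧ y ∈ U ∧ ContDiffOn ℝ 1 φ U ∧ Ω ∩ U = {z ∈ U | φ z ≤ 0} ∧
      φ y = 0 ∧ ∇ φ y ≠ 0 ∧ n = ‖∇ φ y‖⁻¹ • ∇ φ y

/-- The points of `∂Ω` around which `∂Ω` is a `C¹` hypersurface (bounding `Ω` from one side). -/
def regularBoundary {m : ℕ} (Ω : Set (EuclideanSpace ℝ (Fin m))) :
    Set (EuclideanSpace ℝ (Fin m)) :=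
  {y ∈ frontier Ω | ∃ n, IsOuterUnitNormal Ω y n}

open scoped Classical in
/-- The outer unit normal vector field of `∂Ω` (with the value `0` at the points where there is no
such vector, which for the bodies below form a null set of `∂Ω`). -/
def outerUnitNormal {m : ℕ} (Ω : Set (EuclideanSpace ℝ (Fin m)))
    (y : EuclideanSpace ℝ (Fin m)) : EuclideanSpace ℝ (Fin m) :=
  if h : ∃ n, IsOuterUnitNormal Ω y n then h.choose else 0

/-- A body with piecewise `C¹` boundary: a compact set, equal to the closure of its interior, whose
boundary has finite `(m-1)`-dimensional area and is a `C¹` hypersurface around each of its points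
outside a set of area zero (the edges and corners, automatically a closed set). If `∂Ω` is a finite
union of compact `C¹` pieces which only meet along their boundaries (for example if `Ω` is a compact
`m`-dimensional submanifold or a polyhedron), this is satisfied. The area `σ` is the Hausdorff
measure `μHE[m - 1]`, normalised to agree with Lebesgue measure on `(m-1)`-dimensional spaces. (On
the regular part, as `Ω` is the closure of its interior, it lies on one side of `∂Ω`.) -/
structure IsPiecewiseC1Body {m : ℕ} (Ω : Set (EuclideanSpace ℝ (Fin m))) : Prop where
  isCompact : IsCompact Ω
  closure_interior : closure (interior Ω) = Ω
  area_frontier_ne_top : μHE[m - 1] (frontier Ω) ≠ ⊤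
  area_singular : μHE[m - 1] (frontier Ω \ regularBoundary Ω) = 0

/-- The area `A(S^{m-1})` of the unit sphere of `ℝ^m`. -/
def unitSphereArea (m : ℕ) : ℝ := 2 * Real.pi ^ ((m : ℝ) / 2) / Real.Gamma ((m : ℝ) / 2)

/-- The divergent term that is subtracted in the renormalization for `α ≤ 0`. -/
def divergentTerm (m : ℕ) (α ε : ℝ) : ℝ :=
  if α = 0 then unitSphereArea m * Real.log (1 / ε)
  else unitSphereArea m / (-α) * (1 / ε ^ (-α))

/-- `∫_{Ω \ B_ε(x)} |x - y|^{α - m} dμ(y)` minus the divergent term. -/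
def truncatedPotential {m : ℕ} (Ω : Set (EuclideanSpace ℝ (Fin m))) (α : ℝ)
    (x : EuclideanSpace ℝ (Fin m)) (ε : ℝ) : ℝ :=
  (∫ y in Ω \ Metric.ball x ε, ‖x - y‖ ^ (α - (m : ℝ))) - divergentTerm m α ε

open scoped Classical in
/-- The renormalized `r^{α-m}`-potential `V_Ω^{(α)}(x)`. (If `α ≤ 0` it has no meaning for
`x ∈ ∂Ω`.) -/
def renormalizedPotential {m : ℕ} (Ω : Set (EuclideanSpace ℝ (Fin m))) (α : ℝ)
    (x : EuclideanSpace ℝ (Fin m)) : ℝ :=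
  if α ≤ 0 ∧ x ∈ interior Ω then limUnder (𝓝[>] (0 : ℝ)) (truncatedPotential Ω α x)
  else ∫ y in Ω, ‖x - y‖ ^ (α - (m : ℝ))

/-- The integrals and the limit in the definition of `V_Ω^{(α)}(x)` exist (as finite numbers). -/
def PotentialExists {m : ℕ} (Ω : Set (EuclideanSpace ℝ (Fin m))) (α : ℝ)
    (x : EuclideanSpace ℝ (Fin m)) : Prop :=
  (α ≤ 0 ∧ x ∈ interior Ω →
    (∀ ε > 0, IntegrableOn (fun y => ‖x - y‖ ^ (α - (m : ℝ))) (Ω \ Metric.ball x ε)) ∧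
    ∃ v : ℝ, Tendsto (truncatedPotential Ω α x) (𝓝[>] 0) (𝓝 v)) ∧
  (¬ (α ≤ 0 ∧ x ∈ interior Ω) →
    IntegrableOn (fun y => ‖x - y‖ ^ (α - (m : ℝ))) Ω)

/-- The rotation of the oriented plane by `π / 2`. -/
def rotPlane (v : EuclideanSpace ℝ (Fin 2)) : EuclideanSpace ℝ (Fin 2) := !₂[-v 1, v 0]

/-- The unit tangent vector of the positively oriented boundary of `Ω ⊆ ℝ²` (with `Ω` on the
left). -/
def positiveUnitTangent (Ω : Set (EuclideanSpace ℝ (Fin 2))) (y : EuclideanSpace ℝ (Fin 2)) :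
    EuclideanSpace ℝ (Fin 2) :=
  rotPlane (outerUnitNormal Ω y)

/-- The `1`-form `(y₁ - x₁) dy₂ - (y₂ - x₂) dy₁` in the variable `y` of the plane. -/
def angularForm (x y : EuclideanSpace ℝ (Fin 2)) : EuclideanSpace ℝ (Fin 2) →L[ℝ] ℝ :=
  (y 0 - x 0) • (EuclideanSpace.proj 1 : EuclideanSpace ℝ (Fin 2) →L[ℝ] ℝ) -
    (y 1 - x 1) • (EuclideanSpace.proj 0 : EuclideanSpace ℝ (Fin 2) →L[ℝ] ℝ)

/-- The finitely many `C¹` arcs `γ i` form a parametrization of the positively oriented boundary of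
`Ω ⊆ ℝ²`: they cover `∂Ω`, they do not overlap (except for end points), they have non-vanishing
velocity (except possibly at end points), and the velocity at a regular boundary point is a positive
multiple of the outer normal rotated by `π / 2`, that is, `Ω` lies on the left. -/
structure IsPositiveParametrization (Ω : Set (EuclideanSpace ℝ (Fin 2))) {k : ℕ}
    {a b : Fin k → EuclideanSpace ℝ (Fin 2)} (γ : ∀ i, Path (a i) (b i)) : Prop where
  contDiffOn : ∀ i, ContDiffOn ℝ 1 (γ i).extend I
  deriv_ne_zero : ∀ i, ∀ t ∈ Ioo (0 : ℝ) 1, deriv (γ i).extend t ≠ 0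
  injective : ∀ i j, ∀ s ∈ Ioo (0 : ℝ) 1, ∀ t ∈ Ioo (0 : ℝ) 1,
    (γ i).extend s = (γ j).extend t → i = j ∧ s = t
  iUnion_range : ⋃ i, range (γ i) = frontier Ω
  positive : ∀ i, ∀ t ∈ Ioo (0 : ℝ) 1, ∀ n, IsOuterUnitNormal Ω ((γ i).extend t) n →
    deriv (γ i).extend t = ‖deriv (γ i).extend t‖ • rotPlane n

/-- `v = ∮_{∂Ω} ω`, the integral of the `1`-form `ω` along the positively oriented boundary of
`Ω ⊆ ℝ²`, both as the integral of `ω` applied to the positive unit tangent with respect to the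
arc-length of `∂Ω`, and as the sum of the curve integrals of `ω` over the arcs of any positively
oriented parametrization of `∂Ω`; the existence of these integrals is included. -/
def HasContourIntegral (Ω : Set (EuclideanSpace ℝ (Fin 2)))
    (ω : EuclideanSpace ℝ (Fin 2) → EuclideanSpace ℝ (Fin 2) →L[ℝ] ℝ) (v : ℝ) : Prop :=
  (IntegrableOn (fun y => ω y (positiveUnitTangent Ω y)) (frontier Ω) μHE[1] ∧
    v = ∫ y in frontier Ω, ω y (positiveUnitTangent Ω y) ∂μHE[1]) ∧
  ∀ (k : ℕ) (a b : Fin k → EuclideanSpace ℝ (Fin 2)) (γ : ∀ i, Path (a i) (b i)),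
    IsPositiveParametrization Ω γ →
      (∀ i, CurveIntegrable ω (γ i)) ∧ v = ∑ i, curveIntegral ω (γ i)

end

/-! The proof rests on the divergence theorem for the radial field `K(|y - x|²)(y - x)`, whose
divergence is `2sK'(s) + mK(s)` at `s = |y - x|²`. The choice `K(s) = s^((α-m)/2)` gives `α|y -
x|^(α-m)`. For `α = 0` that field is divergence free, and `K(s) = (1/2) log s · s^(-m/2)` gives `|y
- x|^(-m)` instead. If `x` is an inner point, `K` is replaced on `[0, ε²]` by its tangent at `ε²`,
so that the field becomes `C¹` on the whole space; the ball then contributes exactly `A(S^{m-1})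
K(ε²) ε^m` (`setIntegral_radial_diff_ball`). For `α ≤ 0` this is the subtracted divergent term up to
a factor, so the truncated potential is constant for small `ε`; for `α > 0` it tends to `0`.

The divergence theorem itself (`divergenceDefect_eq_zero`) is proved without a change of variables
on the boundary. For `g ≥ 0` supported near a regular point, `w ↦ ∫_Ω ∂_w g` and `w ↦ ∫_∂Ω g ⟪w, n⟫`
are linear functionals, both nonnegative on a wide cone around the normal `n₀`, hence both nearly
multiples of `⟪n₀, ·⟫`. Their values at `n₀` nearly agree: Fubini along normal lines turns the first
into an integral over the projected boundary, and the projection nearly preserves area. So the two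
sides differ by at most `ε ∫_∂Ω g` (`abs_divergenceDefect_le`). Since this error is relative to `g`,
the errors of a partition of unity add up to at most a multiple of `ε` times the total area, however
many pieces there are, and `ε` is arbitrary.

The singular set is compact and of area zero. Covering it by balls with `∑ r_i^(m-1)` small gives
cutoffs whose gradients tend to `0` in `L¹`, so it does not contribute.

In the plane, rotating the normal by `π/2` turns flux into circulation, and the line integrals over
arcs follow from the length formula for injective `C¹` curves, proved by a similar comparison of
Lipschitz constants. -/

section

/-! ### Flat charts, cones of directions and the outer unit normal -/

/-- In the convex open set `V`, the set `Ω` is the sublevel set `{φ ≤ 0}` of a function `φ` whose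
increments are those of `⟪n₀, ·⟫` up to a relative error `δ`. -/
structure IsFlatChart {E : Type*} [NormedAddCommGroup E] [InnerProductSpace ℝ E]
    (Ω V : Set E) (φ : E → ℝ) (n₀ : E) (δ : ℝ) : Prop where
  convex : Convex ℝ V
  isOpen : IsOpen V
  norm_eq : ‖n₀‖ = 1
  pos : 0 < δ
  lt_half : δ < 1 / 2
  approx : ∀ a ∈ V, ∀ b ∈ V, |φ a - φ b - inner ℝ n₀ (a - b)| ≤ δ * ‖a - b‖
  mem_iff : ∀ z ∈ V, z ∈ Ω ↔ φ z ≤ 0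

section Cone

variable {E : Type*} [NormedAddCommGroup E] [InnerProductSpace ℝ E]

/-- A linear functional which is nonnegative on a wide cone around `n₀` is nearly a multiple of
`⟪n₀, ·⟫`. -/
theorem abs_sub_inner_mul_le_of_nonneg_on_cone {n₀ : E} (hn₀ : ‖n₀‖ = 1) {δ : ℝ} (hδ : 0 < δ)
    (hδ' : δ < 1 / 2) (L : E →ₗ[ℝ] ℝ) (hL : ∀ w, δ * ‖w‖ < inner ℝ n₀ w → 0 ≤ L w) (v : E) :
    |L v - inner ℝ n₀ v * L n₀| ≤ 2 * δ * ‖v‖ * L n₀ := by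
  have hnn : inner ℝ n₀ n₀ = (1 : ℝ) := by rw [real_inner_self_eq_norm_sq, hn₀]; norm_num
  have h0 : 0 ≤ L n₀ := hL n₀ (by rw [hnn, hn₀]; linarith)
  set u : E := v - (inner ℝ n₀ v : ℝ) • n₀ with hu
  have huL : L v - inner ℝ n₀ v * L n₀ = L u := by simp [hu]
  have hnu : inner ℝ n₀ u = (0 : ℝ) := by
    rw [hu, inner_sub_right, inner_smul_right, hnn]; ring
  have huv : ‖u‖ ≤ ‖v‖ := by
    have h1 : inner ℝ u v = inner ℝ u u + inner ℝ n₀ v * inner ℝ u n₀ := by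
      conv_lhs => rw [show v = u + (inner ℝ n₀ v : ℝ) • n₀ by rw [hu]; abel]
      rw [inner_add_right, inner_smul_right]
    rw [real_inner_comm n₀ u, hnu, mul_zero, add_zero, real_inner_self_eq_norm_sq] at h1
    have h2 := real_inner_le_norm u v
    rcases (norm_nonneg u).eq_or_lt with h | h
    · rw [← h]; exact norm_nonneg v
    · nlinarith
  rw [huL]
  rcases eq_or_ne u 0 with h | h
  · rw [h]; simp only [map_zero, abs_zero]; positivity
  have hupos : 0 < ‖u‖ := norm_pos_iff.2 h
  -- The vectors `2δ‖u‖ n₀ ± u` lie in the cone: their norm is at most `(2δ + 1)‖u‖ < 2‖u‖`, while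
  -- their `n₀`-component is `2δ‖u‖`. Here `δ < 1/2` is needed.
  have key : ∀ s : ℝ, |s| = 1 → 0 ≤ 2 * δ * ‖u‖ * L n₀ + s * L u := by
    intro s hs
    have h1 := hL ((2 * δ * ‖u‖) • n₀ + s • u) (by
      rw [inner_add_right, inner_smul_right, inner_smul_right, hnn, hnu]
      have h3 : ‖(2 * δ * ‖u‖) • n₀ + s • u‖ ≤ 2 * δ * ‖u‖ + ‖u‖ := by
        refine (norm_add_le _ _).trans ?_
        rw [norm_smul, norm_smul, hn₀, Real.norm_eq_abs s, hs, Real.norm_of_nonneg (by positivity)]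
        linarith
      have h4 : δ * (2 * δ * ‖u‖ + ‖u‖) < 2 * δ * ‖u‖ := by
        have : 0 < δ * ‖u‖ := by positivity
        nlinarith
      nlinarith)
    simpa using h1
  have h1 := key 1 (by simp)
  have h2 := key (-1) (by simp)
  have h3 : 2 * δ * ‖u‖ * L n₀ ≤ 2 * δ * ‖v‖ * L n₀ := by gcongr
  rw [abs_le]
  constructor <;> linarith

/-- A unit vector which is nonnegative on a wide cone around `n₀` is close to `n₀`. -/
theorem one_sub_le_inner_of_nonneg_on_cone {n₀ n : E} (hn₀ : ‖n₀‖ = 1) (hn : ‖n‖ = 1) {δ : ℝ}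
    (hδ : 0 < δ) (hδ' : δ < 1 / 2) (h : ∀ w, δ * ‖w‖ < inner ℝ n₀ w → 0 ≤ (inner ℝ n w : ℝ)) :
    1 - 2 * δ ≤ inner ℝ n n₀ := by
  -- For the functional `⟪n, ·⟫` and the vector `n` itself, the bound reads `1 - a² ≤ 2δa` with `a =
  -- ⟪n, n₀⟫ ∈ [0, 1]`, and `1 - a ≤ 1 - a²`.
  have h1 := abs_sub_inner_mul_le_of_nonneg_on_cone hn₀ hδ hδ' (innerₛₗ ℝ n) h n
  simp only [innerₛₗ_apply_apply, real_inner_self_eq_norm_sq, hn, real_inner_comm n n₀] at h1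
  have h2 := real_inner_le_norm n n₀
  rw [hn, hn₀] at h2
  have h3 := (abs_le.1 h1).2
  have h4 : (0 : ℝ) ≤ inner ℝ n n₀ := h n₀ (by
    rw [real_inner_self_eq_norm_sq, hn₀]; linarith)
  nlinarith

end Cone

namespace IsFlatChart

variable {E : Type*} [NormedAddCommGroup E] [InnerProductSpace ℝ E]
  {Ω V : Set E} {φ : E → ℝ} {n₀ : E} {δ : ℝ}

/-- The linear part `t⟪n₀, w⟫` of the increment beats the error `δt‖w‖`. Hence, inside `V`, a line
in a direction of the cone can only leave `Ω`, never re-enter it. -/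
theorem lt_add_smul (h : IsFlatChart Ω V φ n₀ δ) {b w : E} {t : ℝ} (ht : 0 < t)
    (hw : δ * ‖w‖ < inner ℝ n₀ w) (hb : b ∈ V) (ha : b + t • w ∈ V) : φ b < φ (b + t • w) := by
  have h1 := h.approx _ ha b hb
  rw [add_sub_cancel_left, inner_smul_right, norm_smul, Real.norm_of_nonneg ht.le] at h1
  have h2 := (abs_le.1 h1).1
  have : t * (δ * ‖w‖) < t * inner ℝ n₀ w := by gcongr
  nlinarith

theorem normal_mem_cone (h : IsFlatChart Ω V φ n₀ δ) : δ * ‖n₀‖ < inner ℝ n₀ n₀ := by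
  rw [real_inner_self_eq_norm_sq, h.norm_eq]
  have := h.lt_half
  linarith

theorem continuousOn (h : IsFlatChart Ω V φ n₀ δ) : ContinuousOn φ V := by
  have : LipschitzOnWith (Real.toNNReal (1 + δ)) φ V := by
    refine LipschitzOnWith.of_dist_le_mul fun a ha b hb => ?_
    rw [Real.coe_toNNReal _ (by linarith [h.pos]), Real.dist_eq, dist_eq_norm]
    have h1 := h.approx a ha b hb
    have h2 := abs_real_inner_le_norm n₀ (a - b)
    rw [h.norm_eq] at h2
    calc |φ a - φ b| = |(φ a - φ b - inner ℝ n₀ (a - b)) + inner ℝ n₀ (a - b)| := by ring_nf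
      _ ≤ _ := (abs_add_le _ _).trans (by linarith)
  exact this.continuousOn

theorem eventually_add_smul_mem (h : IsFlatChart Ω V φ n₀ δ) {y : E} (hy : y ∈ V) (w : E) :
    ∀ᶠ t in 𝓝 (0 : ℝ), y + t • w ∈ V := by
  have : ContinuousAt (fun t : ℝ => y + t • w) 0 := by fun_prop
  exact this.eventually_mem (h.isOpen.mem_nhds (by simpa using hy))

/-- Where `φ ≠ 0`, continuity puts a neighbourhood into `Ω` or into its complement. Where `φ = 0`,
arbitrarily small steps along `n₀` make `φ` positive, so the point is not interior. -/
theorem mem_frontier_iff (h : IsFlatChart Ω V φ n₀ δ) {y : E} (hy : y ∈ V) :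
    y ∈ frontier Ω ↔ φ y = 0 := by
  have hc : ContinuousAt φ y := h.continuousOn.continuousAt (h.isOpen.mem_nhds hy)
  constructor
  · intro hf
    by_contra hne
    rcases lt_or_gt_of_ne hne with hlt | hgt
    · have : Ω ∈ 𝓝 y := by
        filter_upwards [hc.eventually_lt_const hlt, h.isOpen.mem_nhds hy] with z hz hzV
        exact (h.mem_iff z hzV).2 hz.le
      exact hf.2 (mem_interior_iff_mem_nhds.2 this)
    · have : Ωᶜ ∈ 𝓝 y := by
        filter_upwards [hc.eventually_const_lt hgt, h.isOpen.mem_nhds hy] with z hz hzV hzΩ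
        exact absurd ((h.mem_iff z hzV).1 hzΩ) (not_le.2 hz)
      rw [← frontier_compl] at hf
      exact hf.2 (mem_interior_iff_mem_nhds.2 this)
  · intro h0
    refine ⟨subset_closure ((h.mem_iff y hy).2 h0.le), fun hi => ?_⟩
    have h1 : ∀ᶠ t in 𝓝 (0 : ℝ), y + t • n₀ ∈ Ω := by
      have : ContinuousAt (fun t : ℝ => y + t • n₀) 0 := by fun_prop
      exact this.eventually_mem (by simpa using mem_interior_iff_mem_nhds.1 hi)
    obtain ⟨t, ⟨ht1, ht2⟩, ht⟩ := (((h1.and (h.eventually_add_smul_mem hy n₀)).filter_mono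
      nhdsWithin_le_nhds).and self_mem_nhdsWithin : ∀ᶠ t in 𝓝[>] (0 : ℝ), _).exists
    have h2 := h.lt_add_smul ht h.normal_mem_cone hy ht2
    have h3 := (h.mem_iff _ ht2).1 ht1
    linarith

end IsFlatChart

section Normal

variable {m : ℕ} {Ω : Set (EuclideanSpace ℝ (Fin m))}

theorem IsOuterUnitNormal.norm_eq_one {y n : EuclideanSpace ℝ (Fin m)}
    (hn : IsOuterUnitNormal Ω y n) : ‖n‖ = 1 := by
  obtain ⟨U, φ, -, -, -, -, -, h, rfl⟩ := hn
  rw [norm_smul, norm_inv, norm_norm, inv_mul_cancel₀ (norm_ne_zero_iff.2 h)]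

theorem norm_outerUnitNormal_le (Ω : Set (EuclideanSpace ℝ (Fin m))) (y) :
    ‖outerUnitNormal Ω y‖ ≤ 1 := by
  unfold outerUnitNormal
  split_ifs with h
  · exact h.choose_spec.norm_eq_one.le
  · simp

theorem isOuterUnitNormal_outerUnitNormal {y : EuclideanSpace ℝ (Fin m)}
    (hy : y ∈ regularBoundary Ω) : IsOuterUnitNormal Ω y (outerUnitNormal Ω y) := by
  unfold outerUnitNormal
  rw [dif_pos hy.2]
  exact hy.2.choose_spec

/-- The boundary is flat near a regular point, up to an arbitrarily small relative error. -/
theorem IsOuterUnitNormal.exists_isFlatChart {y n : EuclideanSpace ℝ (Fin m)}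
    (hn : IsOuterUnitNormal Ω y n) {δ : ℝ} (hδ : 0 < δ) (hδ' : δ < 1 / 2) :
    ∃ V φ, y ∈ V ∧ IsFlatChart Ω V φ n δ ∧ V ∩ frontier Ω ⊆ regularBoundary Ω := by
  have hn1 := hn.norm_eq_one
  obtain ⟨U, φ, hU, hyU, hφ, hΩ, hy0, hg, rfl⟩ := hn
  have hgn : 0 < ‖∇ φ y‖ := norm_pos_iff.2 hg
  set c := ‖∇ φ y‖ with hc
  have hcd : ContDiffAt ℝ 1 φ y := hφ.contDiffAt (hU.mem_nhds hyU)
  have hstrict : HasStrictFDerivAt φ (fderiv ℝ φ y) y :=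
    hcd.hasStrictFDerivAt one_ne_zero
  have hfd : ∀ w, fderiv ℝ φ y w = inner ℝ (∇ φ y) w := fun w => by
    simp [gradient, toDual_symm_apply]
  have hcont : ContinuousAt (fun z => ∇ φ z) y := by
    have h1 : ContinuousAt (fderiv ℝ φ) y :=
      (hφ.continuousOn_fderiv_of_isOpen hU le_rfl).continuousAt (hU.mem_nhds hyU)
    exact (toDual ℝ _).symm.continuous.continuousAt.comp h1
  have hne : ∀ᶠ z in 𝓝 y, ∇ φ z ≠ 0 := hcont.eventually_ne hg
  -- Strict differentiability gives the two-point estimate that a flat chart asks for; the error `δ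
  -- * c` becomes `δ` once `φ` is divided by `c = ‖∇ φ y‖`.
  have happ := hstrict.isLittleO.def (c := δ * c) (by positivity)
  rw [nhds_prod_eq] at happ
  obtain ⟨s, hs, hs'⟩ := eventually_prod_self_iff'.1 happ
  have hmem : s ∩ U ∩ {z | ∇ φ z ≠ 0} ∈ 𝓝 y :=
    inter_mem (inter_mem hs (hU.mem_nhds hyU)) hne
  obtain ⟨r, hr, hball⟩ := Metric.mem_nhds_iff.1 hmem
  have hchart : IsFlatChart Ω (Metric.ball y r) (fun z => c⁻¹ * φ z) (c⁻¹ • ∇ φ y) δ := by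
    refine ⟨convex_ball _ _, Metric.isOpen_ball, hn1, hδ, hδ', fun a ha b hb => ?_, fun z hz => ?_⟩
    · have h1 := hs' a (hball ha).1.1 b (hball hb).1.1
      simp only [hfd, Real.norm_eq_abs] at h1
      have h2 : c⁻¹ * φ a - c⁻¹ * φ b - inner ℝ (c⁻¹ • ∇ φ y) (a - b)
          = c⁻¹ * (φ a - φ b - inner ℝ (∇ φ y) (a - b)) := by
        rw [real_inner_smul_left]; ring
      rw [h2, abs_mul, abs_of_pos (inv_pos.2 hgn), inv_mul_le_iff₀ hgn]
      linarith
    · have hzU : z ∈ U := (hball hz).1.2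
      have h3 : z ∈ Ω ↔ φ z ≤ 0 := by
        have := Set.ext_iff.1 hΩ z
        simp only [mem_inter_iff, hzU, and_true, mem_ofPred_eq, true_and] at this
        exact this
      rw [h3, inv_mul_le_iff₀ hgn, mul_zero]
  refine ⟨_, _, Metric.mem_ball_self hr, hchart, fun z hz => ⟨hz.2, _, U, φ, hU,
    (hball hz.1).1.2, hφ, hΩ, ?_, (hball hz.1).2, rfl⟩⟩
  have h0 := (hchart.mem_frontier_iff hz.1).1 hz.2
  exact (mul_eq_zero.1 h0).resolve_left (inv_pos.2 hgn).ne'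

/-- The outer unit normal is nonnegative on the directions in which a flat chart increases. -/
theorem IsOuterUnitNormal.inner_nonneg {V : Set (EuclideanSpace ℝ (Fin m))}
    {φ : EuclideanSpace ℝ (Fin m) → ℝ} {n₀ y n w : EuclideanSpace ℝ (Fin m)} {δ : ℝ}
    (hn : IsOuterUnitNormal Ω y n) (h : IsFlatChart Ω V φ n₀ δ) (hy : y ∈ V)
    (hyf : y ∈ frontier Ω) (hw : δ * ‖w‖ < inner ℝ n₀ w) : 0 ≤ (inner ℝ n w : ℝ) := by
  obtain ⟨U, ψ, hU, hyU, hψ, hΩ, hy0, hg, rfl⟩ := hn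
  rw [real_inner_smul_left]
  refine mul_nonneg (by positivity) ?_
  have hd : HasDerivAt (fun t : ℝ => ψ (y + t • w)) (inner ℝ (∇ ψ y) w) 0 := by
    have h1 : HasFDerivAt ψ (fderiv ℝ ψ y) (y + (0 : ℝ) • w) := by
      simpa using ((hψ.contDiffAt (hU.mem_nhds hyU)).differentiableAt one_ne_zero).hasFDerivAt
    have h2 : HasDerivAt (fun t : ℝ => y + t • w) w 0 := by
      simpa using ((hasDerivAt_id (0 : ℝ)).smul_const w).const_add y
    have h3 : HasDerivAt (fun t : ℝ => ψ (y + t • w)) (fderiv ℝ ψ y w) 0 :=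
      h1.comp_hasDerivAt (0 : ℝ) h2
    rwa [gradient, toDual_symm_apply]
  have hUev : ∀ᶠ t in 𝓝 (0 : ℝ), y + t • w ∈ U := by
    have : ContinuousAt (fun t : ℝ => y + t • w) 0 := by fun_prop
    exact this.eventually_mem (hU.mem_nhds (by simpa using hyU))
  have hφ0 := (h.mem_frontier_iff hy).1 hyf
  -- The point `y + t • w` has left `Ω` according to the chart `φ`, so the other defining function
  -- `ψ` is positive there, and the slopes that converge to `⟪∇ ψ y, w⟫` are nonnegative.
  refine ge_of_tendsto (hasDerivAt_iff_tendsto_slope.1 hd |>.mono_left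
    (nhdsWithin_mono _ (fun t (ht : t ∈ Ioi (0 : ℝ)) => ne_of_gt ht))) ?_
  filter_upwards [nhdsWithin_le_nhds hUev, nhdsWithin_le_nhds (h.eventually_add_smul_mem hy w),
    self_mem_nhdsWithin] with t htU htV ht
  have h1 := h.lt_add_smul ht hw hy htV
  have h2 : y + t • w ∉ Ω := fun hm => by
    have := (h.mem_iff _ htV).1 hm
    linarith
  have h3 : 0 < ψ (y + t • w) := by
    by_contra hle
    exact h2 ((Set.ext_iff.1 hΩ (y + t • w)).2 ⟨htU, not_lt.1 hle⟩).1
  rw [slope_def_field]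
  simp only [zero_smul, add_zero, hy0, sub_zero]
  exact div_nonneg h3.le (le_of_lt ht)

/-- The chosen normal at `y` may come from a defining function unrelated to `φ`; its nonnegativity
on the cone of the chart still pins it to `n₀`. -/
theorem IsFlatChart.one_sub_le_inner_outerUnitNormal {V : Set (EuclideanSpace ℝ (Fin m))}
    {φ : EuclideanSpace ℝ (Fin m) → ℝ} {n₀ y : EuclideanSpace ℝ (Fin m)} {δ : ℝ}
    (h : IsFlatChart Ω V φ n₀ δ) (hy : y ∈ V) (hyr : y ∈ regularBoundary Ω) :
    1 - 2 * δ ≤ inner ℝ (outerUnitNormal Ω y) n₀ := by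
  have hn := isOuterUnitNormal_outerUnitNormal hyr
  exact one_sub_le_inner_of_nonneg_on_cone h.norm_eq hn.norm_eq_one h.pos h.lt_half
    fun w hw => hn.inner_nonneg h hy hyr.1 hw

/-- Every flat chart around a regular point contains only regular boundary points. This makes the
regular part measurable and the singular part closed. -/
theorem exists_isOpen_regularBoundary_eq (Ω : Set (EuclideanSpace ℝ (Fin m))) :
    ∃ W, IsOpen W ∧ regularBoundary Ω = W ∩ frontier Ω := by
  refine ⟨⋃₀ {V | IsOpen V ∧ V ∩ frontier Ω ⊆ regularBoundary Ω},
    isOpen_sUnion fun V hV => hV.1, Subset.antisymm (fun y hy => ⟨?_, hy.1⟩) ?_⟩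
  · obtain ⟨V, φ, hyV, hV, hVr⟩ := (isOuterUnitNormal_outerUnitNormal hy).exists_isFlatChart
      (δ := 1 / 4) (by norm_num) (by norm_num)
    exact ⟨V, ⟨hV.isOpen, hVr⟩, hyV⟩
  · rintro y ⟨⟨V, hV, hyV⟩, hy⟩
    exact hV.2 ⟨hyV, hy⟩

theorem measurableSet_regularBoundary (Ω : Set (EuclideanSpace ℝ (Fin m))) :
    MeasurableSet (regularBoundary Ω) := by
  obtain ⟨W, hW, h⟩ := exists_isOpen_regularBoundary_eq Ω
  rw [h]
  exact hW.measurableSet.inter isClosed_frontier.measurableSet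

theorem isClosed_frontier_diff_regularBoundary (Ω : Set (EuclideanSpace ℝ (Fin m))) :
    IsClosed (frontier Ω \ regularBoundary Ω) := by
  obtain ⟨W, hW, h⟩ := exists_isOpen_regularBoundary_eq Ω
  have : frontier Ω \ regularBoundary Ω = frontier Ω \ W := by
    rw [h]; ext; simp
  rw [this]
  exact isClosed_frontier.sdiff hW

/-- The normals are picked pointwise, but in a chart of error `δ` around `y` they satisfy `‖n(z) -
n(y)‖² = 2 - 2⟪n(z), n(y)⟫ ≤ 4δ`, which is below `ε²` for the `δ` chosen here. -/
theorem continuousOn_outerUnitNormal (Ω : Set (EuclideanSpace ℝ (Fin m))) :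
    ContinuousOn (outerUnitNormal Ω) (regularBoundary Ω) := by
  intro y hy
  rw [ContinuousWithinAt, Metric.tendsto_nhds]
  intro ε hε
  have hn := isOuterUnitNormal_outerUnitNormal hy
  set δ := min (1 / 4) (ε ^ 2 / 8) with hδ
  have hδ0 : 0 < δ := by positivity
  obtain ⟨V, φ, hyV, hV, -⟩ := hn.exists_isFlatChart hδ0
    ((min_le_left _ _).trans_lt (by norm_num))
  filter_upwards [self_mem_nhdsWithin, nhdsWithin_le_nhds (hV.isOpen.mem_nhds hyV)] with z hz hzV
  have h1 := hV.one_sub_le_inner_outerUnitNormal hzV hz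
  have h2 := @norm_sub_sq_real _ _ _ (outerUnitNormal Ω z) (outerUnitNormal Ω y)
  rw [(isOuterUnitNormal_outerUnitNormal hz).norm_eq_one, hn.norm_eq_one] at h2
  have h3 : δ ≤ ε ^ 2 / 8 := min_le_right _ _
  rw [dist_eq_norm]
  nlinarith [norm_nonneg (outerUnitNormal Ω z - outerUnitNormal Ω y)]

end Normal
end

/-! ### Area under Lipschitz maps, and derivatives integrated over a flat chart -/

section

section Hausdorff

variable {X Y : Type*} [MetricSpace X] [MeasurableSpace X] [BorelSpace X]
  [MetricSpace Y] [MeasurableSpace Y] [BorelSpace Y]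

theorem LipschitzOnWith.euclideanHausdorffMeasure_image_le {f : X → Y} {s : Set X} {K : NNReal}
    (h : LipschitzOnWith K f s) (d : ℕ) :
    μHE[d] (f '' s) ≤ (K : ENNReal) ^ d * μHE[d] s := by
  have h1 := h.hausdorffMeasure_image_le (d := d) (by positivity)
  rw [ENNReal.rpow_natCast] at h1
  simp only [Measure.euclideanHausdorffMeasure_def, Measure.smul_apply, ENNReal.smul_def,
    smul_eq_mul]
  rw [mul_left_comm]
  gcongr

/-- The hypothesis makes `f` injective on `s` with a `K`-Lipschitz inverse on the image, to which
the Lipschitz bound applies. -/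
theorem euclideanHausdorffMeasure_le_mul_image {f : X → Y} {s : Set X} {K : NNReal}
    (h : ∀ x ∈ s, ∀ y ∈ s, dist x y ≤ K * dist (f x) (f y)) (d : ℕ) :
    μHE[d] s ≤ (K : ENNReal) ^ d * μHE[d] (f '' s) := by
  rcases s.eq_empty_or_nonempty with rfl | ⟨x₀, hx₀⟩
  · simp
  have : Nonempty X := ⟨x₀⟩
  have hinj : InjOn f s := fun x hx y hy hxy => by
    have := h x hx y hy
    rw [hxy, dist_self, mul_zero] at this
    exact dist_le_zero.1 this
  have hinv : ∀ x ∈ s, Function.invFunOn f s (f x) = x := hinj.leftInvOn_invFunOn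
  have hl : LipschitzOnWith K (Function.invFunOn f s) (f '' s) := by
    refine LipschitzOnWith.of_dist_le_mul ?_
    rintro _ ⟨x, hx, rfl⟩ _ ⟨y, hy, rfl⟩
    rw [hinv x hx, hinv y hy]
    exact h x hx y hy
  have h1 := hl.euclideanHausdorffMeasure_image_le d
  rwa [show Function.invFunOn f s '' (f '' s) = s by
    rw [image_image]
    exact (image_congr hinv).trans (image_id' s)] at h1

end Hausdorff

namespace IsFlatChart

variable {m : ℕ} {Ω V : Set (EuclideanSpace ℝ (Fin m))} {φ : EuclideanSpace ℝ (Fin m) → ℝ}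
  {n₀ : EuclideanSpace ℝ (Fin m)} {δ : ℝ} {g : EuclideanSpace ℝ (Fin m) → ℝ}

/-- In a flat chart, moving in the direction of the cone leaves `Ω`, so that the integral over `Ω`
of the derivative of a nonnegative function in this direction is nonnegative. -/
theorem setIntegral_fderiv_nonneg (h : IsFlatChart Ω V φ n₀ δ) (hΩ : IsCompact Ω)
    (hg : ContDiff ℝ 1 g) (hgc : HasCompactSupport g) (hgV : tsupport g ⊆ V) (hg0 : ∀ y, 0 ≤ g y)
    {w : EuclideanSpace ℝ (Fin m)} (hw : δ * ‖w‖ < inner ℝ n₀ w) :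
    0 ≤ ∫ y in Ω, fderiv ℝ g y w := by
  have hfc : Continuous (fderiv ℝ g) := hg.continuous_fderiv one_ne_zero
  obtain ⟨C, hC⟩ := hfc.bounded_above_of_compact_support (hgc.fderiv (𝕜 := ℝ))
  have : IsFiniteMeasure (volume.restrict Ω) := ⟨by simpa using hΩ.measure_lt_top⟩
  have hcomp : ∀ t : ℝ, Continuous fun y => g (y + t • w) := fun t =>
    hg.continuous.comp (by fun_prop)
  have hgi : Integrable g := hg.continuous.integrable_of_hasCompactSupport hgc
  have hderiv : HasDerivAt (fun t : ℝ => ∫ y in Ω, g (y + t • w))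
      (∫ y in Ω, fderiv ℝ g (y + (0 : ℝ) • w) w) 0 := by
    refine (hasDerivAt_integral_of_dominated_loc_of_deriv_le (μ := volume.restrict Ω)
      (F := fun t y => g (y + t • w)) (F' := fun t y => fderiv ℝ g (y + t • w) w)
      (bound := fun _ => C * ‖w‖) (s := univ) univ_mem
      (Eventually.of_forall fun t => (hcomp t).aestronglyMeasurable) ?_ ?_ ?_
      (integrable_const _) ?_).2
    · exact ((hcomp 0).continuousOn.integrableOn_compact hΩ)
    · exact ((hfc.comp (by fun_prop : Continuous fun y => y + (0 : ℝ) • w)).clm_apply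
        continuous_const).aestronglyMeasurable
    · refine Eventually.of_forall fun y t _ => ?_
      exact ((fderiv ℝ g _).le_opNorm w).trans (by gcongr; exact hC _)
    · refine Eventually.of_forall fun y t _ => ?_
      have h1 : HasFDerivAt g (fderiv ℝ g (y + t • w)) (y + t • w) :=
        (hg.differentiable one_ne_zero _).hasFDerivAt
      have h2 : HasDerivAt (fun t : ℝ => y + t • w) w t := by
        simpa using ((hasDerivAt_id t).smul_const w).const_add y
      exact h1.comp_hasDerivAt t h2
  simp only [zero_smul, add_zero] at hderiv
  obtain ⟨r, hr, hrV⟩ := hgc.exists_thickening_subset_open h.isOpen hgV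
  have hsmall : ∀ᶠ t : ℝ in 𝓝 0, ‖t • w‖ < r := by
    have : ContinuousAt (fun t : ℝ => ‖t • w‖) 0 := by fun_prop
    exact this.eventually_lt_const (by simpa using hr)
  refine ge_of_tendsto (hasDerivAt_iff_tendsto_slope.1 hderiv |>.mono_left
    (nhdsWithin_mono _ (fun t (ht : t ∈ Ioi (0 : ℝ)) => ne_of_gt ht))) ?_
  filter_upwards [nhdsWithin_le_nhds hsmall, self_mem_nhdsWithin] with t htr ht
  rw [slope_def_field]
  refine div_nonneg (sub_nonneg.2 ?_) (sub_nonneg.2 (le_of_lt ht))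
  simp only [zero_smul, add_zero]
  -- `T = Ω + t • w`, and the translated integral is `∫_T g`. On the support of `g` the chart gives
  -- `Ω ⊆ T`, since going back by `t • w` decreases `φ`; as `g ≥ 0`, the integral over `T` is the
  -- larger one.
  set T : Set (EuclideanSpace ℝ (Fin m)) := {y | y - t • w ∈ Ω} with hT
  have hTm : MeasurableSet T := (continuous_id.sub continuous_const).measurable hΩ.measurableSet
  have h1 : ∫ y in Ω, g (y + t • w) = ∫ y in T, g y := by
    have := (measurePreserving_add_right volume (t • w)).setIntegral_preimage_emb
      (MeasurableEquiv.addRight (t • w)).measurableEmbedding g T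
    rw [← this]
    congr 2
    ext y
    simp [hT]
  rw [h1, ← integral_indicator hTm, ← integral_indicator hΩ.measurableSet]
  refine integral_mono (hgi.indicator hΩ.measurableSet) (hgi.indicator hTm) fun y => ?_
  by_cases hy : y ∈ Ω
  · rcases (hg0 y).eq_or_lt with h0 | h0
    · simp [indicator, ← h0]
    · have hys : y ∈ tsupport g := subset_tsupport g (ne_of_gt h0)
      have hyV := hgV hys
      have hyV' : y - t • w ∈ V := hrV (Metric.mem_thickening_iff.2 ⟨y, hys, by
        rwa [dist_eq_norm, sub_sub_cancel_left, norm_neg]⟩)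
      have hlt := h.lt_add_smul ht hw hyV' (by simpa using hyV)
      rw [sub_add_cancel] at hlt
      have hyT : y ∈ T := (h.mem_iff _ hyV').2 (hlt.le.trans ((h.mem_iff y hyV).1 hy))
      rw [indicator_of_mem hy, indicator_of_mem hyT]
  · rw [indicator_of_notMem hy]
    exact indicator_nonneg (fun y _ => hg0 y) y

/-- The integral of the normal derivative along a line in the normal direction. -/
noncomputable def lineIntegral (Ω : Set (EuclideanSpace ℝ (Fin m))) (n₀ : EuclideanSpace ℝ (Fin m))
    (g : EuclideanSpace ℝ (Fin m) → ℝ) (z : EuclideanSpace ℝ (Fin m)) : ℝ :=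
  ∫ t : ℝ, Ω.indicator (fun y => fderiv ℝ g y n₀) (t • n₀ + z)

theorem hasDerivAt_line (hg : ContDiff ℝ 1 g) (n₀ z : EuclideanSpace ℝ (Fin m)) (t : ℝ) :
    HasDerivAt (fun t : ℝ => g (t • n₀ + z)) (fderiv ℝ g (t • n₀ + z) n₀) t := by
  have h1 : HasFDerivAt g (fderiv ℝ g (t • n₀ + z)) (t • n₀ + z) :=
    (hg.differentiable one_ne_zero _).hasFDerivAt
  have h2 : HasDerivAt (fun t : ℝ => t • n₀ + z) n₀ t := by
    simpa using ((hasDerivAt_id t).smul_const n₀).add_const z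
  exact h1.comp_hasDerivAt t h2

theorem contDiff_line (hg : ContDiff ℝ 1 g) (n₀ z : EuclideanSpace ℝ (Fin m)) :
    ContDiff ℝ 1 (fun t : ℝ => g (t • n₀ + z)) :=
  hg.comp (by fun_prop)

theorem hasCompactSupport_line (hgc : HasCompactSupport g) {n₀ : EuclideanSpace ℝ (Fin m)}
    (hn₀ : ‖n₀‖ = 1) (z : EuclideanSpace ℝ (Fin m)) :
    HasCompactSupport (fun t : ℝ => g (t • n₀ + z)) := by
  refine hgc.comp_isClosedEmbedding (g := fun t : ℝ => t • n₀ + z) ?_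
  refine Isometry.isClosedEmbedding (Isometry.of_dist_eq fun a b => ?_)
  rw [dist_add_right, dist_eq_norm, ← sub_smul, norm_smul, hn₀, mul_one, Real.dist_eq,
    Real.norm_eq_abs]

theorem fderiv_eq_zero_of_notMem (hgV : tsupport g ⊆ V) {y : EuclideanSpace ℝ (Fin m)}
    (hy : y ∉ V) : fderiv ℝ g y = 0 :=
  fderiv_of_notMem_tsupport ℝ fun h => hy (hgV h)

/-- A line in the normal direction through a boundary point of the chart leaves `Ω` there. -/
theorem lineIntegral_eq (h : IsFlatChart Ω V φ n₀ δ)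
    (hg : ContDiff ℝ 1 g) (hgc : HasCompactSupport g) (hgV : tsupport g ⊆ V)
    {z : EuclideanSpace ℝ (Fin m)} {t₀ : ℝ} (htV : t₀ • n₀ + z ∈ V)
    (htf : t₀ • n₀ + z ∈ frontier Ω) : lineIntegral Ω n₀ g z = g (t₀ • n₀ + z) := by
  have hfr := (h.mem_frontier_iff htV).1 htf
  have h1 := (hasCompactSupport_line hgc h.norm_eq z).integral_Iic_deriv_eq
    (contDiff_line hg n₀ z) t₀
  rw [lineIntegral, ← h1, ← integral_indicator measurableSet_Iic]
  refine integral_congr_ae (Eventually.of_forall fun t => ?_)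
  simp only [indicator, mem_Iic, (hasDerivAt_line hg n₀ z _).deriv]
  by_cases hV : t • n₀ + z ∈ V
  -- `φ` increases strictly along the line inside `V` and vanishes at `t₀`. Outside `V` the
  -- derivative of `g` vanishes, so membership in `Ω` does not matter there.
  · have : t • n₀ + z ∈ Ω ↔ t ≤ t₀ := by
      rw [h.mem_iff _ hV, ← hfr]
      have key : ∀ a b : ℝ, a • n₀ + z ∈ V → b • n₀ + z ∈ V → a < b →
          φ (a • n₀ + z) < φ (b • n₀ + z) := fun a b ha hb hab => by
        have e : b • n₀ + z = a • n₀ + z + (b - a) • n₀ := by rw [sub_smul]; abel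
        rw [e] at hb ⊢
        exact h.lt_add_smul (sub_pos.2 hab) h.normal_mem_cone ha hb
      constructor
      · intro hle
        by_contra hlt
        exact absurd (key t₀ t htV hV (not_le.1 hlt)) (not_lt.2 hle)
      · intro hle
        rcases hle.eq_or_lt with rfl | hlt
        · exact le_rfl
        · exact (key t t₀ hV htV hlt).le
    simp [this]
  · simp [fderiv_eq_zero_of_notMem hgV hV]

/-- By convexity of `V` the line meets it in an interval, on which `φ` has no zero and so keeps its
sign. The line thus lies inside `Ω` throughout `V`, and the full integral of the derivative of a
compactly supported function is `0`, or outside `Ω` throughout `V`, and the integrand vanishes. -/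
theorem lineIntegral_eq_zero (h : IsFlatChart Ω V φ n₀ δ)
    (hg : ContDiff ℝ 1 g) (hgc : HasCompactSupport g) (hgV : tsupport g ⊆ V)
    {z : EuclideanSpace ℝ (Fin m)}
    (hz : ∀ t : ℝ, t • n₀ + z ∈ V → t • n₀ + z ∉ frontier Ω) : lineIntegral Ω n₀ g z = 0 := by
  have h1 := (hasCompactSupport_line hgc h.norm_eq z)
  have h2 : ∫ t : ℝ, fderiv ℝ g (t • n₀ + z) n₀ = 0 := by
    have := integral_eq_zero_of_hasDerivAt_of_integrable (hasDerivAt_line hg n₀ z) ?_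
      ((contDiff_line hg n₀ z).continuous.integrable_of_hasCompactSupport h1)
    · exact this
    · have e : (fun t : ℝ => fderiv ℝ g (t • n₀ + z) n₀) = deriv fun t : ℝ => g (t • n₀ + z) :=
        funext fun t => (hasDerivAt_line hg n₀ z t).deriv.symm
      rw [e]
      exact ((contDiff_line hg n₀ z).continuous_deriv le_rfl).integrable_of_hasCompactSupport
        h1.deriv
  set T : Set ℝ := {t | t • n₀ + z ∈ V} with hT
  have hconv : Convex ℝ T := by
    intro a ha b hb p q hp hq hpq
    have h3 := h.convex ha hb hp hq hpq
    obtain rfl : q = 1 - p := by linarith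
    have e : (p • a + (1 - p) • b) • n₀ + z = p • (a • n₀ + z) + (1 - p) • (b • n₀ + z) := by
      simp only [smul_eq_mul]
      module
    rw [hT, mem_ofPred_eq, e]
    exact h3
  have hcont : ContinuousOn (fun t : ℝ => φ (t • n₀ + z)) T :=
    h.continuousOn.comp (by fun_prop) fun t ht => ht
  have hne : ∀ t ∈ T, φ (t • n₀ + z) ≠ 0 := fun t ht h0 =>
    hz t ht ((h.mem_frontier_iff ht).2 h0)
  have himage := (hconv.isPreconnected.image _ hcont).ordConnected
  by_cases hex : ∃ t₁ ∈ T, φ (t₁ • n₀ + z) < 0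
  · obtain ⟨t₁, ht₁, hlt₁⟩ := hex
    rw [lineIntegral, ← h2]
    refine integral_congr_ae (Eventually.of_forall fun t => ?_)
    simp only [indicator]
    by_cases ht : t ∈ T
    · rw [if_pos]
      refine (h.mem_iff _ ht).2 ?_
      by_contra hgt
      obtain ⟨s, hs, hs0⟩ := himage.out (mem_image_of_mem _ ht₁) (mem_image_of_mem _ ht)
        (show (0 : ℝ) ∈ Icc _ _ from ⟨hlt₁.le, (not_le.1 hgt).le⟩)
      exact hne s hs hs0
    · simp [fderiv_eq_zero_of_notMem hgV ht]
  · push Not at hex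
    rw [lineIntegral]
    refine integral_eq_zero_of_ae (Eventually.of_forall fun t => ?_)
    simp only [indicator, Pi.zero_apply]
    by_cases ht : t ∈ T
    · rw [if_neg]
      intro hm
      exact hne t ht (le_antisymm ((h.mem_iff _ ht).1 hm) (hex t ht))
    · simp [fderiv_eq_zero_of_notMem hgV ht]

end IsFlatChart
end

/-! ### Slicing along the normal direction: area against Lebesgue measure on the hyperplane -/

section

section Slicing

variable {m : ℕ}

/-- The orthogonal splitting into `n₀ᗮ` and `ℝ n₀` supplies the coordinates in which Fubini is
applied along normal lines. -/
theorem measurePreserving_smul_add {n₀ : EuclideanSpace ℝ (Fin m)} (hn₀ : ‖n₀‖ = 1) :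
    MeasurePreserving (fun p : (ℝ ∙ n₀)ᗮ × ℝ => p.2 • n₀ + (p.1 : EuclideanSpace ℝ (Fin m)))
      (volume.prod volume) volume := by
  have h1 := ((ℝ ∙ n₀).measurePreserving_measurableEquivProd (0 : EuclideanSpace ℝ (Fin m))).symm
  have h0 : (μHE[Module.finrank ℝ (EuclideanSpace ℝ (Fin m))] :
      Measure (EuclideanSpace ℝ (Fin m))) = volume :=
    InnerProductSpace.euclideanHausdorffMeasure_eq_volume
  rw [h0] at h1
  have h2 := (LinearIsometryEquiv.toSpanUnitSingleton n₀ hn₀).measurePreserving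
  have h3 := (h2.prod (MeasurePreserving.id (volume : Measure (ℝ ∙ n₀)ᗮ)))
  have h4 := (h1.comp h3).comp (Measure.measurePreserving_swap (μ := (volume : Measure (ℝ ∙ n₀)ᗮ))
    (ν := (volume : Measure ℝ)))
  refine (congrArg (fun f => MeasurePreserving f (volume.prod volume) volume) ?_).mp h4
  funext p
  simp

theorem finrank_orthogonal_span_singleton_eq {n₀ : EuclideanSpace ℝ (Fin m)} (hn₀ : ‖n₀‖ = 1) :
    Module.finrank ℝ (ℝ ∙ n₀)ᗮ = m - 1 := by
  have h1 := (ℝ ∙ n₀).finrank_add_finrank_orthogonal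
  rw [finrank_span_singleton (by rintro rfl; simp at hn₀), finrank_euclideanSpace_fin] at h1
  omega

end Slicing

namespace IsFlatChart

variable {m : ℕ} {Ω V : Set (EuclideanSpace ℝ (Fin m))} {φ : EuclideanSpace ℝ (Fin m) → ℝ}
  {n₀ : EuclideanSpace ℝ (Fin m)} {δ : ℝ} {g : EuclideanSpace ℝ (Fin m) → ℝ}

theorem integral_lineIntegral (hn₀ : ‖n₀‖ = 1) (hΩ : IsCompact Ω) (hg : ContDiff ℝ 1 g) :
    AEStronglyMeasurable (fun z : (ℝ ∙ n₀)ᗮ => lineIntegral Ω n₀ g z) ∧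
    ∫ y in Ω, fderiv ℝ g y n₀ = ∫ z : (ℝ ∙ n₀)ᗮ, lineIntegral Ω n₀ g z := by
  have hmp := measurePreserving_smul_add hn₀
  have hc : Continuous fun y => fderiv ℝ g y n₀ :=
    (hg.continuous_fderiv one_ne_zero).clm_apply continuous_const
  have hi : Integrable (Ω.indicator fun y => fderiv ℝ g y n₀) :=
    (hc.continuousOn.integrableOn_compact hΩ).integrable_indicator hΩ.measurableSet
  have hi2 := hmp.integrable_comp_of_integrable hi
  refine ⟨hi2.aestronglyMeasurable.integral_prod_right', ?_⟩
  rw [← integral_indicator hΩ.measurableSet, ← hmp.map_eq, integral_map hmp.aemeasurable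
    (by rw [hmp.map_eq]; exact hi.aestronglyMeasurable)]
  exact integral_prod _ hi2

/-- The area of a function over the part of the boundary in a flat chart nearly agrees with the
integral of its normal derivative over `Ω`. -/
theorem setIntegral_fderiv_normal_bounds (h : IsFlatChart Ω V φ n₀ δ) (hΩ : IsCompact Ω)
    (hfin : μHE[m - 1] (frontier Ω) ≠ ⊤)
    (hg : ContDiff ℝ 1 g) (hgc : HasCompactSupport g) (hgV : tsupport g ⊆ V) (hg0 : ∀ y, 0 ≤ g y) :
    (1 - δ) ^ (m - 1) * ∫ y in frontier Ω, g y ∂μHE[m - 1] ≤ ∫ y in Ω, fderiv ℝ g y n₀ ∧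
      ∫ y in Ω, fderiv ℝ g y n₀ ≤ ∫ y in frontier Ω, g y ∂μHE[m - 1] := by
  obtain ⟨hJm, hJ⟩ := integral_lineIntegral h.norm_eq hΩ hg
  set Q := (ℝ ∙ n₀)ᗮ.orthogonalProjectionOnto with hQ
  have hdecomp : ∀ y : EuclideanSpace ℝ (Fin m), (inner ℝ n₀ y : ℝ) • n₀ + (Q y : _) = y := by
    intro y
    have h1 := (ℝ ∙ n₀).starProjection_add_starProjection_orthogonal y
    rw [Submodule.starProjection_unit_singleton ℝ h.norm_eq] at h1
    exact h1
  set Γ := V ∩ frontier Ω with hΓ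
  have hΓm : MeasurableSet Γ := h.isOpen.measurableSet.inter isClosed_frontier.measurableSet
  set J : (ℝ ∙ n₀)ᗮ → ℝ := fun z => lineIntegral Ω n₀ g z with hJdef
  have hJQ : ∀ y ∈ Γ, J (Q y) = g y := by
    intro y hy
    have := h.lineIntegral_eq hg hgc hgV (z := Q y) (t₀ := inner ℝ n₀ y)
      (by rw [hdecomp]; exact hy.1) (by rw [hdecomp]; exact hy.2)
    rw [hdecomp] at this
    exact this
  have hJ0 : ∀ z, J z ≠ 0 → z ∈ Q '' Γ := by
    intro z hz
    by_contra hcon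
    refine hz (h.lineIntegral_eq_zero hg hgc hgV fun t htV htf => hcon ⟨_, ⟨htV, htf⟩, ?_⟩)
    have h1 : Q n₀ = 0 :=
      Submodule.orthogonalProjectionOnto_orthogonalComplement_singleton_eq_zero n₀
    rw [map_add, map_smul, h1, smul_zero, zero_add]
    exact Submodule.orthogonalProjectionOnto_mem_subspace_eq_self z
  have hJnn : ∀ z, 0 ≤ J z := by
    intro z
    by_cases hz : J z = 0
    · exact hz.ge
    · obtain ⟨y, hy, rfl⟩ := hJ0 z hz
      rw [hJQ y hy]
      exact hg0 y
  have hvol : (volume : Measure (ℝ ∙ n₀)ᗮ) = μHE[m - 1] := by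
    rw [← finrank_orthogonal_span_singleton_eq h.norm_eq]
    exact InnerProductSpace.euclideanHausdorffMeasure_eq_volume.symm
  have hQm : Measurable Q := Q.continuous.measurable
  -- `ρ` is the area of the boundary piece `Γ` pushed to the hyperplane. Since `J ∘ Q = g` on `Γ`,
  -- integrating `J` against `ρ` gives `∫_Γ g`; both bounds then come from comparing `ρ` with
  -- Lebesgue measure.
  set ρ : Measure (ℝ ∙ n₀)ᗮ := ((μHE[m - 1]).restrict Γ).map Q with hρ
  have hρB : ∀ B, MeasurableSet B → ρ B = μHE[m - 1] (Q ⁻¹' B ∩ Γ) := fun B hB => by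
    rw [hρ, Measure.map_apply hQm hB, Measure.restrict_apply (hQm hB)]
  have hQ1 : LipschitzWith 1 Q := by
    refine LipschitzWith.of_dist_le_mul fun a b => ?_
    rw [dist_eq_norm, dist_eq_norm, ← map_sub, NNReal.coe_one, one_mul]
    exact Submodule.norm_orthogonalProjectionOnto_apply_le _ _
  have hle1 : ∀ B, MeasurableSet B → B ⊆ Q '' Γ → volume B ≤ ρ B := by
    intro B hB hBΓ
    rw [hρB B hB, hvol]
    have h1 := hQ1.lipschitzOnWith (s := Q ⁻¹' B ∩ Γ) |>.euclideanHausdorffMeasure_image_le (m - 1)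
    rw [ENNReal.coe_one, one_pow, one_mul] at h1
    refine (measure_mono fun z hz => ?_).trans h1
    obtain ⟨y, hy, rfl⟩ := hBΓ hz
    exact ⟨y, ⟨hz, hy⟩, rfl⟩
  have hδ1 : 0 < 1 - δ := by linarith [h.lt_half]
  -- On `Γ` the function `φ` vanishes, so `|⟪n₀, a - b⟫| ≤ δ‖a - b‖`, and at least `(1 - δ)‖a - b‖`
  -- remains for the projection. Hence the inverse of `Q` on `Q '' Γ` is `(1 - δ)⁻¹`-Lipschitz.
  set K : NNReal := ⟨(1 - δ)⁻¹, by positivity⟩ with hK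
  have hanti : ∀ a ∈ Γ, ∀ b ∈ Γ, dist a b ≤ K * dist (Q a) (Q b) := by
    intro a ha b hb
    have h1 := h.approx a ha.1 b hb.1
    rw [(h.mem_frontier_iff ha.1).1 ha.2, (h.mem_frontier_iff hb.1).1 hb.2, sub_zero, zero_sub,
      abs_neg] at h1
    have h2 : ‖a - b‖ ≤ |inner ℝ n₀ (a - b)| + ‖Q (a - b)‖ := by
      conv_lhs => rw [← hdecomp (a - b)]
      refine (norm_add_le _ _).trans ?_
      rw [norm_smul, h.norm_eq, mul_one, Real.norm_eq_abs]
      rfl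
    rw [dist_eq_norm, dist_eq_norm, ← map_sub]
    change _ ≤ (1 - δ)⁻¹ * _
    rw [le_inv_mul_iff₀ hδ1]
    linarith
  have hle2 : ∀ B, MeasurableSet B → ρ B ≤ (K : ENNReal) ^ (m - 1) * volume B := by
    intro B hB
    rw [hρB B hB, hvol]
    refine (euclideanHausdorffMeasure_le_mul_image (f := Q) (fun a ha b hb =>
      hanti a ha.2 b hb.2) (m - 1)).trans ?_
    gcongr
    rintro _ ⟨y, hy, rfl⟩
    exact hy.1
  have hle2' : ρ ≤ (K : ENNReal) ^ (m - 1) • volume := Measure.le_iff.2 hle2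
  have hJmρ : AEMeasurable J ρ := hJm.aemeasurable.mono_ac
    ((Measure.absolutelyContinuous_of_le hle2').trans (Measure.smul_absolutelyContinuous))
  have hgΓ : ∀ y ∈ frontier Ω \ Γ, g y = 0 := fun y hy => by
    by_contra hne
    exact hy.2 ⟨hgV (subset_tsupport g hne), hy.1⟩
  have hs1 : ∫ y in frontier Ω, g y ∂μHE[m - 1] = ∫ y in Γ, g y ∂μHE[m - 1] :=
    (setIntegral_eq_of_subset_of_forall_sdiff_eq_zero isClosed_frontier.measurableSet
      inter_subset_right hgΓ)
  have hs2 : ∫⁻ z, ENNReal.ofReal (J z) ∂ρ = ∫⁻ y in Γ, ENNReal.ofReal (g y) ∂μHE[m - 1] := by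
    rw [hρ, lintegral_map' (hρ ▸ hJmρ.ennreal_ofReal) hQm.aemeasurable]
    exact setLIntegral_congr_fun hΓm fun y hy => by simp only [hJQ y hy]
  have hgint : IntegrableOn g Γ μHE[m - 1] := by
    have : IsFiniteMeasure ((μHE[m - 1]).restrict (frontier Ω)) := ⟨by
      rw [Measure.restrict_apply_univ]; exact hfin.lt_top⟩
    obtain ⟨C, hC⟩ := hg.continuous.bounded_above_of_compact_support hgc
    exact IntegrableOn.mono_set (t := frontier Ω)
      (Integrable.of_bound hg.continuous.aestronglyMeasurable C
        (Eventually.of_forall hC)) inter_subset_right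
  have hs3 : ∫ y in Γ, g y ∂μHE[m - 1]
      = (∫⁻ y in Γ, ENNReal.ofReal (g y) ∂μHE[m - 1]).toReal :=
    integral_eq_lintegral_of_nonneg_ae (Eventually.of_forall hg0) hg.continuous.aestronglyMeasurable
  have hs4 : ∫⁻ y in Γ, ENNReal.ofReal (g y) ∂μHE[m - 1] ≠ ⊤ :=
    hgint.lintegral_lt_top.ne
  have hs5 : ∫ z, J z = (∫⁻ z, ENNReal.ofReal (J z)).toReal :=
    integral_eq_lintegral_of_nonneg_ae (Eventually.of_forall hJnn) hJm
  have hup : ∫⁻ z, ENNReal.ofReal (J z) ≤ ∫⁻ z, ENNReal.ofReal (J z) ∂ρ := by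
    -- Measurability of `Q '' Γ` is avoided: a measurable version of `J`, off a measurable null set,
    -- gives a measurable `B ⊆ Q '' Γ` that carries the whole integral of `J`.
    obtain ⟨J', hJ'm, hJ'⟩ := hJm.aemeasurable
    set N := toMeasurable volume {z | J z ≠ J' z} with hN
    have hN0 : volume N = 0 := by rw [hN, measure_toMeasurable]; exact hJ'
    set B := {z | J' z ≠ 0} \ N with hB
    have hBm : MeasurableSet B := (hJ'm (measurableSet_singleton 0)).compl.diff
      (measurableSet_toMeasurable _ _)
    have hBΓ : B ⊆ Q '' Γ := fun z hz => hJ0 z (by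
      have : J z = J' z := by
        by_contra hne
        exact hz.2 (subset_toMeasurable _ _ hne)
      rw [this]; exact hz.1)
    have h1 : ∫⁻ z, ENNReal.ofReal (J z) = ∫⁻ z in B, ENNReal.ofReal (J z) := by
      rw [← lintegral_indicator hBm]
      refine lintegral_congr_ae ?_
      filter_upwards [hJ', compl_mem_ae_iff.2 hN0] with z hz hzN
      by_cases hzB : z ∈ B
      · rw [indicator_of_mem hzB]
      · rw [indicator_of_notMem hzB, hz]
        have : J' z = 0 := by
          by_contra hne
          exact hzB ⟨hne, hzN⟩
        rw [this, ENNReal.ofReal_zero]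
    rw [h1]
    refine (lintegral_mono' ?_ le_rfl)
    refine Measure.le_iff.2 fun A hA => ?_
    rw [Measure.restrict_apply hA]
    exact (hle1 _ (hA.inter hBm) (inter_subset_right.trans hBΓ)).trans
      (measure_mono inter_subset_left)
  have hlow : ∫⁻ z, ENNReal.ofReal (J z) ∂ρ
      ≤ (K : ENNReal) ^ (m - 1) * ∫⁻ z, ENNReal.ofReal (J z) := by
    rw [← smul_eq_mul, ← lintegral_smul_measure]
    exact lintegral_mono' hle2' le_rfl
  rw [hs2] at hup hlow
  rw [hJ, hs1, hs3, show (∫ z : (ℝ ∙ n₀)ᗮ, lineIntegral Ω n₀ g z) = ∫ z, J z from rfl, hs5]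
  have hup' := ENNReal.toReal_mono hs4 hup
  have hlow' := ENNReal.toReal_mono (ENNReal.mul_ne_top (by simp) (ne_top_of_le_ne_top hs4 hup)) hlow
  rw [ENNReal.toReal_mul, ENNReal.toReal_pow, ENNReal.coe_toReal] at hlow'
  refine ⟨?_, hup'⟩
  change _ ≤ (1 - δ)⁻¹ ^ (m - 1) * _ at hlow'
  rwa [inv_pow, le_inv_mul_iff₀ (by positivity)] at hlow'

end IsFlatChart
end

/-! ### The local divergence theorem up to a small relative error -/

section

variable {m : ℕ} {Ω : Set (EuclideanSpace ℝ (Fin m))}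

theorem IsPiecewiseC1Body.isFiniteMeasure (hΩ : IsPiecewiseC1Body Ω) :
    IsFiniteMeasure ((μHE[m - 1]).restrict (frontier Ω)) :=
  ⟨by rw [Measure.restrict_apply_univ]; exact hΩ.area_frontier_ne_top.lt_top⟩

theorem IsPiecewiseC1Body.frontier_ae_eq (hΩ : IsPiecewiseC1Body Ω) :
    (regularBoundary Ω : Set _) =ᵐ[μHE[m - 1]] frontier Ω := by
  refine Filter.EventuallyLE.antisymm (LE.le.eventuallyLE fun y hy => hy.1) ?_
  exact ae_le_set.2 hΩ.area_singular

theorem IsPiecewiseC1Body.aestronglyMeasurable_outerUnitNormal (hΩ : IsPiecewiseC1Body Ω) :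
    AEStronglyMeasurable (outerUnitNormal Ω) ((μHE[m - 1]).restrict (frontier Ω)) := by
  rw [← Measure.restrict_congr_set hΩ.frontier_ae_eq]
  exact (continuousOn_outerUnitNormal Ω).aestronglyMeasurable (measurableSet_regularBoundary Ω)

theorem IsPiecewiseC1Body.isCompact_frontier (hΩ : IsPiecewiseC1Body Ω) : IsCompact (frontier Ω) :=
  hΩ.isCompact.of_isClosed_subset isClosed_frontier hΩ.isCompact.isClosed.frontier_subset

theorem IsPiecewiseC1Body.integrableOn_of_continuousOn (hΩ : IsPiecewiseC1Body Ω) {F : Type*}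
    [NormedAddCommGroup F] {f : EuclideanSpace ℝ (Fin m) → F}
    (hf : ContinuousOn f (frontier Ω)) : IntegrableOn f (frontier Ω) μHE[m - 1] := by
  have := hΩ.isFiniteMeasure
  obtain ⟨C, hC⟩ := hΩ.isCompact_frontier.exists_bound_of_continuousOn hf
  refine Integrable.of_bound (hf.aestronglyMeasurable_of_isCompact hΩ.isCompact_frontier
    isClosed_frontier.measurableSet) C ?_
  exact (ae_restrict_iff' isClosed_frontier.measurableSet).2 (Eventually.of_forall hC)

theorem IsPiecewiseC1Body.integrableOn_smul_normal (hΩ : IsPiecewiseC1Body Ω)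
    {f : EuclideanSpace ℝ (Fin m) → ℝ} (hf : ContinuousOn f (frontier Ω)) :
    IntegrableOn (fun y => f y • outerUnitNormal Ω y) (frontier Ω) μHE[m - 1] := by
  refine (hΩ.integrableOn_of_continuousOn hf).smul_bdd 1
    hΩ.aestronglyMeasurable_outerUnitNormal
    (Eventually.of_forall (norm_outerUnitNormal_le Ω))

theorem IsPiecewiseC1Body.integrableOn_inner_normal (hΩ : IsPiecewiseC1Body Ω)
    {F : EuclideanSpace ℝ (Fin m) → EuclideanSpace ℝ (Fin m)} (hF : ContinuousOn F (frontier Ω)) :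
    IntegrableOn (fun y => inner ℝ (F y) (outerUnitNormal Ω y)) (frontier Ω) μHE[m - 1] := by
  have h1 := hΩ.integrableOn_of_continuousOn hF
  refine h1.norm.mono' (h1.aestronglyMeasurable.inner hΩ.aestronglyMeasurable_outerUnitNormal)
    (Eventually.of_forall fun y => ?_)
  refine (norm_inner_le_norm _ _).trans ?_
  exact mul_le_of_le_one_right (norm_nonneg _) (norm_outerUnitNormal_le Ω y)

/-- The difference of the two sides of the divergence theorem for the vector field `g • v`. -/
noncomputable def divergenceDefect (Ω : Set (EuclideanSpace ℝ (Fin m)))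
    (v : EuclideanSpace ℝ (Fin m)) (g : EuclideanSpace ℝ (Fin m) → ℝ) : ℝ :=
  (∫ y in Ω, fderiv ℝ g y v) -
    ∫ y in frontier Ω, g y * inner ℝ v (outerUnitNormal Ω y) ∂μHE[m - 1]

/-- As functionals of `v`, both sides are nonnegative on the cone of the chart, so each is `⟪n₀, v⟫`
times its value at `n₀` up to `2δ‖v‖s`, with `s = ∫_∂Ω g`. The values at `n₀` lie in `[(1 - δ)^(m-1)
s, s]` by slicing and in `[(1 - 2δ)s, s]` by closeness of the normals. Adding the three errors gives
the constant. -/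
theorem IsFlatChart.abs_divergenceDefect_le {V : Set (EuclideanSpace ℝ (Fin m))}
    {φ : EuclideanSpace ℝ (Fin m) → ℝ} {n₀ : EuclideanSpace ℝ (Fin m)} {δ : ℝ}
    {g : EuclideanSpace ℝ (Fin m) → ℝ} (h : IsFlatChart Ω V φ n₀ δ) (hΩ : IsPiecewiseC1Body Ω)
    (hg : ContDiff ℝ 1 g) (hgc : HasCompactSupport g) (hgV : tsupport g ⊆ V) (hg0 : ∀ y, 0 ≤ g y)
    (v : EuclideanSpace ℝ (Fin m)) :
    |divergenceDefect Ω v g| ≤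
      (1 - (1 - δ) ^ (m - 1) + 6 * δ) * ‖v‖ * ∫ y in frontier Ω, g y ∂μHE[m - 1] := by
  obtain ⟨hlo, hup⟩ := h.setIntegral_fderiv_normal_bounds hΩ.isCompact hΩ.area_frontier_ne_top
    hg hgc hgV hg0
  set s := ∫ y in frontier Ω, g y ∂μHE[m - 1] with hs
  have hs0 : 0 ≤ s := integral_nonneg hg0
  have hfi : IntegrableOn (fderiv ℝ g) Ω :=
    (hg.continuous_fderiv one_ne_zero).continuousOn.integrableOn_compact hΩ.isCompact
  have hni := hΩ.integrableOn_smul_normal hg.continuous.continuousOn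
  set L₁ : EuclideanSpace ℝ (Fin m) →L[ℝ] ℝ := ∫ y in Ω, fderiv ℝ g y with hL₁
  set L₂ : EuclideanSpace ℝ (Fin m) →L[ℝ] ℝ :=
    innerSL ℝ (∫ y in frontier Ω, g y • outerUnitNormal Ω y ∂μHE[m - 1]) with hL₂
  have e₁ : ∀ w, L₁ w = ∫ y in Ω, fderiv ℝ g y w := fun w =>
    ContinuousLinearMap.integral_apply hfi w
  have e₂ : ∀ w, L₂ w = ∫ y in frontier Ω, g y * inner ℝ w (outerUnitNormal Ω y) ∂μHE[m - 1] := by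
    intro w
    rw [hL₂, innerSL_apply_apply, real_inner_comm, ← integral_inner hni]
    simp only [inner_smul_right]
  have hD : divergenceDefect Ω v g = L₁ v - L₂ v := by rw [e₁, e₂, divergenceDefect]
  have hpos : ∀ᵐ y ∂(μHE[m - 1]).restrict (frontier Ω), y ∈ regularBoundary Ω := by
    rw [← Measure.restrict_congr_set hΩ.frontier_ae_eq]
    exact ae_restrict_mem (measurableSet_regularBoundary Ω)
  have c₁ : ∀ w, δ * ‖w‖ < inner ℝ n₀ w → 0 ≤ L₁ w := fun w hw => by
    rw [e₁]
    exact h.setIntegral_fderiv_nonneg hΩ.isCompact hg hgc hgV hg0 hw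
  have c₂ : ∀ w, δ * ‖w‖ < inner ℝ n₀ w → 0 ≤ L₂ w := fun w hw => by
    rw [e₂]
    refine integral_nonneg_of_ae ?_
    filter_upwards [hpos] with y hy
    by_cases hyV : y ∈ V
    · rw [real_inner_comm]
      exact mul_nonneg (hg0 y)
        ((isOuterUnitNormal_outerUnitNormal hy).inner_nonneg h hyV hy.1 hw)
    · simp [image_eq_zero_of_notMem_tsupport fun hm => hyV (hgV hm)]
  have b₁ := abs_sub_inner_mul_le_of_nonneg_on_cone h.norm_eq h.pos h.lt_half L₁.toLinearMap c₁ v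
  have b₂ := abs_sub_inner_mul_le_of_nonneg_on_cone h.norm_eq h.pos h.lt_half L₂.toLinearMap c₂ v
  simp only [ContinuousLinearMap.coe_coe] at b₁ b₂
  have hgi := hΩ.integrableOn_of_continuousOn hg.continuous.continuousOn
  have hgin : IntegrableOn (fun y => g y * inner ℝ n₀ (outerUnitNormal Ω y)) (frontier Ω)
      μHE[m - 1] := by
    have := hΩ.integrableOn_inner_normal (F := fun y => g y • n₀)
      (hg.continuous.smul continuous_const).continuousOn
    simpa only [real_inner_smul_left] using this
  have hup₂ : L₂ n₀ ≤ s := by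
    rw [e₂]
    refine integral_mono hgin hgi fun y => mul_le_of_le_one_right (hg0 y) ?_
    refine (real_inner_le_norm _ _).trans ?_
    rw [h.norm_eq, one_mul]
    exact norm_outerUnitNormal_le Ω y
  have hlo₂ : (1 - 2 * δ) * s ≤ L₂ n₀ := by
    rw [e₂, hs, ← integral_const_mul]
    refine integral_mono_ae (hgi.const_mul _) hgin ?_
    filter_upwards [hpos] with y hy
    by_cases hyV : y ∈ V
    · rw [mul_comm, real_inner_comm]
      exact mul_le_mul_of_nonneg_left (h.one_sub_le_inner_outerUnitNormal hyV hy) (hg0 y)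
    · simp [image_eq_zero_of_notMem_tsupport fun hm => hyV (hgV hm)]
  rw [← e₁] at hlo hup
  have hδ1 : (1 - δ) ^ (m - 1) ≤ 1 :=
    pow_le_one₀ (by linarith [h.lt_half]) (by linarith [h.pos])
  have hin : |(inner ℝ n₀ v : ℝ)| ≤ ‖v‖ := by
    have := abs_real_inner_le_norm n₀ v
    rwa [h.norm_eq, one_mul] at this
  have hdiff : |L₁ n₀ - L₂ n₀| ≤ (1 - (1 - δ) ^ (m - 1) + 2 * δ) * s := by
    have hδs : 0 ≤ δ * s := mul_nonneg h.pos.le hs0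
    have : (1 - δ) ^ (m - 1) * s ≤ s := mul_le_of_le_one_left hs0 hδ1
    rw [abs_le]
    constructor <;> nlinarith
  have hdv : 0 ≤ 2 * δ * ‖v‖ := by have := h.pos; positivity
  rw [hD]
  calc |L₁ v - L₂ v| = |(L₁ v - inner ℝ n₀ v * L₁ n₀) + inner ℝ n₀ v * (L₁ n₀ - L₂ n₀)
        - (L₂ v - inner ℝ n₀ v * L₂ n₀)| := by ring_nf
    _ ≤ |L₁ v - inner ℝ n₀ v * L₁ n₀| + |inner ℝ n₀ v * (L₁ n₀ - L₂ n₀)|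
        + |L₂ v - inner ℝ n₀ v * L₂ n₀| := (abs_sub _ _).trans (by gcongr; exact abs_add_le _ _)
    _ ≤ 2 * δ * ‖v‖ * s + ‖v‖ * ((1 - (1 - δ) ^ (m - 1) + 2 * δ) * s) + 2 * δ * ‖v‖ * s := by
        rw [abs_mul]
        gcongr
        · exact b₁.trans (by gcongr)
        · exact b₂.trans (by gcongr)
    _ = _ := by ring

theorem IsPiecewiseC1Body.divergenceDefect_add (hΩ : IsPiecewiseC1Body Ω)
    (v : EuclideanSpace ℝ (Fin m)) {f g : EuclideanSpace ℝ (Fin m) → ℝ} (hf : ContDiff ℝ 1 f)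
    (hg : ContDiff ℝ 1 g) : divergenceDefect Ω v (fun y => f y + g y)
      = divergenceDefect Ω v f + divergenceDefect Ω v g := by
  have h1 : ∀ y, fderiv ℝ (fun y => f y + g y) y v = fderiv ℝ f y v + fderiv ℝ g y v := fun y => by
    rw [fderiv_fun_add (hf.differentiable one_ne_zero y) (hg.differentiable one_ne_zero y)]
    rfl
  have hi : ∀ {f : EuclideanSpace ℝ (Fin m) → ℝ}, ContDiff ℝ 1 f →
      IntegrableOn (fun y => fderiv ℝ f y v) Ω := fun hf =>
    ((hf.continuous_fderiv one_ne_zero).clm_apply continuous_const).continuousOn.integrableOn_compact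
      hΩ.isCompact
  have hn : ∀ {f : EuclideanSpace ℝ (Fin m) → ℝ}, ContDiff ℝ 1 f →
      IntegrableOn (fun y => f y * inner ℝ v (outerUnitNormal Ω y)) (frontier Ω) μHE[m - 1] :=
    fun {f} hf => by
      have := hΩ.integrableOn_inner_normal (F := fun y => f y • v)
        (hf.continuous.smul continuous_const).continuousOn
      simpa only [real_inner_smul_left] using this
  simp only [divergenceDefect, h1, add_mul]
  rw [integral_add (hi hf) (hi hg), integral_add (hn hf) (hn hg)]
  ring

theorem divergenceDefect_const_mul (v : EuclideanSpace ℝ (Fin m))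
    {f : EuclideanSpace ℝ (Fin m) → ℝ} (hf : ContDiff ℝ 1 f) (c : ℝ) :
    divergenceDefect Ω v (fun y => c * f y) = c * divergenceDefect Ω v f := by
  have h1 : ∀ y, fderiv ℝ (fun y => c * f y) y v = c * fderiv ℝ f y v := fun y => by
    rw [fderiv_const_mul (hf.differentiable one_ne_zero y)]
    rfl
  simp only [divergenceDefect, h1, mul_assoc, integral_const_mul, mul_sub]

theorem IsPiecewiseC1Body.divergenceDefect_sum (hΩ : IsPiecewiseC1Body Ω)
    (v : EuclideanSpace ℝ (Fin m)) {ι : Type*} (s : Finset ι)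
    {f : ι → EuclideanSpace ℝ (Fin m) → ℝ} (hf : ∀ i, ContDiff ℝ 1 (f i)) :
    divergenceDefect Ω v (fun y => ∑ i ∈ s, f i y) = ∑ i ∈ s, divergenceDefect Ω v (f i) := by
  classical
  induction s using Finset.induction_on with
  | empty => simp [divergenceDefect]
  | insert i s hi ih =>
    simp only [Finset.sum_insert hi]
    rw [hΩ.divergenceDefect_add v (hf i) (ContDiff.sum fun j _ => hf j), ih]
end

/-! ### From local to global: the divergence theorem away from the singular set -/

section
open scoped Manifold ContDiff

variable {m : ℕ} {Ω : Set (EuclideanSpace ℝ (Fin m))}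

theorem integral_fderiv_apply_eq_zero {g : EuclideanSpace ℝ (Fin m) → ℝ} (hg : ContDiff ℝ 1 g)
    (hgc : HasCompactSupport g) (v : EuclideanSpace ℝ (Fin m)) : ∫ y, fderiv ℝ g y v = 0 := by
  have h1 : Integrable fun y => fderiv ℝ g y v :=
    ((hg.continuous_fderiv one_ne_zero).clm_apply continuous_const).integrable_of_hasCompactSupport
      (hgc.fderiv_apply (𝕜 := ℝ) v)
  have h2 : Integrable g := hg.continuous.integrable_of_hasCompactSupport hgc
  have := integral_mul_fderiv_eq_neg_fderiv_mul_of_integrable (μ := volume) (𝕜 := ℝ)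
    (f := fun _ => (1 : ℝ)) (g := g) (v := v) (by simp) (by simpa using h1) (by simpa using h2)
    (fun x _ => by fun_prop) (fun x _ => hg.differentiable one_ne_zero x)
  simpa using this

theorem divergenceDefect_eq_zero_of_tsupport_subset_compl
    {g : EuclideanSpace ℝ (Fin m) → ℝ} (hΩ : IsClosed Ω) (hg : tsupport g ⊆ Ωᶜ)
    (v : EuclideanSpace ℝ (Fin m)) : divergenceDefect Ω v g = 0 := by
  have h1 : ∫ y in Ω, fderiv ℝ g y v = 0 :=
    setIntegral_eq_zero_of_forall_eq_zero fun y hy => by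
      rw [fderiv_of_notMem_tsupport ℝ fun h => hg h hy]; rfl
  have h2 : ∫ y in frontier Ω, g y * inner ℝ v (outerUnitNormal Ω y) ∂μHE[m - 1] = 0 :=
    setIntegral_eq_zero_of_forall_eq_zero fun y hy => by
      rw [image_eq_zero_of_notMem_tsupport fun h => hg h (hΩ.frontier_subset hy), zero_mul]
  rw [divergenceDefect, h1, h2, sub_zero]

theorem divergenceDefect_eq_zero_of_tsupport_subset_interior
    {g : EuclideanSpace ℝ (Fin m) → ℝ} (hg : ContDiff ℝ 1 g)
    (hgc : HasCompactSupport g) (hgi : tsupport g ⊆ interior Ω)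
    (v : EuclideanSpace ℝ (Fin m)) : divergenceDefect Ω v g = 0 := by
  have h1 : ∫ y in Ω, fderiv ℝ g y v = 0 := by
    rw [setIntegral_eq_integral_of_forall_compl_eq_zero, integral_fderiv_apply_eq_zero hg hgc]
    intro y hy
    rw [fderiv_of_notMem_tsupport ℝ fun h => hy (interior_subset (hgi h))]; rfl
  have h2 : ∫ y in frontier Ω, g y * inner ℝ v (outerUnitNormal Ω y) ∂μHE[m - 1] = 0 :=
    setIntegral_eq_zero_of_forall_eq_zero fun y hy => by
      rw [image_eq_zero_of_notMem_tsupport fun h => hy.2 (hgi h), zero_mul]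
  rw [divergenceDefect, h1, h2, sub_zero]

/-- Away from the singular points of the boundary, the divergence theorem holds locally up to an
arbitrarily small relative error. -/
theorem IsPiecewiseC1Body.exists_nhds_abs_divergenceDefect_le (hΩ : IsPiecewiseC1Body Ω)
    (v : EuclideanSpace ℝ (Fin m)) {ε : ℝ} (hε : 0 < ε) {y : EuclideanSpace ℝ (Fin m)}
    (hy : y ∉ frontier Ω \ regularBoundary Ω) :
    ∃ V, IsOpen V ∧ y ∈ V ∧ Bornology.IsBounded V ∧
      ∀ g : EuclideanSpace ℝ (Fin m) → ℝ, ContDiff ℝ 1 g → HasCompactSupport g → tsupport g ⊆ V →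
        (∀ y, 0 ≤ g y) → |divergenceDefect Ω v g| ≤ ε * ∫ y in frontier Ω, g y ∂μHE[m - 1] := by
  suffices h : ∃ V, IsOpen V ∧ y ∈ V ∧
      ∀ g : EuclideanSpace ℝ (Fin m) → ℝ, ContDiff ℝ 1 g → HasCompactSupport g → tsupport g ⊆ V →
        (∀ y, 0 ≤ g y) →
          |divergenceDefect Ω v g| ≤ ε * ∫ y in frontier Ω, g y ∂μHE[m - 1] by
    obtain ⟨V, hV, hyV, h⟩ := h
    exact ⟨V ∩ Metric.ball y 1, hV.inter Metric.isOpen_ball, ⟨hyV, Metric.mem_ball_self one_pos⟩,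
      Metric.isBounded_ball.subset inter_subset_right,
      fun g h1 h2 h3 h4 => h g h1 h2 (h3.trans inter_subset_left) h4⟩
  have hnn : ∀ g : EuclideanSpace ℝ (Fin m) → ℝ, (∀ y, 0 ≤ g y) →
      0 ≤ ε * ∫ y in frontier Ω, g y ∂μHE[m - 1] := fun g hg =>
    mul_nonneg hε.le (integral_nonneg hg)
  by_cases hyΩ : y ∈ Ω
  · by_cases hyi : y ∈ interior Ω
    · refine ⟨interior Ω, isOpen_interior, hyi, fun g hg hgc hgV hg0 => ?_⟩
      rw [divergenceDefect_eq_zero_of_tsupport_subset_interior hg hgc hgV, abs_zero]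
      exact hnn g hg0
    · have hyr : y ∈ regularBoundary Ω := by
        by_contra hr
        exact hy ⟨⟨subset_closure hyΩ, hyi⟩, hr⟩
      -- The relative error of a chart tends to `0` with `δ`, and a regular point has charts of
      -- every positive `δ < 1/2`.
      have hcont : ContinuousAt (fun δ : ℝ => (1 - (1 - δ) ^ (m - 1) + 6 * δ) * ‖v‖) 0 := by
        fun_prop
      obtain ⟨δ, ⟨hδ1, hδ2⟩, hδ⟩ := ((((hcont.eventually_lt_const (by simpa using hε)).and
        (eventually_lt_nhds (by norm_num : (0 : ℝ) < 1 / 2))).filter_mono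
        nhdsWithin_le_nhds).and self_mem_nhdsWithin : ∀ᶠ t in 𝓝[>] (0 : ℝ), _).exists
      obtain ⟨V, φ, hyV, hV, -⟩ :=
        (isOuterUnitNormal_outerUnitNormal hyr).exists_isFlatChart hδ hδ2
      refine ⟨V, hV.isOpen, hyV, fun g hg hgc hgV hg0 => ?_⟩
      refine (hV.abs_divergenceDefect_le hΩ hg hgc hgV hg0 v).trans ?_
      exact mul_le_mul_of_nonneg_right hδ1.le (integral_nonneg hg0)
  · refine ⟨Ωᶜ, hΩ.isCompact.isClosed.isOpen_compl, hyΩ, fun g hg hgc hgV hg0 => ?_⟩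
    rw [divergenceDefect_eq_zero_of_tsupport_subset_compl hΩ.isCompact.isClosed hgV, abs_zero]
    exact hnn g hg0

/-- The divergence theorem for functions which vanish near the singular points. -/
theorem IsPiecewiseC1Body.divergenceDefect_eq_zero_of_disjoint (hΩ : IsPiecewiseC1Body Ω)
    (v : EuclideanSpace ℝ (Fin m)) {f : EuclideanSpace ℝ (Fin m) → ℝ} (hf : ContDiff ℝ 1 f)
    (hfc : HasCompactSupport f) (hfs : Disjoint (tsupport f) (frontier Ω \ regularBoundary Ω)) :
    divergenceDefect Ω v f = 0 := by
  have := hΩ.isFiniteMeasure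
  obtain ⟨M, hM⟩ := hf.continuous.bounded_above_of_compact_support hfc
  have hM0 : 0 ≤ M := (norm_nonneg _).trans (hM 0)
  set A := (μHE[m - 1]).real (frontier Ω) with hA
  -- The bound is linear in `ε` with a factor independent of the cover, because the local errors are
  -- measured by `∫_∂Ω ρ i` and these sum to at most the area `A`.
  suffices h : ∀ ε > 0, |divergenceDefect Ω v f| ≤ 3 * M * A * ε by
    by_contra hne
    have hpos : 0 < |divergenceDefect Ω v f| := abs_pos.2 hne
    have hA0 : 0 ≤ 3 * M * A := by positivity
    have h1 := h (|divergenceDefect Ω v f| / (2 * (3 * M * A + 1))) (by positivity)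
    rw [mul_div_assoc', le_div_iff₀ (by positivity)] at h1
    nlinarith
  intro ε hε
  have hloc : ∀ y : tsupport f, _ := fun y =>
    hΩ.exists_nhds_abs_divergenceDefect_le v hε (disjoint_left.1 hfs y.2)
  choose V hVo hyV hVb hV using hloc
  obtain ⟨t, ht⟩ := hfc.elim_finite_subcover V hVo fun y hy => mem_iUnion.2 ⟨⟨y, hy⟩, hyV _⟩
  obtain ⟨ρ, hρ⟩ := SmoothPartitionOfUnity.exists_isSubordinate
    𝓘(ℝ, EuclideanSpace ℝ (Fin m)) (isClosed_tsupport f) (fun i : t => V i.1)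
    (fun i => hVo i.1) (fun y hy => by
      obtain ⟨i, hi, hyi⟩ := mem_iUnion₂.1 (ht hy)
      exact mem_iUnion.2 ⟨⟨i, hi⟩, hyi⟩)
  have hρc : ∀ i, ContDiff ℝ 1 (ρ i) := fun i =>
    (contMDiff_iff_contDiff.1 (ρ i).contMDiff).of_le (by exact_mod_cast le_top)
  have hρs : ∀ i, HasCompactSupport (ρ i) := fun i =>
    Metric.isCompact_of_isClosed_isBounded (isClosed_tsupport _) ((hVb i.1).subset (hρ i))
  have hsum : ∀ y, f y = ∑ i, ρ i y * f y := by
    intro y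
    rw [← Finset.sum_mul]
    by_cases hy : y ∈ tsupport f
    · have := ρ.sum_eq_one hy
      rw [finsum_eq_sum_of_fintype] at this
      rw [this, one_mul]
    · rw [image_eq_zero_of_notMem_tsupport hy, mul_zero]
  have hint : ∀ {g : EuclideanSpace ℝ (Fin m) → ℝ}, Continuous g →
      IntegrableOn g (frontier Ω) μHE[m - 1] := fun hg =>
    hΩ.integrableOn_of_continuousOn hg.continuousOn
  have hterm : ∀ i, |divergenceDefect Ω v fun y => ρ i y * f y|
      ≤ 3 * M * ε * ∫ y in frontier Ω, ρ i y ∂μHE[m - 1] := by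
    intro i
    have hfM : ∀ y, |f y| ≤ M := hM
    -- The local estimate needs nonnegative functions, so `ρ f` is written as `ρ (f + M) - M ρ`. The
    -- two parts cost `2M` and `M`, which explains the factor `3M`.
    have hc1 : ContDiff ℝ 1 fun y => ρ i y * (f y + M) := (hρc i).mul (hf.add contDiff_const)
    have e1 : (fun y => ρ i y * f y) = fun y => ρ i y * (f y + M) + (-M) * ρ i y := by
      ext y; ring
    have hb1 := hV i.1 (fun y => ρ i y * (f y + M)) hc1 ((hρs i).mul_right)
      ((tsupport_mul_subset_left).trans (hρ i))
      (fun y => mul_nonneg (ρ.nonneg i y) (by linarith [neg_le_of_abs_le (hfM y)]))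
    have hb2 := hV i.1 (ρ i) (hρc i) (hρs i) (hρ i) (fun y => ρ.nonneg i y)
    have hb3 : ∫ y in frontier Ω, ρ i y * (f y + M) ∂μHE[m - 1]
        ≤ 2 * M * ∫ y in frontier Ω, ρ i y ∂μHE[m - 1] := by
      rw [← integral_const_mul]
      refine integral_mono (hint hc1.continuous) ((hint (hρc i).continuous).const_mul _) fun y => ?_
      have := le_of_abs_le (hfM y)
      have := ρ.nonneg i y
      simp only
      nlinarith
    rw [e1, hΩ.divergenceDefect_add v hc1 (contDiff_const.mul (hρc i)),
      divergenceDefect_const_mul v (hρc i)]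
    refine (abs_add_le _ _).trans ?_
    rw [abs_mul, abs_neg, abs_of_nonneg hM0]
    have hb4 := mul_le_mul_of_nonneg_left hb3 hε.le
    have hb5 := mul_le_mul_of_nonneg_left hb2 hM0
    linarith
  have hfe : divergenceDefect Ω v f = ∑ i, divergenceDefect Ω v fun y => ρ i y * f y := by
    rw [← hΩ.divergenceDefect_sum v Finset.univ fun i => (hρc i).mul hf]
    exact congrArg _ (funext hsum)
  have hone : ∑ i, ∫ y in frontier Ω, ρ i y ∂μHE[m - 1] ≤ A := by
    rw [← integral_finsetSum _ fun i _ => hint (hρc i).continuous]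
    have : A = ∫ y in frontier Ω, (1 : ℝ) ∂μHE[m - 1] := by simp [hA]
    rw [this]
    refine integral_mono (hint (continuous_finsetSum _ fun i _ => (hρc i).continuous))
      (integrable_const _) fun y => ?_
    have := ρ.sum_le_one y
    rwa [finsum_eq_sum_of_fintype] at this
  calc |divergenceDefect Ω v f| ≤ ∑ i, |divergenceDefect Ω v fun y => ρ i y * f y| := by
        rw [hfe]; exact Finset.abs_sum_le_sum_abs _ _
    _ ≤ ∑ i, 3 * M * ε * ∫ y in frontier Ω, ρ i y ∂μHE[m - 1] := Finset.sum_le_sum fun i _ => hterm i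
    _ = 3 * M * ε * ∑ i, ∫ y in frontier Ω, ρ i y ∂μHE[m - 1] := by rw [Finset.mul_sum]
    _ ≤ 3 * M * ε * A := by gcongr
    _ = _ := by ring
end

/-! ### Removing the singular set by cutoffs with small gradient -/

section

variable {m : ℕ} {Ω : Set (EuclideanSpace ℝ (Fin m))}

/-- A compact set of vanishing `d`-dimensional Hausdorff measure has finite covers by small balls
centred on it, the sum of the `d`-th powers of whose radii is small. -/
theorem IsCompact.exists_finset_ball_cover {X : Type*} [Nonempty X] [MetricSpace X] [MeasurableSpace X]
    [BorelSpace X] {S : Set X} (hS : IsCompact S) {d : ℕ} (hd : d ≠ 0) (h0 : μHE[d] S = 0)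
    {ε : ℝ} (hε : 0 < ε) :
    ∃ (s : Finset ℕ) (c : ℕ → X) (r : ℕ → ℝ), (∀ i ∈ s, 0 < r i ∧ r i < ε ∧ c i ∈ S) ∧
      S ⊆ ⋃ i ∈ s, Metric.ball (c i) (r i) ∧ ∑ i ∈ s, r i ^ d ≤ ε := by
  rcases S.eq_empty_or_nonempty with rfl | ⟨x₀, hx₀⟩
  · exact ⟨∅, fun _ => Classical.arbitrary X, fun _ => 0, by simp, by simp, by simpa using hε.le⟩
  have h1 : μH[d] S = 0 := by
    rw [Measure.euclideanHausdorffMeasure_def, Measure.smul_apply, ENNReal.smul_def, smul_eq_mul,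
      mul_eq_zero, ENNReal.coe_eq_zero] at h0
    exact h0.resolve_left (Measure.addHaarScalarFactor_volume_hausdorffMeasure_ne_zero d)
  rw [Measure.hausdorffMeasure_apply] at h1
  simp only [ENNReal.iSup_eq_zero] at h1
  have hη : (0 : ENNReal) < ENNReal.ofReal (ε / 2) := ENNReal.ofReal_pos.2 (by linarith)
  have h2 := (h1 (ENNReal.ofReal (ε / 2)) hη).trans_lt hη
  simp only [iInf_lt_iff] at h2
  obtain ⟨t, htS, htd, htsum⟩ := h2
  obtain ⟨η, hη0, hηsum⟩ := ENNReal.exists_pos_sum_of_countable hη.ne' ℕ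
  have hfin : ∀ n, Metric.ediam (t n) ≠ ⊤ := fun n => ne_top_of_le_ne_top ENNReal.ofReal_ne_top (htd n)
  -- Radii are taken strictly above the diameters, so that open balls centred at points of the
  -- pieces cover them and points also get a positive radius. The excess in the sum is controlled by
  -- the summable `η`.
  have hr : ∀ n, ∃ r : ℝ, (Metric.ediam (t n)).toReal < r ∧ r < ε ∧
      r ^ d < (Metric.ediam (t n)).toReal ^ d + η n := by
    intro n
    have hlt : (Metric.ediam (t n)).toReal < ε := by
      have := ENNReal.toReal_mono ENNReal.ofReal_ne_top (htd n)
      rw [ENNReal.toReal_ofReal (by linarith)] at this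
      linarith
    have hc : ContinuousAt (fun r : ℝ => r ^ d) (Metric.ediam (t n)).toReal := by fun_prop
    obtain ⟨r, ⟨h3, h4⟩, h5⟩ := ((((eventually_lt_nhds hlt).and (hc.eventually_lt_const
      (lt_add_of_pos_right _ (NNReal.coe_pos.2 (hη0 n))))).filter_mono
      nhdsWithin_le_nhds).and self_mem_nhdsWithin :
        ∀ᶠ r in 𝓝[>] (Metric.ediam (t n)).toReal, _).exists
    exact ⟨r, h5, h3, h4⟩
  choose r hr1 hr2 hr3 using hr
  have hc : ∀ n, ∃ c ∈ S, S ∩ t n ⊆ Metric.ball c (r n) := by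
    intro n
    rcases (S ∩ t n).eq_empty_or_nonempty with he | ⟨c, hcS, hct⟩
    · exact ⟨x₀, hx₀, by simp [he]⟩
    · refine ⟨c, hcS, fun y hy => ?_⟩
      rw [Metric.mem_ball, dist_edist]
      refine lt_of_le_of_lt (ENNReal.toReal_mono (hfin n) ?_) (hr1 n)
      exact Metric.edist_le_ediam_of_mem hy.2 hct
  choose c hcS hct using hc
  obtain ⟨s, hs⟩ := hS.elim_finite_subcover (fun n => Metric.ball (c n) (r n))
    (fun n => Metric.isOpen_ball) fun y hy => by
      obtain ⟨n, hn⟩ := mem_iUnion.1 (htS hy)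
      exact mem_iUnion.2 ⟨n, hct n ⟨hy, hn⟩⟩
  have hr0 : ∀ n, 0 < r n := fun n => ENNReal.toReal_nonneg.trans_lt (hr1 n)
  refine ⟨s, c, r, fun i _ => ⟨hr0 i, hr2 i, hcS i⟩, hs, ?_⟩
  have hterm : ∀ n, ENNReal.ofReal (r n ^ d)
      ≤ (⨆ _ : (t n).Nonempty, Metric.ediam (t n) ^ (d : ℝ)) + η n := by
    intro n
    -- For an empty piece the supremum is `0`; the right side agrees because `d ≠ 0`.
    have h3 : (⨆ _ : (t n).Nonempty, Metric.ediam (t n) ^ (d : ℝ)) = Metric.ediam (t n) ^ d := by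
      rw [ENNReal.rpow_natCast]
      rcases (t n).eq_empty_or_nonempty with he | hne
      · simp [he, hd]
      · simp [hne]
    rw [h3]
    refine (ENNReal.ofReal_le_ofReal (hr3 n).le).trans ?_
    rw [ENNReal.ofReal_add (by positivity) (by positivity), ENNReal.ofReal_pow (by positivity),
      ENNReal.ofReal_toReal (hfin n), ENNReal.ofReal_coe_nnreal]
  have hfinal : ENNReal.ofReal (∑ i ∈ s, r i ^ d) ≤ ENNReal.ofReal ε := by
    rw [ENNReal.ofReal_sum_of_nonneg fun i _ => (pow_pos (hr0 i) d).le]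
    calc ∑ i ∈ s, ENNReal.ofReal (r i ^ d)
        ≤ ∑ i ∈ s, ((⨆ _ : (t i).Nonempty, Metric.ediam (t i) ^ (d : ℝ)) + η i) :=
          Finset.sum_le_sum fun i _ => hterm i
      _ ≤ ∑' i, ((⨆ _ : (t i).Nonempty, Metric.ediam (t i) ^ (d : ℝ)) + η i) :=
          ENNReal.sum_le_tsum s
      _ ≤ ENNReal.ofReal (ε / 2) + ENNReal.ofReal (ε / 2) := by
          rw [ENNReal.tsum_add]
          exact add_le_add htsum.le hηsum.le
      _ = ENNReal.ofReal ε := by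
          rw [← ENNReal.ofReal_add (by linarith) (by linarith), add_halves]
  exact (ENNReal.ofReal_le_ofReal_iff hε.le).1 hfinal

/-- Rescaling one fixed bump function gives a gradient of size `O(1/r)`, supported in a ball of
volume `O(r^m)`, with a constant independent of centre and radius. The form `r ^ m / r` avoids
truncated subtraction, so that `m = 0` needs no exception. -/
theorem exists_contDiff_cutoff_ball (m : ℕ) :
    ∃ C : ℝ, 0 ≤ C ∧ ∀ (c : EuclideanSpace ℝ (Fin m)) (r : ℝ), 0 < r →
      ∃ χ : EuclideanSpace ℝ (Fin m) → ℝ, ContDiff ℝ 1 χ ∧ (∀ y, 0 ≤ χ y) ∧ (∀ y, χ y ≤ 1) ∧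
        (∀ y ∈ Metric.ball c r, χ y = 1) ∧ (∀ y, y ∉ Metric.ball c (2 * r) → χ y = 0) ∧
        ∫⁻ y, ENNReal.ofReal ‖fderiv ℝ χ y‖ ≤ ENNReal.ofReal (C * (r ^ m / r)) := by
  let b : ContDiffBump (0 : EuclideanSpace ℝ (Fin m)) := ⟨1, 2, one_pos, one_lt_two⟩
  have hb : ContDiff ℝ 1 b := b.contDiff
  obtain ⟨C, hC⟩ := (hb.continuous_fderiv one_ne_zero).bounded_above_of_compact_support
    (b.hasCompactSupport.fderiv (𝕜 := ℝ))
  have hC0 : 0 ≤ C := (norm_nonneg _).trans (hC 0)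
  set ω := volume.real (Metric.ball (0 : EuclideanSpace ℝ (Fin m)) 1) with hω
  refine ⟨C * 2 ^ m * ω, by positivity, fun c r hr => ?_⟩
  have hd : ∀ y, HasFDerivAt (fun y => b (r⁻¹ • (y - c)))
      ((fderiv ℝ b (r⁻¹ • (y - c))).comp (r⁻¹ • ContinuousLinearMap.id ℝ _)) y := fun y =>
    (hb.differentiable one_ne_zero _).hasFDerivAt.comp y
      (((hasFDerivAt_id y).sub_const c).const_smul r⁻¹)
  have hnorm : ∀ y, ‖r⁻¹ • (y - c)‖ = dist y c / r := fun y => by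
    rw [norm_smul, norm_inv, Real.norm_of_nonneg hr.le, dist_eq_norm]; ring
  have hzero : ∀ y, y ∉ Metric.ball c (2 * r) → b (r⁻¹ • (y - c)) = 0 := fun y hy => by
    refine b.zero_of_le_dist ?_
    rw [dist_zero_right, hnorm]
    change 2 ≤ _
    rw [le_div_iff₀ hr]
    exact not_lt.1 hy
  refine ⟨fun y => b (r⁻¹ • (y - c)), hb.comp (by fun_prop), fun y => b.nonneg, fun y => b.le_one,
    fun y hy => ?_, hzero, ?_⟩
  · refine b.one_of_mem_closedBall ?_
    rw [Metric.mem_closedBall, dist_zero_right, hnorm]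
    change _ ≤ 1
    rw [div_le_one hr]
    exact (Metric.mem_ball.1 hy).le
  · have hbound : ∀ y, ENNReal.ofReal ‖fderiv ℝ (fun y => b (r⁻¹ • (y - c))) y‖
        ≤ (Metric.closedBall c (2 * r)).indicator (fun _ => ENNReal.ofReal (C * r⁻¹)) y := by
      intro y
      by_cases hy : y ∈ Metric.closedBall c (2 * r)
      · rw [indicator_of_mem hy, (hd y).fderiv]
        refine ENNReal.ofReal_le_ofReal ((ContinuousLinearMap.opNorm_comp_le _ _).trans ?_)
        gcongr
        · exact hC _
        · rw [norm_smul, norm_inv, Real.norm_of_nonneg hr.le]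
          exact mul_le_of_le_one_right (by positivity) ContinuousLinearMap.norm_id_le
      · rw [indicator_of_notMem hy]
        have : y ∉ tsupport fun y => b (r⁻¹ • (y - c)) := fun hm => hy
          (closure_minimal (fun z hz => by
            by_contra hcon
            exact hz (hzero z fun h => hcon (Metric.ball_subset_closedBall h)))
            Metric.isClosed_closedBall hm)
        rw [fderiv_of_notMem_tsupport ℝ this, norm_zero, ENNReal.ofReal_zero]
    refine (lintegral_mono hbound).trans ?_
    rw [lintegral_indicator_const Metric.isClosed_closedBall.measurableSet,
      Measure.addHaar_closedBall _ _ (by positivity), finrank_euclideanSpace_fin,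
      show volume (Metric.ball (0 : EuclideanSpace ℝ (Fin m)) 1) = ENNReal.ofReal ω from
        (ENNReal.ofReal_toReal measure_ball_lt_top.ne).symm,
      ← ENNReal.ofReal_mul (by positivity), ← ENNReal.ofReal_mul (by positivity)]
    refine ENNReal.ofReal_le_ofReal (le_of_eq ?_)
    rw [mul_pow]
    field_simp

/-- A cutoff function which vanishes near finitely many balls. -/
theorem exists_contDiff_cutoff_finset (m : ℕ) :
    ∃ C : ℝ, 0 ≤ C ∧ ∀ (s : Finset ℕ) (c : ℕ → EuclideanSpace ℝ (Fin m)) (r : ℕ → ℝ),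
      (∀ i ∈ s, 0 < r i) →
      ∃ ζ : EuclideanSpace ℝ (Fin m) → ℝ, ContDiff ℝ 1 ζ ∧ (∀ y, 0 ≤ ζ y) ∧ (∀ y, ζ y ≤ 1) ∧
        (∀ i ∈ s, ∀ y ∈ Metric.ball (c i) (r i), ζ y = 0) ∧
        (∀ y, (∀ i ∈ s, y ∉ Metric.ball (c i) (2 * r i)) → ζ y = 1) ∧
        ∫⁻ y, ENNReal.ofReal ‖fderiv ℝ ζ y‖ ≤ ENNReal.ofReal (C * ∑ i ∈ s, r i ^ m / r i) := by
  obtain ⟨C, hC0, hC⟩ := exists_contDiff_cutoff_ball m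
  refine ⟨C, hC0, fun s c r => ?_⟩
  induction s using Finset.induction_on with
  | empty => exact fun _ => ⟨fun _ => 1, contDiff_const, by simp, by simp, by simp, by simp, by simp⟩
  | insert i s hi ih =>
    intro hr
    obtain ⟨ζ, h1, h2, h3, h4, h5, h6⟩ := ih fun j hj => hr j (Finset.mem_insert_of_mem hj)
    have hri := hr i (Finset.mem_insert_self i s)
    obtain ⟨χ, g1, g2, g3, g4, g5, g6⟩ := hC (c i) (r i) hri
    have hcd : ContDiff ℝ 1 fun y => 1 - χ y := contDiff_const.sub g1
    -- All factors take values in `[0, 1]`, so by the product rule the `L¹` norms of their gradients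
    -- simply add up.
    refine ⟨fun y => ζ y * (1 - χ y), h1.mul hcd,
      fun y => mul_nonneg (h2 y) (sub_nonneg.2 (g3 y)),
      fun y => mul_le_one₀ (h3 y) (sub_nonneg.2 (g3 y)) (sub_le_self _ (g2 y)), ?_, ?_, ?_⟩
    · intro j hj y hy
      rcases Finset.mem_insert.1 hj with rfl | hj
      · simp [g4 y hy]
      · simp [h4 j hj y hy]
    · intro y hy
      simp [h5 y fun j hj => hy j (Finset.mem_insert_of_mem hj),
        g5 y (hy i (Finset.mem_insert_self i s))]
    · have hfd : ∀ y, ENNReal.ofReal ‖fderiv ℝ (fun y => ζ y * (1 - χ y)) y‖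
          ≤ ENNReal.ofReal ‖fderiv ℝ ζ y‖ + ENNReal.ofReal ‖fderiv ℝ χ y‖ := by
        intro y
        have e : fderiv ℝ (fun y => ζ y * (1 - χ y)) y
            = ζ y • (-fderiv ℝ χ y) + (1 - χ y) • fderiv ℝ ζ y := by
          rw [fderiv_fun_mul (h1.differentiable one_ne_zero y) (hcd.differentiable one_ne_zero y),
            fderiv_const_sub]
        rw [e, ← ENNReal.ofReal_add (norm_nonneg _) (norm_nonneg _)]
        refine ENNReal.ofReal_le_ofReal ?_
        rw [add_comm ‖fderiv ℝ ζ y‖]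
        refine (norm_add_le _ _).trans ?_
        rw [norm_smul, norm_smul, norm_neg, Real.norm_of_nonneg (h2 y),
          Real.norm_of_nonneg (sub_nonneg.2 (g3 y))]
        exact add_le_add (mul_le_of_le_one_left (norm_nonneg _) (h3 y))
          (mul_le_of_le_one_left (norm_nonneg _) (sub_le_self _ (g2 y)))
      refine (lintegral_mono hfd).trans ?_
      rw [lintegral_add_left (h1.continuous_fderiv one_ne_zero).norm.measurable.ennreal_ofReal,
        Finset.sum_insert hi, mul_add, add_comm (C * _), ENNReal.ofReal_add
          (mul_nonneg hC0 (Finset.sum_nonneg fun j hj => by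
            have := hr j (Finset.mem_insert_of_mem hj); positivity)) (by positivity)]
      exact add_le_add h6 g6

/-- Cutoff functions near a compact set of area zero. -/
theorem IsCompact.exists_contDiff_cutoff_seq (hm : 2 ≤ m) {S : Set (EuclideanSpace ℝ (Fin m))}
    (hS : IsCompact S) (h0 : μHE[m - 1] S = 0) :
    ∃ ζ : ℕ → EuclideanSpace ℝ (Fin m) → ℝ, (∀ k, ContDiff ℝ 1 (ζ k)) ∧
      (∀ k y, ‖ζ k y‖ ≤ 1) ∧ (∀ k, Disjoint (tsupport (ζ k)) S) ∧
      (∀ y ∉ S, ∀ᶠ k in atTop, ζ k y = 1) ∧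
      Tendsto (fun k => ∫⁻ y, ENNReal.ofReal ‖fderiv ℝ (ζ k) y‖) atTop (𝓝 0) := by
  obtain ⟨C, hC0, hC⟩ := exists_contDiff_cutoff_finset m
  have hε : ∀ k : ℕ, (0 : ℝ) < 1 / (k + 1) := fun k => by positivity
  have hcov : ∀ k : ℕ, _ := fun k => hS.exists_finset_ball_cover (by omega : m - 1 ≠ 0) h0 (hε k)
  choose s c r hr hcover hsum using hcov
  have hζ : ∀ k : ℕ, _ := fun k => hC (s k) (c k) (r k) fun i hi => (hr k i hi).1
  choose ζ h1 h2 h3 h4 h5 h6 using hζ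
  refine ⟨ζ, h1, fun k y => by rw [Real.norm_of_nonneg (h2 k y)]; exact h3 k y, fun k => ?_,
    fun y hy => ?_, ?_⟩
  · have hopen : IsOpen (⋃ i ∈ s k, Metric.ball (c k i) (r k i)) :=
      isOpen_biUnion fun i _ => Metric.isOpen_ball
    have hdisj : Disjoint (tsupport (ζ k)) (⋃ i ∈ s k, Metric.ball (c k i) (r k i)) := by
      refine Disjoint.closure_left (disjoint_left.2 fun y hy hy' => ?_) hopen
      obtain ⟨i, hi, hyi⟩ := mem_iUnion₂.1 hy'
      exact hy (h4 k i hi y hyi)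
    exact hdisj.mono_right (hcover k)
  -- The balls are centred on `S` and have radius below `1 / (k + 1)`. Once `2 / (k + 1)` is below
  -- the radius `ρ` of a ball around `y` that misses `S`, no doubled ball contains `y`.
  · obtain ⟨ρ, hρ, hball⟩ := Metric.isOpen_iff.1 hS.isClosed.isOpen_compl y hy
    have hlim : Tendsto (fun k : ℕ => 2 * (1 / ((k : ℝ) + 1))) atTop (𝓝 0) := by
      simpa using tendsto_one_div_add_atTop_nhds_zero_nat.const_mul (2 : ℝ)
    filter_upwards [hlim.eventually_lt_const hρ] with k hk
    refine h5 k y fun i hi hyi => hball (a := c k i) ?_ (hr k i hi).2.2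
    rw [Metric.mem_ball, dist_comm]
    have := (hr k i hi).2.1
    exact (Metric.mem_ball.1 hyi).trans (by linarith)
  · have hlim : Tendsto (fun k : ℕ => ENNReal.ofReal (C * (1 / ((k : ℝ) + 1)))) atTop (𝓝 0) := by
      simpa using ENNReal.tendsto_ofReal (tendsto_one_div_add_atTop_nhds_zero_nat.const_mul C)
    refine tendsto_of_tendsto_of_tendsto_of_le_of_le tendsto_const_nhds hlim
      (fun _ => zero_le) fun k => (h6 k).trans (ENNReal.ofReal_le_ofReal ?_)
    refine mul_le_mul_of_nonneg_left ((Finset.sum_congr rfl fun i hi => ?_).trans_le (hsum k)) hC0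
    have hp := (hr k i hi).1
    rw [div_eq_iff hp.ne', ← pow_succ]
    congr 1
    omega

/-- The divergence theorem for a vector field of constant direction. -/
theorem IsPiecewiseC1Body.divergenceDefect_eq_zero (hm : 2 ≤ m) (hΩ : IsPiecewiseC1Body Ω)
    (v : EuclideanSpace ℝ (Fin m)) {f : EuclideanSpace ℝ (Fin m) → ℝ} (hf : ContDiff ℝ 1 f)
    (hfc : HasCompactSupport f) : divergenceDefect Ω v f = 0 := by
  have hfin := hΩ.isFiniteMeasure
  set S := frontier Ω \ regularBoundary Ω with hSdef
  have hS : IsCompact S := hΩ.isCompact_frontier.of_isClosed_subset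
    (isClosed_frontier_diff_regularBoundary Ω) sdiff_subset
  obtain ⟨ζ, hζ, hζ1, hζS, hζlim, hζd⟩ := hS.exists_contDiff_cutoff_seq hm hΩ.area_singular
  -- Finite `(m-1)`-dimensional measure forces `m`-dimensional measure zero; hence the cutoffs tend
  -- to `1` almost everywhere on `Ω` as well as on the boundary.
  have hvolS : volume S = 0 := by
    have h1 := (Measure.euclideanHausdorffMeasure_zero_or_top (by omega : m - 1 < m) S).resolve_right
      (by rw [hΩ.area_singular]; exact ENNReal.zero_ne_top)
    rwa [EuclideanSpace.euclideanHausdorffMeasure_eq_volume] at h1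
  have hk : ∀ k, divergenceDefect Ω v (fun y => f y * ζ k y) = 0 := fun k =>
    hΩ.divergenceDefect_eq_zero_of_disjoint v (hf.mul (hζ k)) hfc.mul_right
      ((hζS k).mono_left (tsupport_mul_subset_right))
  have hcont : ∀ {g : EuclideanSpace ℝ (Fin m) → ℝ}, ContDiff ℝ 1 g →
      Continuous fun y => fderiv ℝ g y v := fun hg =>
    (hg.continuous_fderiv one_ne_zero).clm_apply continuous_const
  have hfd : ∀ k y, fderiv ℝ (fun y => f y * ζ k y) y v
      = ζ k y * fderiv ℝ f y v + f y * fderiv ℝ (ζ k) y v := fun k y => by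
    rw [fderiv_fun_mul (hf.differentiable one_ne_zero y) ((hζ k).differentiable one_ne_zero y)]
    simp only [add_apply, smul_apply, smul_eq_mul]
    ring
  have hfi : IntegrableOn (fun y => fderiv ℝ f y v) Ω :=
    (hcont hf).continuousOn.integrableOn_compact hΩ.isCompact
  have hni : IntegrableOn (fun y => f y * inner ℝ v (outerUnitNormal Ω y)) (frontier Ω)
      μHE[m - 1] := by
    have := hΩ.integrableOn_inner_normal (F := fun y => f y • v)
      (hf.continuous.smul continuous_const).continuousOn
    simpa only [real_inner_smul_left] using this
  have lim1 : Tendsto (fun k => ∫ y in Ω, ζ k y * fderiv ℝ f y v) atTop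
      (𝓝 (∫ y in Ω, fderiv ℝ f y v)) := by
    refine tendsto_integral_of_dominated_convergence (fun y => ‖fderiv ℝ f y v‖)
      (fun k => ((hζ k).continuous.mul (hcont hf)).aestronglyMeasurable) hfi.norm
      (fun k => Eventually.of_forall fun y => ?_) ?_
    · rw [norm_mul]
      exact mul_le_of_le_one_left (norm_nonneg _) (hζ1 k y)
    · filter_upwards [ae_restrict_of_ae (compl_mem_ae_iff.2 hvolS)] with y hy
      exact tendsto_const_nhds.congr' ((hζlim y hy).mono fun k hk => by simp only [hk, one_mul])
  -- This is the error term from differentiating the cutoff: `f` is bounded and the gradients tend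
  -- to `0` in `L¹`.
  have lim2 : Tendsto (fun k => ∫ y in Ω, f y * fderiv ℝ (ζ k) y v) atTop (𝓝 0) := by
    obtain ⟨M, hM⟩ := hf.continuous.bounded_above_of_compact_support hfc
    have hM0 : 0 ≤ M := (norm_nonneg _).trans (hM 0)
    rw [tendsto_zero_iff_enorm_tendsto_zero]
    have hlim : Tendsto (fun k => ENNReal.ofReal (M * ‖v‖) * ∫⁻ y, ENNReal.ofReal ‖fderiv ℝ (ζ k) y‖) atTop
        (𝓝 0) := by
      simpa using ENNReal.Tendsto.const_mul hζd (Or.inr ENNReal.ofReal_ne_top)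
    refine tendsto_of_tendsto_of_tendsto_of_le_of_le tendsto_const_nhds hlim
      (fun _ => zero_le) fun k => ?_
    refine (enorm_integral_le_lintegral_enorm _).trans ?_
    refine (setLIntegral_le_lintegral _ _).trans ?_
    rw [← lintegral_const_mul' _ _ ENNReal.ofReal_ne_top]
    refine lintegral_mono fun y => ?_
    rw [← ofReal_norm, ← ENNReal.ofReal_mul (by positivity)]
    refine ENNReal.ofReal_le_ofReal ?_
    rw [norm_mul]
    calc ‖f y‖ * ‖fderiv ℝ (ζ k) y v‖ ≤ M * (‖fderiv ℝ (ζ k) y‖ * ‖v‖) := by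
          gcongr
          · exact hM y
          · exact ContinuousLinearMap.le_opNorm _ _
      _ = _ := by ring
  have lim3 : Tendsto (fun k => ∫ y in frontier Ω,
      (f y * ζ k y) * inner ℝ v (outerUnitNormal Ω y) ∂μHE[m - 1]) atTop
      (𝓝 (∫ y in frontier Ω, f y * inner ℝ v (outerUnitNormal Ω y) ∂μHE[m - 1])) := by
    have e : ∀ k y, (f y * ζ k y) * inner ℝ v (outerUnitNormal Ω y)
        = ζ k y * (f y * inner ℝ v (outerUnitNormal Ω y)) := fun k y => by ring
    simp only [e]
    refine tendsto_integral_of_dominated_convergence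
      (fun y => ‖f y * inner ℝ v (outerUnitNormal Ω y)‖)
      (fun k => (hζ k).continuous.aestronglyMeasurable.mul hni.aestronglyMeasurable) hni.norm
      (fun k => Eventually.of_forall fun y => ?_) ?_
    · rw [norm_mul]
      exact mul_le_of_le_one_left (norm_nonneg _) (hζ1 k y)
    · filter_upwards [ae_restrict_of_ae (compl_mem_ae_iff.2 hΩ.area_singular)] with y hy
      exact tendsto_const_nhds.congr' ((hζlim y hy).mono fun k hk => by simp only [hk, one_mul])
  have hlim := (lim1.add lim2).sub lim3
  rw [add_zero] at hlim
  refine tendsto_nhds_unique hlim (tendsto_const_nhds.congr fun k => ?_)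
  rw [← hk k, divergenceDefect]
  simp only [hfd]
  rw [integral_add]
  · exact ((hζ k).continuous.mul (hcont hf)).continuousOn.integrableOn_compact hΩ.isCompact
  · exact (hf.continuous.mul (hcont (hζ k))).continuousOn.integrableOn_compact hΩ.isCompact
end

/-! ### Radial vector fields, with the singularity at the centre filled in -/

section

variable {m : ℕ} {Ω : Set (EuclideanSpace ℝ (Fin m))}

/-- The divergence theorem for the vector field `H(y) (y - x)`. -/
theorem IsPiecewiseC1Body.setIntegral_divergence_radial (hm : 2 ≤ m) (hΩ : IsPiecewiseC1Body Ω)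
    {H : EuclideanSpace ℝ (Fin m) → ℝ} (hH : ContDiff ℝ 1 H) (x : EuclideanSpace ℝ (Fin m)) :
    ∫ y in Ω, (fderiv ℝ H y (y - x) + m * H y)
      = ∫ y in frontier Ω, H y * inner ℝ (y - x) (outerUnitNormal Ω y) ∂μHE[m - 1] := by
  obtain ⟨R, hR0, hR⟩ : ∃ R > 0, Ω ⊆ Metric.ball 0 R := by
    obtain ⟨R, hR⟩ := hΩ.isCompact.isBounded.subset_ball 0
    exact ⟨max R 1, by positivity, hR.trans (Metric.ball_subset_ball (le_max_left _ _))⟩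
  -- The factor `χ`, equal to `1` near `Ω`, makes the components of `H(y)(y - x)` compactly
  -- supported without changing either side.
  let χ : ContDiffBump (0 : EuclideanSpace ℝ (Fin m)) := ⟨R, R + 1, hR0, by linarith⟩
  have hχ : ContDiff ℝ 1 χ := χ.contDiff
  have hχ1 : ∀ y ∈ Ω, χ =ᶠ[𝓝 y] fun _ => 1 := fun y hy => by
    filter_upwards [Metric.isOpen_ball.mem_nhds (hR hy)] with z hz
    exact χ.one_of_mem_closedBall (Metric.ball_subset_closedBall hz)
  set e : Fin m → EuclideanSpace ℝ (Fin m) := fun i => EuclideanSpace.single i 1 with he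
  set f : Fin m → EuclideanSpace ℝ (Fin m) → ℝ := fun i y => χ y * (H y * (y i - x i)) with hf
  have hproj : ∀ i, ContDiff ℝ 1 fun y : EuclideanSpace ℝ (Fin m) => y i - x i := fun i =>
    (EuclideanSpace.proj (𝕜 := ℝ) i).contDiff.sub contDiff_const
  have hfc : ∀ i, ContDiff ℝ 1 (f i) := fun i => hχ.mul (hH.mul (hproj i))
  have hfs : ∀ i, HasCompactSupport (f i) := fun i => χ.hasCompactSupport.mul_right
  have hdef : ∀ i, ∫ y in Ω, fderiv ℝ (f i) y (e i)
      = ∫ y in frontier Ω, f i y * inner ℝ (e i) (outerUnitNormal Ω y) ∂μHE[m - 1] := fun i =>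
    sub_eq_zero.1 (hΩ.divergenceDefect_eq_zero hm (e i) (hfc i) (hfs i))
  have hsum := Finset.sum_congr (rfl : (Finset.univ : Finset (Fin m)) = Finset.univ)
    fun i _ => hdef i
  have hd : ∀ i, ∀ y ∈ Ω, fderiv ℝ (f i) y (e i) = (y i - x i) * fderiv ℝ H y (e i) + H y := by
    intro i y hy
    have h1 : f i =ᶠ[𝓝 y] fun y => H y * (y i - x i) := by
      filter_upwards [hχ1 y hy] with z hz
      simp [hf, hz]
    have h2 : HasFDerivAt (fun y : EuclideanSpace ℝ (Fin m) => y i - x i)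
        (EuclideanSpace.proj (𝕜 := ℝ) i) y :=
      (EuclideanSpace.proj (𝕜 := ℝ) i).hasFDerivAt.sub_const _
    rw [h1.fderiv_eq, ((hH.differentiable one_ne_zero y).hasFDerivAt.fun_mul h2).fderiv]
    simp [he]
    ring
  have hi1 : ∀ i, IntegrableOn (fun y => fderiv ℝ (f i) y (e i)) Ω := fun i =>
    (((hfc i).continuous_fderiv one_ne_zero).clm_apply
      continuous_const).continuousOn.integrableOn_compact hΩ.isCompact
  have hi2 : ∀ i, IntegrableOn (fun y => f i y * inner ℝ (e i) (outerUnitNormal Ω y)) (frontier Ω)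
      μHE[m - 1] := fun i => by
    have := hΩ.integrableOn_inner_normal (F := fun y => f i y • e i)
      ((hfc i).continuous.smul continuous_const).continuousOn
    simpa only [real_inner_smul_left] using this
  rw [← integral_finsetSum _ fun i _ => hi1 i, ← integral_finsetSum _ fun i _ => hi2 i] at hsum
  have hexp : ∀ w : EuclideanSpace ℝ (Fin m), w = ∑ i, w i • e i := fun w => by
    conv_lhs => rw [← (EuclideanSpace.basisFun (Fin m) ℝ).sum_repr w]
    simp [he]
  rw [setIntegral_congr_fun hΩ.isCompact.measurableSet
    (g := fun y => ∑ i, fderiv ℝ (f i) y (e i)), hsum]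
  · refine setIntegral_congr_fun isClosed_frontier.measurableSet fun y hy => ?_
    have hy1 : χ y = 1 := (hχ1 y (hΩ.isCompact.isClosed.frontier_subset hy)).eq_of_nhds
    simp only [hf, hy1, one_mul]
    conv_rhs => rw [hexp (y - x), sum_inner, Finset.mul_sum]
    refine Finset.sum_congr rfl fun i _ => ?_
    rw [real_inner_smul_left, PiLp.sub_apply]
    ring
  · intro y hy
    simp only
    rw [Finset.sum_congr rfl fun i _ => hd i y hy, Finset.sum_add_distrib]
    conv_lhs => rw [hexp (y - x), map_sum]
    simp

/-- The extension of a `C¹` function on `(0, ∞)` from `[a, ∞)` to the left by its tangent. -/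
noncomputable def tangentExtension (K K' : ℝ → ℝ) (a s : ℝ) : ℝ :=
  K a + ∫ t in a..s, K' (max t a)

section TangentExtension

variable {K K' : ℝ → ℝ} {a : ℝ}

theorem hasDerivAt_tangentExtension (ha : 0 < a) (hK' : ContinuousOn K' (Ioi 0)) (s : ℝ) :
    HasDerivAt (tangentExtension K K' a) (K' (max s a)) s := by
  have hc : Continuous fun t => K' (max t a) :=
    hK'.comp_continuous (by fun_prop) fun t => ha.trans_le (le_max_right _ _)
  exact (intervalIntegral.integral_hasDerivAt_right (hc.intervalIntegrable _ _)
    (hc.stronglyMeasurableAtFilter _ _) hc.continuousAt).const_add _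

theorem contDiff_tangentExtension (ha : 0 < a) (hK' : ContinuousOn K' (Ioi 0)) :
    ContDiff ℝ 1 (tangentExtension K K' a) := by
  have hd := hasDerivAt_tangentExtension (K := K) ha hK'
  rw [contDiff_one_iff_deriv]
  refine ⟨fun s => (hd s).differentiableAt, ?_⟩
  rw [funext fun s => (hd s).deriv]
  exact hK'.comp_continuous (by fun_prop) fun t => ha.trans_le (le_max_right _ _)

theorem tangentExtension_of_le (ha : 0 < a) (hK : ∀ s > 0, HasDerivAt K (K' s) s)
    (hK' : ContinuousOn K' (Ioi 0)) {s : ℝ} (hs : a ≤ s) : tangentExtension K K' a s = K s := by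
  have h1 : ∫ t in a..s, K' (max t a) = ∫ t in a..s, K' t :=
    intervalIntegral.integral_congr fun t ht => by
      rw [uIcc_of_le hs] at ht
      simp only [max_eq_left ht.1]
  have hsub : uIcc a s ⊆ Ioi 0 := fun t ht => by
    rw [uIcc_of_le hs] at ht
    exact ha.trans_le ht.1
  rw [tangentExtension, h1, intervalIntegral.integral_eq_sub_of_hasDerivAt
    (fun t ht => hK t (hsub ht)) (hK'.mono hsub).intervalIntegrable]
  ring

theorem tangentExtension_of_ge {s : ℝ} (hs : s ≤ a) :
    tangentExtension K K' a s = K a + K' a * (s - a) := by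
  have h1 : ∫ t in a..s, K' (max t a) = ∫ t in a..s, K' a :=
    intervalIntegral.integral_congr fun t ht => by
      rw [uIcc_of_ge hs] at ht
      simp only [max_eq_right ht.2]
  rw [tangentExtension, h1, intervalIntegral.integral_const, smul_eq_mul]
  ring

end TangentExtension

/-- `Γ(m/2 + 1) = (m/2) Γ(m/2)` identifies the Gamma formula with `m` times the volume of the unit
ball, the factor that appears in integration in polar coordinates. -/
theorem unitSphereArea_eq (hm : 0 < m) : unitSphereArea m
    = m * volume.real (Metric.ball (0 : EuclideanSpace ℝ (Fin m)) 1) := by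
  have : Nonempty (Fin m) := ⟨⟨0, hm⟩⟩
  have hm' : (m : ℝ) / 2 ≠ 0 := by positivity
  rw [measureReal_def, EuclideanSpace.volume_ball, Fintype.card_fin, ENNReal.ofReal_one, one_pow, one_mul,
    ENNReal.toReal_ofReal (by have := Real.Gamma_pos_of_pos (show (0 : ℝ) < m / 2 + 1 by positivity);
                              positivity), Real.Gamma_add_one hm', unitSphereArea,
    Real.sqrt_eq_rpow, ← Real.rpow_natCast, ← Real.rpow_mul Real.pi_nonneg]
  have hG := (Real.Gamma_pos_of_pos (show (0 : ℝ) < m / 2 by positivity)).ne'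
  have hm0 : (m : ℝ) ≠ 0 := by positivity
  rw [show (1 : ℝ) / 2 * m = m / 2 by ring]
  field_simp

/-- The integral over a ball of the divergence of the vector field
`(c + b (|y - x|² - ε²)) (y - x)`. -/
theorem setIntegral_ball_divergence (hm : 0 < m) (x : EuclideanSpace ℝ (Fin m)) {ε : ℝ}
    (hε : 0 < ε) (b c : ℝ) :
    ∫ y in Metric.ball x ε, (2 * b * ‖y - x‖ ^ 2 + m * (c + b * (‖y - x‖ ^ 2 - ε ^ 2)))
      = unitSphereArea m * (c * ε ^ m) := by
  set F : ℝ → ℝ := fun r => 2 * b * r ^ 2 + m * (c + b * (r ^ 2 - ε ^ 2)) with hF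
  have : Nonempty (Fin m) := ⟨⟨0, hm⟩⟩
  have hnt : Nontrivial (EuclideanSpace ℝ (Fin m)) := by
    apply Module.nontrivial_of_finrank_pos (R := ℝ)
    rwa [finrank_euclideanSpace_fin]
  have h1 : ∫ y in Metric.ball x ε, F ‖y - x‖
      = ∫ y : EuclideanSpace ℝ (Fin m), (Iio ε).indicator F ‖y‖ := by
    rw [← integral_indicator Metric.isOpen_ball.measurableSet,
      ← integral_sub_right_eq_self (fun y => (Iio ε).indicator F ‖y‖) x]
    refine integral_congr_ae (Eventually.of_forall fun y => ?_)
    simp only [indicator, Metric.mem_ball, dist_eq_norm, mem_Iio]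
  rw [h1, integral_fun_norm_addHaar volume, finrank_euclideanSpace_fin, unitSphereArea_eq hm,
    nsmul_eq_mul, smul_eq_mul, mul_assoc]
  congr 2
  have h2 : ∫ r in Ioi (0 : ℝ), r ^ (m - 1) • (Iio ε).indicator F r
      = ∫ r in (0 : ℝ)..ε, r ^ (m - 1) * F r := by
    rw [intervalIntegral.integral_of_le hε.le, integral_Ioc_eq_integral_Ioo,
      ← Ioi_inter_Iio, ← Measure.restrict_restrict_of_subset inter_subset_left,
      ← integral_indicator (measurableSet_Ioi.inter measurableSet_Iio)]
    refine setIntegral_congr_fun measurableSet_Ioi fun r hr => ?_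
    have hr' : 0 < r := hr
    simp [indicator, hr']
  -- The primitive is `r^m` times the radial factor of the field, the flux through the sphere of
  -- radius `r` up to the area constant. At `r = ε` the term with `b` drops out.
  rw [h2, intervalIntegral.integral_eq_sub_of_hasDerivAt
    (f := fun r => c * r ^ m + b * r ^ m * (r ^ 2 - ε ^ 2))]
  · simp [hm.ne']
  · intro r _
    have h3 : HasDerivAt (fun r : ℝ => r ^ m) (m * r ^ (m - 1)) r := hasDerivAt_pow m r
    have h4 := (h3.const_mul c).add ((h3.const_mul b).mul
      ((hasDerivAt_pow 2 r).sub_const (ε ^ 2)))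
    refine h4.congr_deriv ?_
    obtain ⟨k, rfl⟩ : ∃ k, m = k + 1 := ⟨m - 1, by omega⟩
    simp only [hF, Nat.add_sub_cancel, pow_succ]
    push_cast
    ring
  · exact (by fun_prop : Continuous fun r => r ^ (m - 1) * F r).intervalIntegrable _ _

section Radial

variable {K K' : ℝ → ℝ}

theorem fderiv_comp_norm_sq {k : ℝ → ℝ} {k' : ℝ} {x y : EuclideanSpace ℝ (Fin m)}
    (hk : HasDerivAt k k' (‖y - x‖ ^ 2)) :
    fderiv ℝ (fun y => k (‖y - x‖ ^ 2)) y (y - x) = 2 * ‖y - x‖ ^ 2 * k' := by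
  have h1 : HasFDerivAt (fun y : EuclideanSpace ℝ (Fin m) => ‖y - x‖ ^ 2)
      (2 • (innerSL ℝ (y - x))) y :=
    ((hasFDerivAt_id y).sub_const x).norm_sq
  have h2 : HasFDerivAt (fun y => k (‖y - x‖ ^ 2)) (k' • (2 • (innerSL ℝ (y - x)))) y :=
    hk.comp_hasFDerivAt y h1
  rw [h2.fderiv]
  simp only [smul_apply, innerSL_apply_apply, real_inner_self_eq_norm_sq,
    smul_eq_mul, nsmul_eq_mul]
  push_cast
  ring

/-- The divergence theorem for the extension of the vector field `K(|y - x|²) (y - x)` to the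
ball of radius `ε` around `x`. -/
theorem IsPiecewiseC1Body.setIntegral_divergence_tangentExtension (hm : 2 ≤ m)
    (hΩ : IsPiecewiseC1Body Ω) (hK' : ContinuousOn K' (Ioi 0))
    (x : EuclideanSpace ℝ (Fin m)) {a : ℝ} (ha : 0 < a) :
    ∫ y in Ω, (2 * ‖y - x‖ ^ 2 * K' (max (‖y - x‖ ^ 2) a)
        + m * tangentExtension K K' a (‖y - x‖ ^ 2))
      = ∫ y in frontier Ω, tangentExtension K K' a (‖y - x‖ ^ 2) *
          inner ℝ (y - x) (outerUnitNormal Ω y) ∂μHE[m - 1] := by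
  -- The radial factor is a function of `‖y - x‖ ^ 2`, not of `‖y - x‖`, so it is `C¹` at the centre
  -- too.
  have hH : ContDiff ℝ 1 fun y : EuclideanSpace ℝ (Fin m) =>
      tangentExtension K K' a (‖y - x‖ ^ 2) :=
    (contDiff_tangentExtension ha hK').comp ((contDiff_id.sub contDiff_const).norm_sq ℝ)
  rw [← hΩ.setIntegral_divergence_radial hm hH x]
  refine setIntegral_congr_fun hΩ.isCompact.measurableSet fun y _ => ?_
  rw [fderiv_comp_norm_sq (hasDerivAt_tangentExtension ha hK' _)]

/-- The divergence theorem for the vector field `K(|y - x|²) (y - x)` and a centre `x ∉ Ω`. -/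
theorem IsPiecewiseC1Body.setIntegral_radial_of_notMem (hm : 2 ≤ m) (hΩ : IsPiecewiseC1Body Ω)
    (hK : ∀ s > 0, HasDerivAt K (K' s) s) (hK' : ContinuousOn K' (Ioi 0))
    {x : EuclideanSpace ℝ (Fin m)} (hx : x ∉ Ω) :
    ∫ y in Ω, (2 * ‖y - x‖ ^ 2 * K' (‖y - x‖ ^ 2) + m * K (‖y - x‖ ^ 2))
      = ∫ y in frontier Ω, K (‖y - x‖ ^ 2) *
          inner ℝ (y - x) (outerUnitNormal Ω y) ∂μHE[m - 1] := by
  obtain ⟨ε, hε, hball⟩ := Metric.isOpen_iff.1 hΩ.isCompact.isClosed.isOpen_compl x hx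
  have hle : ∀ y ∈ Ω, ε ^ 2 ≤ ‖y - x‖ ^ 2 := fun y hy => by
    have : ε ≤ ‖y - x‖ := by
      by_contra hlt
      exact hball (by rwa [Metric.mem_ball, dist_eq_norm, ← not_le]) hy
    gcongr
  have h1 := hΩ.setIntegral_divergence_tangentExtension (K := K) hm hK' x (pow_pos hε 2)
  rw [setIntegral_congr_fun hΩ.isCompact.measurableSet (g := fun y =>
      2 * ‖y - x‖ ^ 2 * K' (‖y - x‖ ^ 2) + m * K (‖y - x‖ ^ 2)) (fun y hy => by
      simp only [tangentExtension_of_le (pow_pos hε 2) hK hK' (hle y hy), max_eq_left (hle y hy)]),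
    setIntegral_congr_fun (μ := μHE[m - 1]) isClosed_frontier.measurableSet (g := fun y =>
      K (‖y - x‖ ^ 2) * inner ℝ (y - x) (outerUnitNormal Ω y)) (fun y hy => by
      simp only [tangentExtension_of_le (pow_pos hε 2) hK hK'
        (hle y (hΩ.isCompact.isClosed.frontier_subset hy))])] at h1
  exact h1

/-- The divergence theorem for the vector field `K(|y - x|²) (y - x)` and an inner point `x`,
outside a ball around `x`. -/
theorem IsPiecewiseC1Body.setIntegral_radial_diff_ball (hm : 2 ≤ m) (hΩ : IsPiecewiseC1Body Ω)
    (hK : ∀ s > 0, HasDerivAt K (K' s) s) (hK' : ContinuousOn K' (Ioi 0))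
    {x : EuclideanSpace ℝ (Fin m)} {ε : ℝ} (hε : 0 < ε) (hball : Metric.ball x ε ⊆ Ω) :
    ∫ y in Ω \ Metric.ball x ε, (2 * ‖y - x‖ ^ 2 * K' (‖y - x‖ ^ 2) + m * K (‖y - x‖ ^ 2))
      = (∫ y in frontier Ω, K (‖y - x‖ ^ 2) *
          inner ℝ (y - x) (outerUnitNormal Ω y) ∂μHE[m - 1])
        - unitSphereArea m * (K (ε ^ 2) * ε ^ m) := by
  have ha := pow_pos hε 2
  have hle : ∀ y, y ∉ Metric.ball x ε → ε ^ 2 ≤ ‖y - x‖ ^ 2 := fun y hy => by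
    rw [Metric.mem_ball, not_lt, dist_eq_norm] at hy
    gcongr
  have hfr : ∀ y ∈ frontier Ω, y ∉ Metric.ball x ε := fun y hy hyb =>
    hy.2 (interior_maximal hball Metric.isOpen_ball hyb)
  have h1 := hΩ.setIntegral_divergence_tangentExtension (K := K) hm hK' x ha
  have hint : IntegrableOn (fun y => 2 * ‖y - x‖ ^ 2 * K' (max (‖y - x‖ ^ 2) (ε ^ 2))
      + m * tangentExtension K K' (ε ^ 2) (‖y - x‖ ^ 2)) Ω := by
    refine Continuous.continuousOn ?_ |>.integrableOn_compact hΩ.isCompact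
    have c1 : Continuous fun y : EuclideanSpace ℝ (Fin m) =>
        K' (max (‖y - x‖ ^ 2) (ε ^ 2)) :=
      hK'.comp_continuous (by fun_prop) fun t => ha.trans_le (le_max_right _ _)
    have c2 : Continuous fun y : EuclideanSpace ℝ (Fin m) =>
        tangentExtension K K' (ε ^ 2) (‖y - x‖ ^ 2) :=
      (contDiff_tangentExtension (K := K) ha hK').continuous.comp (by fun_prop)
    exact ((continuous_const.mul (by fun_prop)).mul c1).add (continuous_const.mul c2)
  have h2 := setIntegral_union (μ := volume) (disjoint_sdiff_left (s := Metric.ball x ε) (t := Ω))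
    Metric.isOpen_ball.measurableSet (hint.mono_set sdiff_subset) (hint.mono_set hball)
  rw [sdiff_union_of_subset hball] at h2
  -- Inside the ball the extension is affine in `‖y - x‖ ^ 2`, with `c = K (ε ^ 2)` and `b = K' (ε ^
  -- 2)`. Its integral does not see the slope, so only `K (ε ^ 2)` survives.
  rw [setIntegral_congr_fun (s := Metric.ball x ε) (μ := volume) Metric.isOpen_ball.measurableSet
    (g := fun y => 2 * K' (ε ^ 2) * ‖y - x‖ ^ 2
      + m * (K (ε ^ 2) + K' (ε ^ 2) * (‖y - x‖ ^ 2 - ε ^ 2))) (fun y hy => by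
      have hy' : ‖y - x‖ ^ 2 ≤ ε ^ 2 := by
        rw [Metric.mem_ball, dist_eq_norm] at hy
        gcongr
      simp only [tangentExtension_of_ge hy', max_eq_right hy']
      ring), setIntegral_ball_divergence (by omega) x hε,
    setIntegral_congr_fun (s := Ω \ Metric.ball x ε)
    (hΩ.isCompact.measurableSet.diff Metric.isOpen_ball.measurableSet) (g := fun y =>
      2 * ‖y - x‖ ^ 2 * K' (‖y - x‖ ^ 2) + m * K (‖y - x‖ ^ 2)) (fun y hy => by
      simp only [tangentExtension_of_le ha hK hK' (hle y hy.2), max_eq_left (hle y hy.2)]), h1,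
    setIntegral_congr_fun (μ := μHE[m - 1]) isClosed_frontier.measurableSet (g := fun y =>
      K (‖y - x‖ ^ 2) * inner ℝ (y - x) (outerUnitNormal Ω y)) (fun y hy => by
      simp only [tangentExtension_of_le ha hK hK' (hle y (hfr y hy))])] at h2
  linarith

end Radial
end

/-! ### The renormalized potential as a boundary integral -/

section

variable {m : ℕ} {Ω : Set (EuclideanSpace ℝ (Fin m))}

theorem continuousOn_norm_rpow (x : EuclideanSpace ℝ (Fin m)) (p : ℝ)
    {s : Set (EuclideanSpace ℝ (Fin m))} (hs : x ∉ s) :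
    ContinuousOn (fun y => ‖x - y‖ ^ p) s :=
  ContinuousOn.rpow_const (by fun_prop) fun y hy => Or.inl
    (norm_ne_zero_iff.2 (sub_ne_zero.2 fun h => hs (h ▸ hy)))

/-- In polar coordinates the integrand becomes `r^(m-1) r^(α-m) = r^(α-1)`, which is integrable at
`0` for `α > 0`. -/
theorem integrableOn_norm_rpow (hm : 0 < m) (hΩ : IsCompact Ω) {α : ℝ} (hα : 0 < α)
    (x : EuclideanSpace ℝ (Fin m)) : IntegrableOn (fun y => ‖x - y‖ ^ (α - (m : ℝ))) Ω := by
  have hnt : Nontrivial (EuclideanSpace ℝ (Fin m)) := by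
    apply Module.nontrivial_of_finrank_pos (R := ℝ)
    rwa [finrank_euclideanSpace_fin]
  obtain ⟨R, hR⟩ := hΩ.isBounded.subset_ball x
  refine IntegrableOn.mono_set ?_ hR
  have h1 : IntegrableOn (fun y : EuclideanSpace ℝ (Fin m) => ‖y‖ ^ (α - (m : ℝ)))
      (Metric.ball 0 R) := by
    rw [integrableOn_fun_norm_addHaar volume (f := fun r => r ^ (α - (m : ℝ)))]
    rcases le_or_gt R 0 with hR0 | hR0
    · rw [Ioo_eq_empty (not_lt.2 hR0)]; exact integrableOn_empty
    · have := (intervalIntegral.integrableOn_Ioo_rpow_iff (s := α - 1) hR0).2 (by linarith)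
      refine this.congr_fun (fun r hr => ?_) measurableSet_Ioo
      have e : α - 1 = ((m - 1 : ℕ) : ℝ) + (α - m) := by
        rw [Nat.cast_sub (by omega), Nat.cast_one]
        ring
      simp only
      rw [finrank_euclideanSpace_fin, smul_eq_mul, ← Real.rpow_natCast, ← Real.rpow_add hr.1, e]
  have h2 := (Measure.measurePreserving_sub_left volume x).integrableOn_comp_preimage
    (MeasurableEquiv.subLeft x).measurableEmbedding (f := fun y => ‖y‖ ^ (α - (m : ℝ)))
    (s := Metric.ball 0 R)
  have e : Metric.ball x R = (fun t => x - t) ⁻¹' Metric.ball 0 R := by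
    ext y
    rw [mem_preimage, mem_ball_zero_iff, Metric.mem_ball, dist_comm, dist_eq_norm]
  rw [e]
  exact h2.2 h1

section

variable {α κ : ℝ} {K K' : ℝ → ℝ} {x : EuclideanSpace ℝ (Fin m)}

theorem sq_rpow_half {r : ℝ} (hr : 0 ≤ r) (p : ℝ) : (r ^ 2) ^ (p / 2) = r ^ p := by
  rw [← Real.rpow_natCast, ← Real.rpow_mul hr]
  congr 1
  push_cast
  ring

theorem IsPiecewiseC1Body.setIntegral_norm_rpow_of_notMem (hm : 2 ≤ m) (hΩ : IsPiecewiseC1Body Ω)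
    (hK : ∀ s > 0, HasDerivAt K (K' s) s) (hK' : ContinuousOn K' (Ioi 0))
    (hdiv : ∀ s > 0, 2 * s * K' s + m * K s = κ * s ^ ((α - m) / 2)) (hx : x ∉ Ω) :
    κ * ∫ y in Ω, ‖x - y‖ ^ (α - (m : ℝ)) = ∫ y in frontier Ω, K (‖y - x‖ ^ 2) *
      inner ℝ (y - x) (outerUnitNormal Ω y) ∂μHE[m - 1] := by
  rw [← hΩ.setIntegral_radial_of_notMem hm hK hK' hx, ← integral_const_mul]
  refine setIntegral_congr_fun hΩ.isCompact.measurableSet fun y hy => ?_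
  have : 0 < ‖y - x‖ := norm_pos_iff.2 (sub_ne_zero.2 fun h => hx (h ▸ hy))
  rw [hdiv _ (by positivity), sq_rpow_half this.le, norm_sub_rev]

theorem IsPiecewiseC1Body.setIntegral_norm_rpow_diff_ball (hm : 2 ≤ m) (hΩ : IsPiecewiseC1Body Ω)
    (hK : ∀ s > 0, HasDerivAt K (K' s) s) (hK' : ContinuousOn K' (Ioi 0))
    (hdiv : ∀ s > 0, 2 * s * K' s + m * K s = κ * s ^ ((α - m) / 2))
    {ε : ℝ} (hε : 0 < ε) (hball : Metric.ball x ε ⊆ Ω) :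
    κ * ∫ y in Ω \ Metric.ball x ε, ‖x - y‖ ^ (α - (m : ℝ))
      = (∫ y in frontier Ω, K (‖y - x‖ ^ 2) *
          inner ℝ (y - x) (outerUnitNormal Ω y) ∂μHE[m - 1])
        - unitSphereArea m * (K (ε ^ 2) * ε ^ m) := by
  rw [← hΩ.setIntegral_radial_diff_ball hm hK hK' hε hball, ← integral_const_mul]
  refine setIntegral_congr_fun
    (hΩ.isCompact.measurableSet.diff Metric.isOpen_ball.measurableSet) fun y hy => ?_
  have : 0 < ‖y - x‖ := norm_pos_iff.2 (sub_ne_zero.2 fun h =>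
    hy.2 (h ▸ Metric.mem_ball_self hε))
  rw [hdiv _ (by positivity), sq_rpow_half this.le, norm_sub_rev]

/-- The boundary integral of a vector field `K(|y - x|²) (y - x)` with divergence
`κ |y - x|^(α - m)` is `κ` times the renormalized potential. -/
theorem IsPiecewiseC1Body.potentialExists_and_eq (hm : 2 ≤ m) (hΩ : IsPiecewiseC1Body Ω)
    (hκ : κ ≠ 0) (hK : ∀ s > 0, HasDerivAt K (K' s) s) (hK' : ContinuousOn K' (Ioi 0))
    (hdiv : ∀ s > 0, 2 * s * K' s + m * K s = κ * s ^ ((α - m) / 2))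
    (hneg : α ≤ 0 → ∀ ε > 0,
      unitSphereArea m * (K (ε ^ 2) * ε ^ m) = -κ * divergentTerm m α ε)
    (hpos : 0 < α → Tendsto (fun ε : ℝ => K (ε ^ 2) * ε ^ m) (𝓝[>] 0) (𝓝 0))
    (hx : x ∉ frontier Ω) :
    PotentialExists Ω α x ∧ κ * renormalizedPotential Ω α x
      = ∫ y in frontier Ω, K (‖y - x‖ ^ 2) *
          inner ℝ (y - x) (outerUnitNormal Ω y) ∂μHE[m - 1] := by
  set F := ∫ y in frontier Ω, K (‖y - x‖ ^ 2) *
    inner ℝ (y - x) (outerUnitNormal Ω y) ∂μHE[m - 1] with hF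
  have hsmall : x ∈ interior Ω → ∀ᶠ ε in 𝓝[>] (0 : ℝ), 0 < ε ∧ Metric.ball x ε ⊆ Ω := by
    intro hxi
    obtain ⟨r, hr, hball⟩ := Metric.mem_nhds_iff.1 (mem_interior_iff_mem_nhds.1 hxi)
    filter_upwards [self_mem_nhdsWithin, nhdsWithin_le_nhds (eventually_lt_nhds hr)] with ε h1 h2
    exact ⟨h1, (Metric.ball_subset_ball h2.le).trans hball⟩
  by_cases h : α ≤ 0 ∧ x ∈ interior Ω
  -- By `hneg` the flux through the small sphere cancels the divergent term exactly, so the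
  -- truncated potential is constant as soon as the ball lies in `Ω`.
  · have hlim : Tendsto (truncatedPotential Ω α x) (𝓝[>] 0) (𝓝 (κ⁻¹ * F)) := by
      refine tendsto_const_nhds.congr' ?_
      filter_upwards [hsmall h.2] with ε ⟨hε, hball⟩
      have h1 := hΩ.setIntegral_norm_rpow_diff_ball hm hK hK' hdiv hε hball
      rw [hneg h.1 ε hε, ← hF] at h1
      rw [truncatedPotential, inv_mul_eq_iff_eq_mul₀ hκ, mul_sub, h1]
      ring
    refine ⟨⟨fun _ => ⟨fun ε hε => ?_, _, hlim⟩, fun hn => absurd h hn⟩, ?_⟩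
    · refine (continuousOn_norm_rpow x _ fun hmem => hmem.2 (Metric.mem_ball_self hε)
        ).integrableOn_compact (hΩ.isCompact.diff Metric.isOpen_ball)
    · rw [renormalizedPotential, if_pos h, hlim.limUnder_eq, mul_inv_cancel_left₀ hκ]
  · rw [renormalizedPotential, if_neg h]
    by_cases hxΩ : x ∈ Ω
    · have hxi : x ∈ interior Ω := by
        by_contra hxi
        exact hx ⟨subset_closure hxΩ, hxi⟩
      have hα : 0 < α := by
        by_contra hα
        exact h ⟨not_lt.1 hα, hxi⟩
      have hint := integrableOn_norm_rpow (by omega) hΩ.isCompact hα x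
      refine ⟨⟨fun h' => absurd h' h, fun _ => hint⟩, ?_⟩
      have hnt : Nontrivial (EuclideanSpace ℝ (Fin m)) := by
        apply Module.nontrivial_of_finrank_pos (R := ℝ)
        rw [finrank_euclideanSpace_fin]; omega
      -- For `α > 0` and an inner point, the identity outside the ball is passed to the limit:
      -- dominated convergence for the volume integral, `hpos` for the flux through the small
      -- sphere.
      have lim1 : Tendsto (fun ε => ∫ y in Ω \ Metric.ball x ε, ‖x - y‖ ^ (α - (m : ℝ)))
          (𝓝[>] 0) (𝓝 (∫ y in Ω, ‖x - y‖ ^ (α - (m : ℝ)))) := by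
        have e : ∀ ε, ∫ y in Ω \ Metric.ball x ε, ‖x - y‖ ^ (α - (m : ℝ))
            = ∫ y in Ω, (Metric.ball x ε)ᶜ.indicator (fun y => ‖x - y‖ ^ (α - (m : ℝ))) y :=
          fun ε => by rw [setIntegral_indicator Metric.isOpen_ball.measurableSet.compl, sdiff_eq]
        simp only [e]
        refine tendsto_integral_filter_of_dominated_convergence
          (fun y => ‖x - y‖ ^ (α - (m : ℝ))) (Eventually.of_forall fun ε =>
            hint.aestronglyMeasurable.indicator Metric.isOpen_ball.measurableSet.compl)
          (Eventually.of_forall fun ε => Eventually.of_forall fun y => ?_) hint ?_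
        · refine (norm_indicator_le_norm_self _ _).trans_eq ?_
          exact Real.norm_of_nonneg (by positivity)
        · filter_upwards [ae_restrict_of_ae (compl_mem_ae_iff.2 (measure_singleton x))] with y hy
          have hd : 0 < dist y x := dist_pos.2 hy
          refine tendsto_const_nhds.congr' ?_
          filter_upwards [nhdsWithin_le_nhds (eventually_lt_nhds hd)] with ε hε
          rw [indicator_of_mem]
          exact fun hb => not_lt.2 (Metric.mem_ball.1 hb).le hε
      have lim2 := (hpos hα).const_mul (unitSphereArea m)
      rw [mul_zero] at lim2
      have lim3 := lim2.const_sub F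
      rw [sub_zero] at lim3
      refine tendsto_nhds_unique (lim1.const_mul κ) (lim3.congr' ?_)
      filter_upwards [hsmall hxi] with ε ⟨hε, hball⟩
      rw [hΩ.setIntegral_norm_rpow_diff_ball hm hK hK' hdiv hε hball]
    · refine ⟨⟨fun h' => absurd h' h, fun _ => ?_⟩,
        hΩ.setIntegral_norm_rpow_of_notMem hm hK hK' hdiv hxΩ⟩
      exact (continuousOn_norm_rpow x _ hxΩ).integrableOn_compact hΩ.isCompact

end

/-- `K(s) = s^((α-m)/2)` satisfies `2sK' + mK = α s^((α-m)/2)`, and `K(ε²) ε^m = ε^α`. -/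
theorem IsPiecewiseC1Body.potential_of_ne_zero (hm : 2 ≤ m) (hΩ : IsPiecewiseC1Body Ω) {α : ℝ}
    (hα : α ≠ 0) {x : EuclideanSpace ℝ (Fin m)} (hx : x ∉ frontier Ω) :
    PotentialExists Ω α x ∧ α * renormalizedPotential Ω α x = ∫ y in frontier Ω,
      ‖x - y‖ ^ (α - (m : ℝ)) * inner ℝ (y - x) (outerUnitNormal Ω y) ∂μHE[m - 1] := by
  have hKε : ∀ ε : ℝ, 0 < ε → (ε ^ 2) ^ ((α - m) / 2) * ε ^ m = ε ^ α := fun ε hε => by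
    rw [sq_rpow_half hε.le, ← Real.rpow_natCast, ← Real.rpow_add hε, sub_add_cancel]
  have h := hΩ.potentialExists_and_eq hm (α := α) (κ := α) (K := fun s => s ^ ((α - m) / 2))
    (K' := fun s => (α - m) / 2 * s ^ ((α - m) / 2 - 1)) hα
    (fun s hs => Real.hasDerivAt_rpow_const (Or.inl (ne_of_gt hs)))
    (continuousOn_const.mul (ContinuousOn.rpow_const continuousOn_id
      fun s hs => Or.inl (ne_of_gt hs)))
    (fun s hs => by
      rw [Real.rpow_sub_one (ne_of_gt hs)]
      have : s ≠ 0 := ne_of_gt hs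
      field_simp
      ring)
    (fun hα' ε hε => by
      rw [hKε ε hε, divergentTerm, if_neg hα, Real.rpow_neg hε.le]
      field_simp)
    (fun hα' => by
      have h1 : Tendsto (fun ε : ℝ => ε ^ α) (𝓝[>] 0) (𝓝 0) := by
        have : ContinuousAt (fun ε : ℝ => ε ^ α) 0 :=
          Real.continuousAt_rpow_const 0 α (Or.inr hα'.le)
        simpa [ContinuousAt, Real.zero_rpow hα] using this.tendsto.mono_left nhdsWithin_le_nhds
      refine h1.congr' ?_
      filter_upwards [self_mem_nhdsWithin] with ε hε
      exact (hKε ε hε).symm) hx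
  refine ⟨h.1, h.2.trans ?_⟩
  refine integral_congr_ae (Eventually.of_forall fun y => ?_)
  simp only
  rw [sq_rpow_half (norm_nonneg _), norm_sub_rev]

/-- The power `s^(-m/2)` alone has divergence zero. The factor `(1/2) log s` contributes precisely
`s^(-m/2)` when differentiated, and `K(ε²) ε^m = log ε` matches the logarithmic divergent term. -/
theorem IsPiecewiseC1Body.potential_zero (hm : 2 ≤ m) (hΩ : IsPiecewiseC1Body Ω)
    {x : EuclideanSpace ℝ (Fin m)} (hx : x ∉ frontier Ω) :
    PotentialExists Ω 0 x ∧ renormalizedPotential Ω 0 x = ∫ y in frontier Ω,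
      Real.log ‖x - y‖ / ‖x - y‖ ^ m * inner ℝ (y - x) (outerUnitNormal Ω y) ∂μHE[m - 1] := by
  have hKr : ∀ r : ℝ, 0 ≤ r → Real.log (r ^ 2) / 2 * (r ^ 2) ^ (-(m : ℝ) / 2)
      = Real.log r / r ^ m := fun r hr => by
    rw [sq_rpow_half hr, Real.rpow_neg hr, Real.rpow_natCast, Real.log_pow]
    push_cast
    ring
  have h := hΩ.potentialExists_and_eq hm (α := 0) (κ := 1)
    (K := fun s => Real.log s / 2 * s ^ (-(m : ℝ) / 2))
    (K' := fun s => s⁻¹ / 2 * s ^ (-(m : ℝ) / 2)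
      + Real.log s / 2 * (-(m : ℝ) / 2 * s ^ (-(m : ℝ) / 2 - 1))) one_ne_zero
    (fun s hs => ((Real.hasDerivAt_log (ne_of_gt hs)).div_const 2).mul
      (Real.hasDerivAt_rpow_const (Or.inl (ne_of_gt hs))))
    (by
      have c1 : ∀ p : ℝ, ContinuousOn (fun s : ℝ => s ^ p) (Ioi 0) := fun p =>
        ContinuousOn.rpow_const continuousOn_id fun s hs => Or.inl (ne_of_gt hs)
      have c2 : ContinuousOn Real.log (Ioi 0) :=
        Real.continuousOn_log.mono fun s hs => ne_of_gt hs
      have c3 : ContinuousOn (fun s : ℝ => s⁻¹) (Ioi 0) :=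
        continuousOn_id.inv₀ fun s hs => ne_of_gt hs
      exact ((c3.div_const 2).mul (c1 _)).add ((c2.div_const 2).mul (continuousOn_const.mul (c1 _))))
    (fun s hs => by
      rw [Real.rpow_sub_one (ne_of_gt hs), zero_sub]
      have : s ≠ 0 := ne_of_gt hs
      field_simp
      ring)
    (fun _ ε hε => by
      rw [hKr ε hε.le, divergentTerm, if_pos rfl, one_div, Real.log_inv,
        div_mul_cancel₀ _ (pow_pos hε m).ne']
      ring)
    (fun h => absurd h (lt_irrefl 0)) hx
  rw [one_mul] at h
  refine ⟨h.1, h.2.trans ?_⟩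
  refine integral_congr_ae (Eventually.of_forall fun y => ?_)
  simp only
  rw [hKr _ (norm_nonneg _), norm_sub_rev]
end

/-! ### Length of `C¹` curves -/

section

section Curve

variable {m : ℕ} {γ : ℝ → EuclideanSpace ℝ (Fin m)}

theorem euclideanHausdorffMeasure_one_real : (μHE[1] : Measure ℝ) = volume := by
  have := InnerProductSpace.euclideanHausdorffMeasure_eq_volume (V := ℝ)
  rwa [Module.finrank_self] at this

/-- Near a point with non-zero velocity, the length of the image of a set under a `C¹` curve is the
integral of the speed, up to a factor close to `1`. -/
theorem exists_nhds_hausdorffMeasure_image_le {U : Set ℝ} (hU : IsOpen U)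
    (hγ : ContDiffOn ℝ 1 γ U) {t₀ : ℝ} (ht₀ : t₀ ∈ U) (hd : deriv γ t₀ ≠ 0) {k : ℝ} (hk : 1 < k) :
    ∃ W ∈ 𝓝 t₀, ∀ A ⊆ W, MeasurableSet A →
      μHE[1] (γ '' A) ≤ ENNReal.ofReal k * ∫⁻ t in A, ‖deriv γ t‖ₑ ∧
      ∫⁻ t in A, ‖deriv γ t‖ₑ ≤ ENNReal.ofReal k * μHE[1] (γ '' A) := by
  set c := ‖deriv γ t₀‖ with hc
  have hc0 : 0 < c := norm_pos_iff.2 hd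
  -- Chosen so that `(1 + ε) / (1 - ε) = k`: near `t₀` both the speed and the distortion of
  -- distances by `γ` lie between `(1 - ε)c` and `(1 + ε)c`.
  set ε := (k - 1) / (k + 1) with hε
  have hε0 : 0 < ε := div_pos (by linarith) (by linarith)
  have hε1 : 0 < 1 - ε := by
    rw [hε, sub_pos, div_lt_one (by linarith)]; linarith
  have hkε : 1 + ε = k * (1 - ε) := by
    rw [hε]
    have : k + 1 ≠ 0 := by linarith
    field_simp
    ring
  have hcd : ContDiffAt ℝ 1 γ t₀ := hγ.contDiffAt (hU.mem_nhds ht₀)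
  have hstrict : HasStrictDerivAt γ (deriv γ t₀) t₀ := hcd.hasStrictDerivAt one_ne_zero
  have happ := hstrict.isLittleO.def (c := ε * c) (by positivity)
  rw [nhds_prod_eq] at happ
  obtain ⟨s, hs, hs'⟩ := eventually_prod_self_iff'.1 happ
  have hdc : ContinuousAt (fun t => ‖deriv γ t‖) t₀ :=
    ((hγ.continuousOn_deriv_of_isOpen hU le_rfl).continuousAt (hU.mem_nhds ht₀)).norm
  have hup := hdc.eventually_lt_const (show c < (1 + ε) * c by nlinarith)
  have hlo := hdc.eventually_const_lt (show (1 - ε) * c < c by nlinarith)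
  refine ⟨s ∩ {t | ‖deriv γ t‖ < (1 + ε) * c ∧ (1 - ε) * c < ‖deriv γ t‖},
    inter_mem hs (hup.and hlo), fun A hA hAm => ?_⟩
  have hdist : ∀ a ∈ A, ∀ b ∈ A, |dist (γ a) (γ b) - c * dist a b| ≤ ε * c * dist a b := by
    intro a ha b hb
    have h1 := hs' a (hA ha).1 b (hA hb).1
    simp only [ContinuousLinearMap.toSpanSingleton_apply] at h1
    have h2 : c * dist a b = ‖(a - b) • deriv γ t₀‖ := by
      rw [norm_smul, dist_eq_norm, mul_comm]
    rw [h2, dist_eq_norm, dist_eq_norm]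
    exact (abs_norm_sub_norm_le _ _).trans h1
  set K₁ : NNReal := ⟨(1 + ε) * c, by positivity⟩ with hK₁
  set K₂ : NNReal := ⟨((1 - ε) * c)⁻¹, by positivity⟩ with hK₂
  have hlip : LipschitzOnWith K₁ γ A := by
    refine LipschitzOnWith.of_dist_le_mul fun a ha b hb => ?_
    change _ ≤ (1 + ε) * c * _
    have := (abs_le.1 (hdist a ha b hb)).2
    linarith
  have hanti : ∀ a ∈ A, ∀ b ∈ A, dist a b ≤ K₂ * dist (γ a) (γ b) := by
    intro a ha b hb
    change _ ≤ ((1 - ε) * c)⁻¹ * _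
    rw [le_inv_mul_iff₀ (by positivity)]
    have := (abs_le.1 (hdist a ha b hb)).1
    linarith
  have m1 := hlip.euclideanHausdorffMeasure_image_le 1
  have m2 := euclideanHausdorffMeasure_le_mul_image hanti 1
  rw [euclideanHausdorffMeasure_one_real, pow_one] at m1 m2
  have e1 : (K₁ : ENNReal) = ENNReal.ofReal k * ENNReal.ofReal ((1 - ε) * c) := by
    rw [← ENNReal.ofReal_mul (by linarith), ← mul_assoc, ← hkε, ENNReal.ofReal,
      Real.toNNReal_of_nonneg (by positivity)]
    rfl
  have e2 : ENNReal.ofReal ((1 - ε) * c) * K₂ = 1 := by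
    rw [show (K₂ : ENNReal) = ENNReal.ofReal ((1 - ε) * c)⁻¹ by
      rw [ENNReal.ofReal, Real.toNNReal_of_nonneg (by positivity)]; rfl,
      ← ENNReal.ofReal_mul (by positivity), mul_inv_cancel₀ (by positivity), ENNReal.ofReal_one]
  have e3 : ENNReal.ofReal ((1 + ε) * c) = K₁ := by
    rw [ENNReal.ofReal, Real.toNNReal_of_nonneg (by positivity)]
    rfl
  have i1 : ENNReal.ofReal ((1 - ε) * c) * volume A ≤ ∫⁻ t in A, ‖deriv γ t‖ₑ := by
    rw [← setLIntegral_const]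
    refine setLIntegral_mono' hAm fun t ht => ?_
    rw [← ofReal_norm]
    exact ENNReal.ofReal_le_ofReal (hA ht).2.2.le
  have i2 : ∫⁻ t in A, ‖deriv γ t‖ₑ ≤ K₁ * volume A := by
    rw [← setLIntegral_const, ← e3]
    refine setLIntegral_mono' hAm fun t ht => ?_
    rw [← ofReal_norm]
    exact ENNReal.ofReal_le_ofReal (hA ht).2.1.le
  constructor
  · refine m1.trans ?_
    rw [e1, mul_assoc]
    gcongr
  · refine i2.trans ?_
    calc (K₁ : ENNReal) * volume A
        ≤ ENNReal.ofReal k * ENNReal.ofReal ((1 - ε) * c) * (K₂ * μHE[1] (γ '' A)) := by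
          rw [e1]; gcongr
      _ = ENNReal.ofReal k * (ENNReal.ofReal ((1 - ε) * c) * K₂) * μHE[1] (γ '' A) := by ring
      _ = _ := by rw [e2, mul_one]

/-- The length of the image of a set under an injective `C¹` curve with non-zero velocity is the
integral of the speed. -/
theorem hausdorffMeasure_image_eq_lintegral_norm_deriv {U : Set ℝ} (hU : IsOpen U)
    (hne : U.Nonempty) (hγ : ContDiffOn ℝ 1 γ U) (hd : ∀ t ∈ U, deriv γ t ≠ 0) (hinj : InjOn γ U)
    {A : Set ℝ} (hA : MeasurableSet A) (hAU : A ⊆ U) :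
    μHE[1] (γ '' A) = ∫⁻ t in A, ‖deriv γ t‖ₑ := by
  -- Countably many of the local neighbourhoods cover `U`. Cut into disjoint pieces, they give the
  -- local inequalities with the same factor `k` for all of `A`, because injectivity keeps the
  -- images disjoint; then `k` tends to `1`.
  have key : ∀ k : ℝ, 1 < k →
      μHE[1] (γ '' A) ≤ ENNReal.ofReal k * ∫⁻ t in A, ‖deriv γ t‖ₑ ∧
      ∫⁻ t in A, ‖deriv γ t‖ₑ ≤ ENNReal.ofReal k * μHE[1] (γ '' A) := by
    intro k hk
    have hloc : ∀ t : ℝ, ∃ W : Set ℝ, IsOpen W ∧ (t ∈ U → t ∈ W) ∧ ∀ A ⊆ W, MeasurableSet A →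
        μHE[1] (γ '' A) ≤ ENNReal.ofReal k * ∫⁻ t in A, ‖deriv γ t‖ₑ ∧
        ∫⁻ t in A, ‖deriv γ t‖ₑ ≤ ENNReal.ofReal k * μHE[1] (γ '' A) := by
      intro t
      by_cases ht : t ∈ U
      · obtain ⟨W, hW, h⟩ := exists_nhds_hausdorffMeasure_image_le hU hγ ht (hd t ht) hk
        obtain ⟨W', hW', hWo, htW⟩ := mem_nhds_iff.1 hW
        exact ⟨W', hWo, fun _ => htW, fun A hA => h A (hA.trans hW')⟩
      · refine ⟨∅, isOpen_empty, fun h => absurd h ht, fun A hA _ => ?_⟩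
        rw [subset_empty_iff.1 hA]
        simp
    choose W hWo hW hWA using hloc
    obtain ⟨T, hTU, hTc, hcover⟩ := TopologicalSpace.countable_cover_nhdsWithin (f := W) (s := U)
      fun t ht => mem_nhdsWithin_of_mem_nhds ((hWo t).mem_nhds (hW t ht))
    have hTne : T.Nonempty := by
      obtain ⟨t, ht⟩ := hne
      obtain ⟨x, hx, -⟩ := mem_iUnion₂.1 (hcover ht)
      exact ⟨x, hx⟩
    obtain ⟨u, rfl⟩ := hTc.exists_eq_range hTne
    set B : ℕ → Set ℝ := fun n => A ∩ disjointed (fun n => W (u n)) n with hB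
    have hBm : ∀ n, MeasurableSet (B n) := fun n =>
      hA.inter (MeasurableSet.disjointed (fun i => (hWo (u i)).measurableSet) n)
    have hBd : Pairwise (Function.onFun Disjoint B) := fun i j hij =>
      ((disjoint_disjointed _) hij).mono inter_subset_right inter_subset_right
    have hBU : ⋃ n, B n = A := by
      rw [← inter_iUnion, iUnion_disjointed, inter_eq_left]
      intro t ht
      obtain ⟨x, ⟨n, rfl⟩, hx⟩ := mem_iUnion₂.1 (hcover (hAU ht))
      exact mem_iUnion.2 ⟨n, hx⟩
    have hBA : ∀ n, B n ⊆ U := fun n => inter_subset_left.trans hAU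
    have hBW := fun n => hWA (u n) (B n)
      (inter_subset_right.trans (disjointed_subset (fun n => W (u n)) n)) (hBm n)
    have hl : ∫⁻ t in A, ‖deriv γ t‖ₑ = ∑' n, ∫⁻ t in B n, ‖deriv γ t‖ₑ := by
      rw [← lintegral_iUnion hBm hBd, hBU]
    have hr : μHE[1] (γ '' A) = ∑' n, μHE[1] (γ '' B n) := by
      rw [← measure_iUnion, ← image_iUnion, hBU]
      · intro i j hij
        exact (disjoint_image_image fun a ha b hb hab =>
          disjoint_left.1 (hBd hij) ha ((hinj (hBA i ha) (hBA j hb) hab) ▸ hb))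
      · exact fun n => (hBm n).image_of_continuousOn_injOn (hγ.continuousOn.mono (hBA n))
          (hinj.mono (hBA n))
    rw [hl, hr, ← ENNReal.tsum_mul_left, ← ENNReal.tsum_mul_left]
    exact ⟨ENNReal.tsum_le_tsum fun n => (hBW n).1, ENNReal.tsum_le_tsum fun n => (hBW n).2⟩
  have hlim : ∀ X Y : ENNReal, (∀ k : ℝ, 1 < k → X ≤ ENNReal.ofReal k * Y) → X ≤ Y := by
    intro X Y h
    have h1 : Tendsto (fun k : ℝ => ENNReal.ofReal k * Y) (𝓝[>] 1) (𝓝 Y) := by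
      have := ENNReal.Tendsto.mul_const (b := Y)
        ((ENNReal.tendsto_ofReal (tendsto_id (x := 𝓝 (1 : ℝ)))).mono_left
          (nhdsWithin_le_nhds (s := Ioi 1))) (Or.inl (by simp))
      simpa using this
    exact ge_of_tendsto h1 (by filter_upwards [self_mem_nhdsWithin] with k hk using h k hk)
  exact le_antisymm (hlim _ _ fun k hk => (key k hk).1) (hlim _ _ fun k hk => (key k hk).2)

/-- This restates the length formula as an identity of measures, from which the change of variables
for integrals along an arc follows. -/
theorem map_withDensity_norm_deriv {U : Set ℝ} (hU : IsOpen U)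
    (hne : U.Nonempty) (hγc : Continuous γ) (hγ : ContDiffOn ℝ 1 γ U)
    (hd : ∀ t ∈ U, deriv γ t ≠ 0) (hinj : InjOn γ U) :
    ((volume.restrict U).withDensity fun t => ‖deriv γ t‖ₑ).map γ
      = (μHE[1]).restrict (γ '' U) := by
  ext B hB
  rw [Measure.map_apply hγc.measurable hB, withDensity_apply _ (hγc.measurable hB),
    Measure.restrict_apply hB, Measure.restrict_restrict (hγc.measurable hB),
    ← hausdorffMeasure_image_eq_lintegral_norm_deriv hU hne hγ hd hinj
      ((hγc.measurable hB).inter hU.measurableSet) inter_subset_right, image_preimage_inter]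

end Curve
end

/-! ### Contour integrals in the plane -/

section

variable {Ω : Set (EuclideanSpace ℝ (Fin 2))}

theorem continuous_rotPlane : Continuous rotPlane := by
  refine (PiLp.continuous_toLp 2 _).comp (continuous_pi fun i => ?_)
  fin_cases i
  · exact (EuclideanSpace.proj (𝕜 := ℝ) (1 : Fin 2)).continuous.neg
  · exact (EuclideanSpace.proj (𝕜 := ℝ) (0 : Fin 2)).continuous

theorem norm_rotPlane (v : EuclideanSpace ℝ (Fin 2)) : ‖rotPlane v‖ = ‖v‖ := by
  simp [EuclideanSpace.norm_eq, rotPlane, Fin.sum_univ_two, add_comm]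

/-- The form is the determinant of `y - x` with its argument, and rotating the argument by `π/2`
turns the determinant into the inner product; flux through the boundary thus becomes circulation
along it. -/
theorem angularForm_rotPlane (x y v : EuclideanSpace ℝ (Fin 2)) :
    angularForm x y (rotPlane v) = inner ℝ (y - x) v := by
  simp [angularForm, rotPlane, PiLp.inner_apply, Fin.sum_univ_two]
  ring

theorem continuous_angularForm (x : EuclideanSpace ℝ (Fin 2)) : Continuous (angularForm x) := by
  have h : ∀ i, Continuous fun y : EuclideanSpace ℝ (Fin 2) => y i - x i := fun i =>
    (EuclideanSpace.proj (𝕜 := ℝ) i).continuous.sub continuous_const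
  exact ((h 0).smul continuous_const).sub ((h 1).smul continuous_const)

theorem IsPiecewiseC1Body.integrableOn_apply_positiveUnitTangent (hΩ : IsPiecewiseC1Body Ω)
    {ω : EuclideanSpace ℝ (Fin 2) → EuclideanSpace ℝ (Fin 2) →L[ℝ] ℝ}
    (hω : ContinuousOn ω (frontier Ω)) :
    IntegrableOn (fun y => ω y (positiveUnitTangent Ω y)) (frontier Ω) μHE[1] := by
  have h1 : IntegrableOn ω (frontier Ω) μHE[1] := hΩ.integrableOn_of_continuousOn hω
  have h2 : AEStronglyMeasurable (positiveUnitTangent Ω) ((μHE[1]).restrict (frontier Ω)) :=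
    continuous_rotPlane.comp_aestronglyMeasurable hΩ.aestronglyMeasurable_outerUnitNormal
  refine h1.norm.mono' ?_ (Eventually.of_forall fun y => ?_)
  · exact isBoundedBilinearMap_apply.continuous.comp_aestronglyMeasurable₂ h1.aestronglyMeasurable h2
  · refine ((ω y).le_opNorm _).trans (mul_le_of_le_one_right (norm_nonneg _) ?_)
    rw [positiveUnitTangent, norm_rotPlane]
    exact norm_outerUnitNormal_le Ω y

/-- Only end points of arcs are missing, and finitely many points have length zero. -/
theorem frontier_ae_eq_iUnion_image {k : ℕ} {a b : Fin k → EuclideanSpace ℝ (Fin 2)}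
    {γ : ∀ i, Path (a i) (b i)} (hγ : ⋃ i, range (γ i) = frontier Ω) :
    (⋃ i, (γ i).extend '' Ioo 0 1 : Set _) =ᵐ[μHE[1]] frontier Ω := by
  refine Filter.EventuallyLE.antisymm (LE.le.eventuallyLE ?_) (ae_le_set.2 ?_)
  · rw [← hγ]
    refine iUnion_mono fun i => ?_
    rw [← Path.extend_range]
    exact image_subset_range _ _
  · have hsub : frontier Ω \ ⋃ i, (γ i).extend '' Ioo 0 1 ⊆ range a ∪ range b := by
      rintro y ⟨hy, hy'⟩
      rw [← hγ] at hy
      obtain ⟨i, t, rfl⟩ := mem_iUnion.1 hy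
      by_cases h0 : t = 0
      · left; exact ⟨i, by rw [h0, (γ i).source]⟩
      by_cases h1 : t = 1
      · right; exact ⟨i, by rw [h1, (γ i).target]⟩
      have ht : (t : ℝ) ∈ Ioo (0 : ℝ) 1 :=
        ⟨unitInterval.pos_iff_ne_zero.2 h0, unitInterval.lt_one_iff_ne_one.2 h1⟩
      have hm : γ i t ∈ (γ i).extend '' Ioo 0 1 := ⟨t, ht, (γ i).extend_apply t.2⟩
      exact absurd (mem_iUnion.2 ⟨i, hm⟩) hy'
    have hnull : ∀ y : EuclideanSpace ℝ (Fin 2), μHE[1] {y} = 0 := fun y => by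
      have := Measure.nullSingletonClass_hausdorff (EuclideanSpace ℝ (Fin 2)) (d := (1 : ℕ))
        (by norm_num)
      rw [Measure.euclideanHausdorffMeasure_def, Measure.smul_apply,
        measure_singleton, smul_zero]
    refine measure_mono_null hsub (measure_union_null ?_ ?_)
    · rw [← iUnion_singleton_eq_range]
      exact measure_iUnion_null fun i => hnull _
    · rw [← iUnion_singleton_eq_range]
      exact measure_iUnion_null fun i => hnull _

/-- At a regular boundary point the velocity is the speed times the positive unit tangent, so `ω(γ')
dt` is `ω(τ) ds` under the change of variables along the arc. -/
theorem IsPositiveParametrization.setIntegral_image_eq_curveIntegral (hΩ : IsPiecewiseC1Body Ω)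
    {k : ℕ} {a b : Fin k → EuclideanSpace ℝ (Fin 2)} {γ : ∀ i, Path (a i) (b i)}
    (hγ : IsPositiveParametrization Ω γ)
    {ω : EuclideanSpace ℝ (Fin 2) → EuclideanSpace ℝ (Fin 2) →L[ℝ] ℝ}
    (hω : ContinuousOn ω (frontier Ω)) (i : Fin k) :
    ∫ y in (γ i).extend '' Ioo 0 1, ω y (positiveUnitTangent Ω y) ∂μHE[1]
      = curveIntegral ω (γ i) := by
  set g := (γ i).extend with hg
  have hgc : Continuous g := (γ i).continuous_extend
  have hsub : g '' Ioo 0 1 ⊆ frontier Ω := by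
    rw [← hγ.iUnion_range]
    refine Subset.trans ?_ (subset_iUnion _ i)
    rw [← Path.extend_range]
    exact image_subset_range _ _
  have hmap := map_withDensity_norm_deriv (γ := g) isOpen_Ioo (nonempty_Ioo.2 one_pos) hgc
    ((hγ.contDiffOn i).mono Ioo_subset_Icc_self) (hγ.deriv_ne_zero i)
    fun s hs t ht hst => (hγ.injective i i s hs t ht hst).2
  have hm : Measurable fun t => ‖deriv g t‖ₑ := (measurable_deriv g).enorm
  have hint := (hΩ.integrableOn_apply_positiveUnitTangent hω).mono_set hsub
  have hreg : ∀ᵐ y ∂(μHE[1]).restrict (g '' Ioo 0 1), y ∈ regularBoundary Ω := by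
    have h1 : ∀ᵐ y ∂(μHE[1]).restrict (frontier Ω), y ∈ regularBoundary Ω := by
      rw [← Measure.restrict_congr_set hΩ.frontier_ae_eq]
      exact ae_restrict_mem (measurableSet_regularBoundary Ω)
    exact ae_restrict_of_ae_restrict_of_subset hsub h1
  rw [← hmap] at hreg
  -- Almost every boundary point is regular with respect to arc-length. As the speed has no zero on
  -- `(0, 1)`, this pulls back to almost every parameter.
  have hreg' := (ae_withDensity_iff hm).1 (ae_of_ae_map hgc.aemeasurable hreg)
  rw [← hmap, integral_map hgc.aemeasurable (by rw [hmap]; exact hint.aestronglyMeasurable),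
    integral_withDensity_eq_integral_toReal_smul hm (Eventually.of_forall fun _ => enorm_lt_top),
    curveIntegral_eq_intervalIntegral_deriv, intervalIntegral.integral_of_le zero_le_one,
    integral_Ioc_eq_integral_Ioo]
  refine integral_congr_ae ?_
  filter_upwards [hreg', ae_restrict_mem measurableSet_Ioo] with t ht htI
  have hd := hγ.deriv_ne_zero i t htI
  have hy := ht (by simpa using hd)
  rw [toReal_enorm, smul_eq_mul, ← smul_eq_mul, ← map_smul, positiveUnitTangent,
    ← hγ.positive i t htI _ (isOuterUnitNormal_outerUnitNormal hy)]

theorem IsPiecewiseC1Body.hasContourIntegral (hΩ : IsPiecewiseC1Body Ω)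
    {ω : EuclideanSpace ℝ (Fin 2) → EuclideanSpace ℝ (Fin 2) →L[ℝ] ℝ}
    (hω : ContinuousOn ω (frontier Ω)) :
    HasContourIntegral Ω ω (∫ y in frontier Ω, ω y (positiveUnitTangent Ω y) ∂μHE[1]) := by
  have hint := hΩ.integrableOn_apply_positiveUnitTangent hω
  refine ⟨⟨hint, rfl⟩, fun k a b γ hγ => ⟨fun i => ?_, ?_⟩⟩
  · refine hω.curveIntegrable_of_contDiffOn (hγ.contDiffOn i) fun t => ?_
    rw [← hγ.iUnion_range]
    exact mem_iUnion.2 ⟨i, mem_range_self t⟩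
  · have hae := frontier_ae_eq_iUnion_image hγ.iUnion_range
    have hm : ∀ i, MeasurableSet ((γ i).extend '' Ioo 0 1) := fun i =>
      measurableSet_Ioo.image_of_continuousOn_injOn (γ i).continuous_extend.continuousOn
        fun s hs t ht hst => (hγ.injective i i s hs t ht hst).2
    rw [← setIntegral_congr_set hae, integral_iUnion_fintype hm]
    · exact Finset.sum_congr rfl fun i _ => hγ.setIntegral_image_eq_curveIntegral hΩ hω i
    · rintro i j hij
      refine disjoint_left.2 ?_
      rintro _ ⟨s, hs, rfl⟩ ⟨t, ht, hst⟩
      exact hij (hγ.injective i j s hs t ht hst.symm).1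
    · intro i
      refine hint.mono_set ?_
      rw [← hγ.iUnion_range]
      refine Subset.trans ?_ (subset_iUnion _ i)
      rw [← Path.extend_range]
      exact image_subset_range _ _
end

/-! ### Gradients of functions of the distance, and the final formulas -/

section

section GradientNorm

variable {E : Type*} [NormedAddCommGroup E] [InnerProductSpace ℝ E] [CompleteSpace E] {x y : E}

theorem gradient_norm_sub_rpow (α : ℝ) (hxy : y ≠ x) :
    ∇ (fun z => ‖x - z‖ ^ α) y = (α * ‖x - y‖ ^ (α - 2)) • (y - x) := by
  have h0 : 0 < ‖x - y‖ := norm_pos_iff.2 (sub_ne_zero.2 hxy.symm)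
  have hsq : HasFDerivAt (fun z => ‖z - x‖ ^ 2) (2 • innerSL ℝ (y - x)) y := by
    simpa using ((hasFDerivAt_id y).sub_const x).norm_sq
  have h := hsq.rpow_const (p := α / 2) (Or.inl (by rw [norm_sub_rev]; positivity))
  refine HasGradientAt.gradient (hasGradientAt_iff_hasFDerivAt.2 ?_)
  refine (h.congr_fderiv ?_).congr_of_eventuallyEq (Eventually.of_forall fun z => ?_)
  · ext v
    have : (‖x - y‖ ^ 2) ^ (α / 2 - 1) = ‖x - y‖ ^ (α - 2) := by
      rw [← Real.rpow_natCast, ← Real.rpow_mul h0.le]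
      congr 1
      push_cast
      ring
    simp [norm_sub_rev y x, this]
    ring
  · change ‖x - z‖ ^ α = (‖z - x‖ ^ 2) ^ (α / 2)
    rw [← Real.rpow_natCast, ← Real.rpow_mul (norm_nonneg _), norm_sub_rev]
    congr 1
    push_cast
    ring

theorem gradient_log_norm_sub (hxy : y ≠ x) :
    ∇ (fun z => Real.log ‖x - z‖) y = (‖x - y‖ ^ 2)⁻¹ • (y - x) := by
  have h0 : 0 < ‖x - y‖ := norm_pos_iff.2 (sub_ne_zero.2 hxy.symm)
  have hsq : HasFDerivAt (fun z => ‖z - x‖ ^ 2) (2 • innerSL ℝ (y - x)) y := by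
    simpa using ((hasFDerivAt_id y).sub_const x).norm_sq
  have h := (hsq.log (by rw [norm_sub_rev]; positivity)).const_mul (1 / 2 : ℝ)
  refine HasGradientAt.gradient (hasGradientAt_iff_hasFDerivAt.2 ?_)
  refine (h.congr_fderiv ?_).congr_of_eventuallyEq (Eventually.of_forall fun z => ?_)
  · ext v
    simp [norm_sub_rev y x]
    ring
  · change Real.log ‖x - z‖ = 1 / 2 * Real.log (‖z - x‖ ^ 2)
    rw [Real.log_pow, norm_sub_rev]
    push_cast
    ring

end GradientNorm

theorem IsPiecewiseC1Body.integrableOn_mul_inner_sub_normal {m : ℕ}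
    {Ω : Set (EuclideanSpace ℝ (Fin m))} (hΩ : IsPiecewiseC1Body Ω)
    (x : EuclideanSpace ℝ (Fin m)) {f : EuclideanSpace ℝ (Fin m) → ℝ}
    (hf : ContinuousOn f (frontier Ω)) :
    IntegrableOn (fun y => f y * inner ℝ (y - x) (outerUnitNormal Ω y)) (frontier Ω)
      μHE[m - 1] := by
  have h := hΩ.integrableOn_inner_normal (F := fun y => f y • (y - x))
    (hf.smul (continuousOn_id.sub continuousOn_const))
  simpa only [real_inner_smul_left] using h

theorem continuousOn_log_norm_sub_div_pow {E : Type*} [NormedAddCommGroup E] {x : E} {s : Set E}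
    (hx : x ∉ s) (m : ℕ) :
    ContinuousOn (fun y => Real.log ‖x - y‖ / ‖x - y‖ ^ m) s := by
  have h0 : ∀ y ∈ s, ‖x - y‖ ≠ 0 := fun y hy =>
    norm_ne_zero_iff.2 (sub_ne_zero.2 fun h => hx (h ▸ hy))
  have hc : ContinuousOn (fun y => ‖x - y‖) s :=
    (continuous_const.sub continuous_id).norm.continuousOn
  exact (hc.log h0).div (hc.pow m) fun y hy => pow_ne_zero _ (h0 y hy)
end

theorem mainTheorem8 :
    (∀ (m : ℕ), 2 ≤ m → ∀ (Ω : Set (EuclideanSpace ℝ (Fin m))), IsPiecewiseC1Body Ω →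
      ∀ (α : ℝ) (x : EuclideanSpace ℝ (Fin m)), x ∉ frontier Ω →
        PotentialExists Ω α x ∧
        (α ≠ 0 →
          IntegrableOn (fun y => ‖x - y‖ ^ (α - (m : ℝ)) * inner ℝ (y - x) (outerUnitNormal Ω y))
            (frontier Ω) μHE[m - 1] ∧
          renormalizedPotential Ω α x = 1 / α * ∫ y in frontier Ω,
            ‖x - y‖ ^ (α - (m : ℝ)) * inner ℝ (y - x) (outerUnitNormal Ω y) ∂μHE[m - 1]) ∧
        (α = 0 →
          IntegrableOn
            (fun y => Real.log ‖x - y‖ / ‖x - y‖ ^ m * inner ℝ (y - x) (outerUnitNormal Ω y))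
            (frontier Ω) μHE[m - 1] ∧
          renormalizedPotential Ω 0 x = ∫ y in frontier Ω,
            Real.log ‖x - y‖ / ‖x - y‖ ^ m * inner ℝ (y - x) (outerUnitNormal Ω y) ∂μHE[m - 1])) ∧
    (∀ (Ω : Set (EuclideanSpace ℝ (Fin 2))), IsPiecewiseC1Body Ω →
      ∀ (α : ℝ) (x : EuclideanSpace ℝ (Fin 2)), x ∉ frontier Ω →
        (α ≠ 0 →
          IntegrableOn (fun y => inner ℝ (∇ (fun z => ‖x - z‖ ^ α) y) (outerUnitNormal Ω y))
            (frontier Ω) μHE[1] ∧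
          renormalizedPotential Ω α x = 1 / α ^ 2 * ∫ y in frontier Ω,
            inner ℝ (∇ (fun z => ‖x - z‖ ^ α) y) (outerUnitNormal Ω y) ∂μHE[1] ∧
          ∃ v : ℝ, HasContourIntegral Ω (fun y => ‖x - y‖ ^ (α - 2) • angularForm x y) v ∧
            renormalizedPotential Ω α x = 1 / α * v) ∧
        (α = 0 →
          IntegrableOn
            (fun y => Real.log ‖x - y‖ *
              inner ℝ (∇ (fun z => Real.log ‖x - z‖) y) (outerUnitNormal Ω y))
            (frontier Ω) μHE[1] ∧
          renormalizedPotential Ω 0 x = ∫ y in frontier Ω, Real.log ‖x - y‖ *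
            inner ℝ (∇ (fun z => Real.log ‖x - z‖) y) (outerUnitNormal Ω y) ∂μHE[1] ∧
          HasContourIntegral Ω (fun y => (Real.log ‖x - y‖ / ‖x - y‖ ^ 2) • angularForm x y)
            (renormalizedPotential Ω 0 x))) := by
  refine ⟨fun m hm Ω hΩ α x hx => ⟨?_, fun hα => ⟨?_, ?_⟩, fun hα => ⟨?_, ?_⟩⟩,
    fun Ω hΩ α x hx => ?_⟩
  · rcases eq_or_ne α 0 with rfl | hα
    · exact (hΩ.potential_zero hm hx).1
    · exact (hΩ.potential_of_ne_zero hm hα hx).1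
  · exact hΩ.integrableOn_mul_inner_sub_normal x (continuousOn_norm_rpow x _ hx)
  · rw [← (hΩ.potential_of_ne_zero hm hα hx).2]
    field_simp
  · exact hΩ.integrableOn_mul_inner_sub_normal x (continuousOn_log_norm_sub_div_pow hx m)
  · exact (hΩ.potential_zero hm hx).2
  have hne : ∀ y ∈ frontier Ω, y ≠ x := fun y hy h => hx (h ▸ hy)
  have hmeas : MeasurableSet (frontier Ω) := isClosed_frontier.measurableSet
  refine ⟨fun hα => ?_, fun _ => ?_⟩
  · have hcont : ContinuousOn (fun y => ‖x - y‖ ^ (α - 2)) (frontier Ω) :=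
      continuousOn_norm_rpow x _ hx
    have hV : α * renormalizedPotential Ω α x = ∫ y in frontier Ω,
        ‖x - y‖ ^ (α - 2) * inner ℝ (y - x) (outerUnitNormal Ω y) ∂μHE[1] := by
      simpa using (hΩ.potential_of_ne_zero le_rfl hα hx).2
    -- The gradient of `‖x - z‖ ^ α` carries a factor `α`, which accounts for the second power in `1
    -- / α ^ 2`.
    have heq : EqOn
        (fun y => α * (‖x - y‖ ^ (α - 2) * inner ℝ (y - x) (outerUnitNormal Ω y)))
        (fun y => inner ℝ (∇ (fun z => ‖x - z‖ ^ α) y) (outerUnitNormal Ω y)) (frontier Ω) :=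
      fun y hy => by
        simp only [gradient_norm_sub_rpow α (hne y hy), real_inner_smul_left, mul_assoc]
    have hint := hΩ.integrableOn_mul_inner_sub_normal x hcont
    refine ⟨IntegrableOn.congr_fun (hint.const_mul α) heq hmeas, ?_, _,
      hΩ.hasContourIntegral (hcont.smul (continuous_angularForm x).continuousOn), ?_⟩
    · rw [← setIntegral_congr_fun hmeas heq, integral_const_mul, ← hV]
      field_simp
    · simp only [_root_.smul_apply, positiveUnitTangent, angularForm_rotPlane, smul_eq_mul]
      rw [← hV]
      field_simp
  · have hcont : ContinuousOn (fun y => Real.log ‖x - y‖ / ‖x - y‖ ^ 2) (frontier Ω) :=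
      continuousOn_log_norm_sub_div_pow hx 2
    have hV : renormalizedPotential Ω 0 x = ∫ y in frontier Ω,
        Real.log ‖x - y‖ / ‖x - y‖ ^ 2 * inner ℝ (y - x) (outerUnitNormal Ω y) ∂μHE[1] :=
      (hΩ.potential_zero le_rfl hx).2
    have heq : EqOn
        (fun y => Real.log ‖x - y‖ / ‖x - y‖ ^ 2 * inner ℝ (y - x) (outerUnitNormal Ω y))
        (fun y => Real.log ‖x - y‖ *
          inner ℝ (∇ (fun z => Real.log ‖x - z‖) y) (outerUnitNormal Ω y)) (frontier Ω) :=
      fun y hy => by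
        simp only [gradient_log_norm_sub (hne y hy), real_inner_smul_left, div_eq_mul_inv,
          mul_assoc]
    have hint := hΩ.integrableOn_mul_inner_sub_normal x hcont
    refine ⟨IntegrableOn.congr_fun hint heq hmeas, ?_, ?_⟩
    · rw [← setIntegral_congr_fun hmeas heq, hV]
    · convert hΩ.hasContourIntegral (hcont.smul (continuous_angularForm x).continuousOn) using 1
      · rfl
      · rw [hV]
        simp only [Pi.smul_apply', _root_.smul_apply, positiveUnitTangent, angularForm_rotPlane,
          smul_eq_mul]
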